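/- Let $m,n\in\mathbb N$ and, for $k=1,\dots,m$, let $0<\alpha_k<n$, $0<\beta_k<n$, $0<\rho_k<n$; put $\alpha=\sum_k\alpha_k$, $\beta=\sum_k\beta_k$, $\rho=\sum_k\rho_k$. Assume $n-\beta-\rho=mn-\alpha$ and $0<\beta+\rho<n$. Let $\Delta_k$ be the Laplacian in the variable $x_k\in\mathbb R^n$, and let $\prod_k(-\Delta_k/4\pi^2)^{\alpha_k/4}$ be the operator on functions on $\mathbb R^{mn}$ with Fourier multiplier $\prod_k|\xi_k|^{\alpha_k/2}$, where $\widehat u(\xi)=\int e^{-2\pi i x\cdot\xi}u(x)\,dx$. For a Schwartz function $f\in\mathcal S(\mathbb R^{mn})$ write $$Tf=\prod_{k=1}^m|x_k|^{\rho_k/2}\,(-\Delta_k/4\pi^2)^{\alpha_k/4}\,|x_k|^{\beta_k/2}\,f .$$ Then for every $f\in\mathcal S(\mathbb R^{mn})$ the function $\prod_k|\xi_k|^{\alpha_k/2}\,\bigl(\prod_k|x_k|^{\beta_k/2}f\bigr)^{\wedge}(\xi)$ is in $L^2(\mathbb R^{mn})$, $Tf\in L^2(\mathbb R^{mn})$,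 the function $x\mapsto f(x,\dots,x)$ is in $L^2(\mathbb R^n)$, and $$\int_{\mathbb R^n}|f(\underbrace{x,\dots,x}_{m\text{ slots}})|^2\,dx\le C\int_{\mathbb R^n\times\cdots\times\mathbb R^n}|Tf|^2\,dx_1\cdots dx_m,$$ $$C=\pi^{-mn+\alpha}\prod_{k=1}^m\left[\frac{\Gamma\left(\frac{2n-\alpha_k}4\right)}{\Gamma\left(\frac{\alpha_k}4\right)}\right]^2\;\frac{2^{-mn+\alpha/2}}{\sigma(S^{n-1})}\int_{\mathbb R}H(x)\,dx .$$ Here $\int_{\mathbb R}H\,dx<\infty$ and, with $d\xi,d\eta_1,d\eta_2$ the standard surface measure $\sigma$ on the unit sphere $S^{n-1}\subset\mathbb R^n$ (counting measure if $n=1$), $$H(x)=\int_{S^{n-1}\times S^{n-1}}\prod_{k=1}^m B_k(x,\eta_1,\eta_2)\,d\eta_1\,d\eta_2,$$ $$B_k(x,\eta_1,\eta_2)=\int_{\mathbb R\times S^{n-1}}e^{-(\rho_k-\alpha_k/2)t}\Bigl[\bigl(\cosh(\tfrac x2-t)-\xi\cdot\eta_1\bigr)\bigl(\cosh(\tfrac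 x2+t)-\xi\cdot\eta_2\bigr)\Bigr]^{-(n/2-\alpha_k/4)}\,dt\,d\xi .$$ The constant $C$ is sharp: it is the smallest real constant for which the inequality holds for all $f\in\mathcal S(\mathbb R^{mn})$. No extremals exist: the inequality is strict for every $f\in\mathcal S(\mathbb R^{mn})$ with $f\neq0$; and there is none in the completion either, i.e. if $f_j\in\mathcal S(\mathbb R^{mn})$, $Tf_j\to g$ in $L^2(\mathbb R^{mn})$ and $\int|f_j(x,\dots,x)|^2dx\to C\int|g|^2$, then $g=0$ almost everywhere. -/

import Mathlib

open MeasureTheory Filter Topology FourierTransform SchwartzMap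
open scoped ENNReal

noncomputable section

namespace IteratedSteinWeiss

/-- The product `ℝⁿ × ⋯ × ℝⁿ` (`m` factors) with its Euclidean structure; a point `x` has
blocks `x k : ℝⁿ`, and `volume` is Lebesgue measure on `ℝ^{mn}`. -/
abbrev Space (m n : ℕ) : Type := PiLp 2 (fun _ : Fin m => EuclideanSpace ℝ (Fin n))

/-- The diagonal point `(x, …, x)`. -/
def diag (m : ℕ) {n : ℕ} (x : EuclideanSpace ℝ (Fin n)) : Space m n :=
  WithLp.toLp 2 (fun _ => x)

/-- The weight `∏ₖ |xₖ|^{sₖ/2}`. -/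
def weight {m n : ℕ} (s : Fin m → ℝ) (x : Space m n) : ℝ :=
  ∏ k, ‖x k‖ ^ (s k / 2)

/-- The function `ξ ↦ ∏ₖ |ξₖ|^{αₖ/2} û(ξ)`, i.e. the Fourier transform of
`∏ₖ (-Δₖ/4π²)^{αₖ/4} u`, for an integrable `u`. -/
def fracLapFourier {m n : ℕ} (α : Fin m → ℝ) (u : Space m n → ℂ) (ξ : Space m n) : ℂ :=
  (weight α ξ : ℂ) * 𝓕 u ξ

open Classical in
/-- The operator `∏ₖ (-Δₖ/4π²)^{αₖ/4}` with values in `L²`: the `L²` inverse Fourier transform of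
`∏ₖ |ξₖ|^{αₖ/2} û(ξ)`. It is meaningful if the latter is square integrable (and is set to `0`
otherwise). -/
def fracLap {m n : ℕ} (α : Fin m → ℝ) (u : Space m n → ℂ) :
    Lp ℂ 2 (volume : Measure (Space m n)) :=
  if h : MemLp (fracLapFourier α u) 2 (volume : Measure (Space m n)) then 𝓕⁻ (h.toLp _) else 0

/-- The function `∏ₖ |xₖ|^{βₖ/2} f`. -/
def weighted {m n : ℕ} (β : Fin m → ℝ) (f : Space m n → ℂ) (x : Space m n) : ℂ :=
  (weight β x : ℂ) * f x

/-- The function `∏ₖ |xₖ|^{ρₖ/2} (-Δₖ/4π²)^{αₖ/4} |xₖ|^{βₖ/2} f`. -/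
def iterated {m n : ℕ} (α β ρ : Fin m → ℝ) (f : Space m n → ℂ) : Space m n → ℂ :=
  weighted ρ (fracLap α (weighted β f))

/-- Surface measure on the unit sphere `S^{n-1}`. -/
def surface (n : ℕ) : Measure (Metric.sphere (0 : EuclideanSpace ℝ (Fin n)) 1) :=
  (volume : Measure (EuclideanSpace ℝ (Fin n))).toSphere

/-- The kernel `B(x, η₁, η₂)` attached to one pair of exponents `(a, r) = (αₖ, ρₖ)`. -/
def kernelB (n : ℕ) (a r x : ℝ)
    (η₁ η₂ : Metric.sphere (0 : EuclideanSpace ℝ (Fin n)) 1) : ℝ≥0∞ :=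
  ∫⁻ t : ℝ, ∫⁻ ξ, ENNReal.ofReal (Real.exp (-(r - a / 2) * t)) *
    ENNReal.ofReal
      ((Real.cosh (x / 2 - t) - inner ℝ (ξ : EuclideanSpace ℝ (Fin n)) η₁) *
        (Real.cosh (x / 2 + t) - inner ℝ (ξ : EuclideanSpace ℝ (Fin n)) η₂))
      ^ (-((n : ℝ) / 2 - a / 4)) ∂(surface n)

/-- The kernel `H` on the real line. -/
def kernelH {m : ℕ} (n : ℕ) (α ρ : Fin m → ℝ) (x : ℝ) : ℝ≥0∞ :=
  ∫⁻ η₁, ∫⁻ η₂, ∏ k, kernelB n (α k) (ρ k) x η₁ η₂ ∂(surface n) ∂(surface n)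

/-- The constant `C`. -/
def sharpConst {m : ℕ} (n : ℕ) (α ρ : Fin m → ℝ) : ℝ :=
  Real.pi ^ (-((m : ℝ) * n) + ∑ k, α k) *
    (∏ k, (Real.Gamma ((2 * n - α k) / 4) / Real.Gamma (α k / 4)) ^ 2) *
    ((2 : ℝ) ^ (-((m : ℝ) * n) + (∑ k, α k) / 2) / (surface n).real Set.univ) *
    (∫⁻ x : ℝ, kernelH n α ρ x).toReal

end IteratedSteinWeiss

end

noncomputable section

namespace IteratedSteinWeiss

/-! The restriction of `f` to the diagonal is a positive integral operator applied to `Tf`.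
Inverting the fractional Laplacians by Riesz potentials gives f(x,…,x) = c ∫ K(x,y) Tf(y) dy, where
K(x,y) = |x|^(-β/2) ∏ |x-y_k|^(-(n-α_k/2)) |y_k|^(-ρ_k/2) is `kern` and c is `rieszConst`
(`diag_representation`). Let S be the operator with kernel K. Since K is positive and the functions
Tf are dense in L² (`approx_of_memLp`), the best constant is c²‖S‖².

Now ‖S‖² = ‖SS*‖, and the kernel of SS* (`compKern`) is invariant under rotations and, exactly
because of the balance condition on the exponents, homogeneous of degree -n. Hence p = |x|^(-n/2)
satisfies SS*p = N p with N = `normConst`. Schur's test with weights p and q = S*p gives ‖S‖² ≤ N.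
Equality for some g ≠ 0 would force g = c' q, which is impossible because ‖q‖² = N‖p‖² = ∞; so the
bound is strict on all of L² (`schur_lt`), which excludes extremals in the completion as well.
Conversely, p restricted to the shells e^(-R) < |x| < e^R is an approximate eigenfunction, and
letting R grow shows that N cannot be lowered (`exists_lintegral_kern_sq_gt`).

Writing N in polar coordinates with logarithmic radius, and averaging over the sphere, turns it into
the integral of H (`surface_mul_lintegral_compKern`, `sharpConst_eq`). It is finite because the
kernel of SS* is a product of one-block integrals with explicit power bounds at the origin and on
the unit sphere, while the symmetry x ↦ -x of H reduces large |w| to small |w|.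

The analytic burden lies in making sense of Tf: the weight |x_k|^(β_k/2) destroys smoothness where
x_k = 0. Each power is truncated near its zero and split into dyadic pieces which, rescaled to unit
size, are bounded in the Schwartz space uniformly in the scale (`dyadic_sNorm_le`). Summing
geometric series over the scales gives bounds, independent of the truncation, for the Fourier
transform (`fourier_mulTrunc_le`) and for the fractional derivative (`fracDeriv_mulTrunc_le`).
Dominated convergence and Plancherel then remove the truncation. The same truncations, with negative
exponents, invert the weights away from their zeros and yield density. -/

/-! ### Product measure and anisotropic dilations. -/

/-- The volume of a product of Euclidean spaces is the product measure. -/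
theorem volume_preserving_ofLp (m n : ℕ) :
    MeasurePreserving (WithLp.ofLp : Space m n → Fin m → EuclideanSpace ℝ (Fin n)) := by
  let e := (PiLp.continuousLinearEquiv 2 ℝ (fun _ : Fin m => EuclideanSpace ℝ (Fin n)))
  have hme : Measurable e := e.continuous.measurable
  have hh : (Measure.map e volume).IsAddHaarMeasure := e.isAddHaarMeasure_map _
  have hc := Measure.isAddLeftInvariant_eq_smul (Measure.map e volume)
    (volume : Measure (Fin m → EuclideanSpace ℝ (Fin n)))
  set c := Measure.addHaarScalarFactor (Measure.map e volume)
    (volume : Measure (Fin m → EuclideanSpace ℝ (Fin n)))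
  -- Both measures are translation invariant, hence proportional; the unit cube shows that the
  -- factor `c` is one.
  let Q : Set (EuclideanSpace ℝ (Fin n)) := WithLp.ofLp ⁻¹' (Set.Icc 0 1)
  have hQm : MeasurableSet Q := (PiLp.volume_preserving_ofLp (Fin n)).measurable measurableSet_Icc
  have hQ : volume Q = 1 := by
    rw [(PiLp.volume_preserving_ofLp (Fin n)).measure_preimage measurableSet_Icc.nullMeasurableSet]
    simp [Real.volume_Icc_pi]
  have hP : volume (Set.univ.pi fun _ : Fin m => Q) = 1 := by
    rw [volume_pi_pi]; simp [hQ]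
  have hPm : MeasurableSet (Set.univ.pi fun _ : Fin m => Q) := MeasurableSet.univ_pi fun _ => hQm
  have h2 : Measure.map e volume (Set.univ.pi fun _ : Fin m => Q) = 1 := by
    rw [Measure.map_apply hme hPm]
    -- Currying identifies the space with the Euclidean space over pairs of indices, where the
    -- volume of the cube is known.
    let F := LinearIsometryEquiv.piLpCurry ℝ 2 (fun (_ : Fin m) (_ : Fin n) => ℝ)
    rw [← F.measurePreserving.measure_preimage (hme hPm).nullMeasurableSet]
    have : F ⁻¹' (e ⁻¹' (Set.univ.pi fun _ : Fin m => Q)) = WithLp.ofLp ⁻¹' (Set.Icc 0 1) := by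
      ext x
      simp only [Set.mem_preimage, Set.mem_pi, Set.mem_univ, true_imp_iff, Q, Set.mem_Icc, Pi.le_def]
      constructor
      · intro h; exact ⟨fun ⟨i, j⟩ => (h i).1 j, fun ⟨i, j⟩ => (h i).2 j⟩
      · intro h i; exact ⟨fun j => h.1 ⟨i, j⟩, fun j => h.2 ⟨i, j⟩⟩
    rw [this, (PiLp.volume_preserving_ofLp _).measure_preimage measurableSet_Icc.nullMeasurableSet]
    simp [Real.volume_Icc_pi]
  have hc1 : c = 1 := by
    rw [hc] at h2
    rw [Measure.smul_apply, hP] at h2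
    simpa [ENNReal.smul_def] using h2
  refine ⟨hme, ?_⟩
  rw [hc1, one_smul] at hc
  exact hc

theorem measurableEmbedding_ofLp (m n : ℕ) :
    MeasurableEmbedding (WithLp.ofLp : Space m n → Fin m → EuclideanSpace ℝ (Fin n)) :=
  (MeasurableEquiv.toLp 2 (Fin m → EuclideanSpace ℝ (Fin n))).symm.measurableEmbedding

/-- Tonelli's theorem for products of functions of one variable each. -/
theorem lintegral_pi_prod {m : ℕ} {E : Type*} [MeasurableSpace E]
    (μ : Fin m → Measure E) [∀ i, SigmaFinite (μ i)]
    (f : Fin m → E → ℝ≥0∞) (hf : ∀ i, Measurable (f i)) :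
    ∫⁻ x, ∏ i, f i (x i) ∂(Measure.pi μ) = ∏ i, ∫⁻ y, f i y ∂(μ i) := by
  induction m with
  | zero => simp
  | succ m ih =>
    have h1 := ((measurePreserving_piFinSuccAbove μ 0).symm).lintegral_comp_emb
      (MeasurableEquiv.measurableEmbedding _) (fun x => ∏ i, f i (x i))
    rw [← h1, Fin.prod_univ_succ, ← ih _ _ fun i => hf _, ← lintegral_prod_mul (hf 0).aemeasurable]
    · refine lintegral_congr fun x => ?_
      rw [Fin.prod_univ_succ]
      rfl
    · refine (Finset.measurable_fun_prod _ fun i _ => ?_).aemeasurable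
      exact (hf _).comp (measurable_pi_apply i)

theorem lintegral_space_prod {m n : ℕ} (f : Fin m → EuclideanSpace ℝ (Fin n) → ℝ≥0∞)
    (hf : ∀ i, Measurable (f i)) :
    ∫⁻ x : Space m n, ∏ i, f i (x i) = ∏ i, ∫⁻ y, f i y := by
  rw [← lintegral_pi_prod _ f hf]
  exact (volume_preserving_ofLp m n).lintegral_comp_emb (measurableEmbedding_ofLp m n)
    (fun x => ∏ i, f i (x i))

theorem integral_space_prod {m n : ℕ} (f : Fin m → EuclideanSpace ℝ (Fin n) → ℂ) :
    ∫ x : Space m n, ∏ i, f i (x i) = ∏ i, ∫ y, f i y := by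
  rw [← integral_fintype_prod_volume_eq_prod]
  exact (volume_preserving_ofLp m n).integral_comp (measurableEmbedding_ofLp m n)
    (fun x => ∏ i, f i (x i))

theorem integrable_space_prod {m n : ℕ} (f : Fin m → EuclideanSpace ℝ (Fin n) → ℝ)
    (hf : ∀ i, Integrable (f i)) : Integrable (fun x : Space m n => ∏ i, f i (x i)) :=
  ((volume_preserving_ofLp m n).integrable_comp_emb (measurableEmbedding_ofLp m n)).2
    (Integrable.fintype_prod hf)

/-- The anisotropic dilation `x ↦ (tₖ xₖ)ₖ`. -/
def dil {m n : ℕ} (t : Fin m → ℝ) : Space m n →L[ℝ] Space m n where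
  toFun x := WithLp.toLp 2 fun k => t k • x k
  map_add' x y := by ext k i; simp
  map_smul' c x := by ext k i; simp; ring
  cont := by fun_prop

@[simp] theorem dil_apply {m n : ℕ} (t : Fin m → ℝ) (x : Space m n) (k : Fin m) :
    dil t x k = t k • x k := rfl

theorem dil_dil_inv {m n : ℕ} {t : Fin m → ℝ} (ht : ∀ k, t k ≠ 0) (x : Space m n) :
    dil t (dil (fun k => (t k)⁻¹) x) = x := by
  ext k i; simp [ht k]

theorem dil_inv_dil {m n : ℕ} {t : Fin m → ℝ} (ht : ∀ k, t k ≠ 0) (x : Space m n) :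
    dil (fun k => (t k)⁻¹) (dil t x) = x := by
  ext k i; simp [ht k]

/-- The dilation as an equivalence. -/
def dilEquiv {m n : ℕ} (t : Fin m → ℝ) (ht : ∀ k, t k ≠ 0) : Space m n ≃L[ℝ] Space m n :=
  ContinuousLinearEquiv.equivOfInverse (dil t) (dil fun k => (t k)⁻¹) (dil_inv_dil ht)
    (dil_dil_inv ht)

theorem pi_smul_measure {m : ℕ} {E : Type*} [MeasurableSpace E] (μ : Measure E) [SigmaFinite μ]
    (c : Fin m → ℝ≥0∞) (hc : ∀ i, c i ≠ ∞) :
    Measure.pi (fun i => c i • μ) = (∏ i, c i) • Measure.pi fun _ : Fin m => μ := by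
  have : ∀ i, SigmaFinite (c i • μ) := fun i => by
    lift c to Fin m → NNReal using hc
    exact inferInstanceAs (SigmaFinite ((c i : NNReal) • μ))
  refine Measure.pi_eq fun s _ => ?_
  simp [Measure.pi_pi, Finset.prod_mul_distrib]

/-- Every block scales by its own Jacobian; independent factors are needed because the dyadic scales
of the blocks vary independently. -/
theorem map_dil_volume {m n : ℕ} {t : Fin m → ℝ} (ht : ∀ k, t k ≠ 0) :
    Measure.map (dil t) (volume : Measure (Space m n)) =
      (∏ k, ENNReal.ofReal |(t k ^ n)⁻¹|) • volume := by
  have h1 := volume_preserving_ofLp m n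
  have hm : Measurable (dil (n := n) t) := (dil t).continuous.measurable
  refine (measurableEmbedding_ofLp m n).map_injective ?_
  simp only
  rw [Measure.map_map h1.measurable hm, Measure.map_smul, h1.map_eq]
  have h2 : (WithLp.ofLp ∘ dil t : Space m n → Fin m → EuclideanSpace ℝ (Fin n)) =
      (fun x k => t k • x k) ∘ WithLp.ofLp := rfl
  have hs (k : Fin m) : Measure.map (fun x : EuclideanSpace ℝ (Fin n) => t k • x) volume =
      ENNReal.ofReal |(t k ^ n)⁻¹| • volume := by
    rw [Measure.map_addHaar_smul _ (ht k)]; simp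
  have : ∀ k, SigmaFinite (Measure.map (fun x : EuclideanSpace ℝ (Fin n) => t k • x) volume) :=
    fun k => by
      rw [hs k]
      exact inferInstanceAs (SigmaFinite ((Real.toNNReal |(t k ^ n)⁻¹|) • volume))
  rw [h2, ← Measure.map_map (by fun_prop) h1.measurable, h1.map_eq, volume_pi,
    Measure.pi_map_pi (fun k => by fun_prop)]
  simp_rw [hs]
  exact pi_smul_measure _ _ fun i => by simp

theorem integral_comp_dil {m n : ℕ} {E : Type*} [NormedAddCommGroup E] [NormedSpace ℝ E]
    {t : Fin m → ℝ} (ht : ∀ k, t k ≠ 0) (g : Space m n → E) :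
    ∫ x, g (dil t x) = (∏ k, |(t k ^ n)⁻¹|) • ∫ x, g x := by
  have he : MeasurableEmbedding (dil (n := n) t) :=
    (dilEquiv t ht).toHomeomorph.measurableEmbedding
  rw [← he.integral_map, map_dil_volume ht, integral_smul_measure, ENNReal.toReal_prod]
  simp

theorem inner_dil {m n : ℕ} (t : Fin m → ℝ) (x y : Space m n) :
    inner ℝ (dil t x) y = inner ℝ x (dil t y) := by
  simp [PiLp.inner_apply, inner_smul_left, inner_smul_right]

theorem fourier_comp_dil {m n : ℕ} {t : Fin m → ℝ} (ht : ∀ k, t k ≠ 0) (g : Space m n → ℂ)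
    (ξ : Space m n) :
    𝓕 (fun x => g (dil t x)) ξ = (∏ k, |(t k ^ n)⁻¹| : ℝ) • 𝓕 g (dil (fun k => (t k)⁻¹) ξ) := by
  rw [Real.fourier_eq, Real.fourier_eq,
    ← integral_comp_dil ht (fun v => Real.fourierChar (-inner ℝ v (dil (fun k => (t k)⁻¹) ξ)) • g v)]
  congr 1; ext v
  rw [← inner_dil, dil_inv_dil ht]

theorem fourierInv_comp_dil {m n : ℕ} {t : Fin m → ℝ} (ht : ∀ k, t k ≠ 0) (g : Space m n → ℂ)
    (ξ : Space m n) :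
    𝓕⁻ (fun x => g (dil t x)) ξ =
      (∏ k, |(t k ^ n)⁻¹| : ℝ) • 𝓕⁻ g (dil (fun k => (t k)⁻¹) ξ) := by
  simp only [Real.fourierInv_eq_fourier_neg, fourier_comp_dil ht, map_neg]

/-! ### Power-type majorants and powers of functions of temperate growth. -/

/-- Radial functions with prescribed power behaviour at the origin and at infinity. -/
def powTail (κ τ : ℝ) (r : ℝ) : ℝ := r ^ (-κ) * (1 + r) ^ (-(τ - κ))

/-- In polar coordinates the integrand is at most r^(n-1-κ) on (0,1] and at most r^(n-1-τ) beyond.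
-/
theorem integrable_powTail {n : ℕ} {κ τ : ℝ} (h1 : κ < n) (h2 : (n : ℝ) < τ) :
    Integrable fun x : EuclideanSpace ℝ (Fin n) => powTail κ τ ‖x‖ := by
  rcases Nat.eq_zero_or_pos n with rfl | hn
  · exact Integrable.of_finite
  have : Nontrivial (EuclideanSpace ℝ (Fin n)) := by
    have : Nonempty (Fin n) := ⟨⟨0, hn⟩⟩
    infer_instance
  rw [integrable_fun_norm_addHaar volume (f := powTail κ τ), ← Set.Ioc_union_Ioi_eq_Ioi zero_le_one]
  have hm : Measurable fun y : ℝ => y ^ (Module.finrank ℝ (EuclideanSpace ℝ (Fin n)) - 1) •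
      powTail κ τ y := by
    unfold powTail; fun_prop
  have hcast : ((n - 1 : ℕ) : ℝ) = n - 1 := by push_cast [hn]; ring
  refine IntegrableOn.union ?_ ?_
  · have := (intervalIntegral.intervalIntegrable_rpow' (a := 0) (b := 1)
      (show -1 < (n : ℝ) - 1 - κ by linarith)).1
    refine Integrable.mono' this hm.aestronglyMeasurable ?_
    filter_upwards [ae_restrict_mem measurableSet_Ioc] with y hy
    have hy0 := hy.1
    rw [finrank_euclideanSpace_fin, smul_eq_mul, Real.norm_of_nonneg (by unfold powTail; positivity)]
    unfold powTail
    rw [← Real.rpow_natCast, hcast, ← mul_assoc, ← Real.rpow_add hy0]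
    refine (mul_le_of_le_one_right (by positivity) ?_).trans_eq (by ring_nf)
    exact Real.rpow_le_one_of_one_le_of_nonpos (by linarith) (by linarith)
  · have := integrableOn_Ioi_rpow_of_lt (show (n : ℝ) - 1 - τ < -1 by linarith) zero_lt_one
    refine Integrable.mono' this hm.aestronglyMeasurable ?_
    filter_upwards [ae_restrict_mem measurableSet_Ioi] with y hy
    have hy0 : 0 < y := zero_lt_one.trans hy
    rw [finrank_euclideanSpace_fin, smul_eq_mul, Real.norm_of_nonneg (by unfold powTail; positivity)]
    unfold powTail
    rw [← Real.rpow_natCast, hcast, ← mul_assoc, ← Real.rpow_add hy0]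
    calc _ ≤ y ^ ((n : ℝ) - 1 + -κ) * y ^ (-(τ - κ)) := by
          gcongr ?_ * ?_
          exact Real.rpow_le_rpow_of_nonpos hy0 (by linarith) (by linarith)
      _ = _ := by rw [← Real.rpow_add hy0]; ring_nf

/-- On values above 1/2 all derivatives of y ↦ y^r are polynomially bounded; the singularity at 0 is
never met. -/
theorem hasTemperateGrowth_rpow_comp {H : Type*} [NormedAddCommGroup H] [NormedSpace ℝ H]
    {f : H → ℝ} (hf : f.HasTemperateGrowth) (h : ∀ x, 1 / 2 < f x) (r : ℝ) :
    (fun x => f x ^ r).HasTemperateGrowth := by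
  set t := {y : ℝ | 1 / 2 < y}
  have ht : Set.range f ⊆ t := by
    rintro - ⟨y, rfl⟩
    exact h y
  have hpos : ∀ x ∈ t, (0 : ℝ) < x := fun x hx => lt_trans (by norm_num) hx
  have hdiff : ContDiffOn ℝ ((⊤ : ℕ∞) : WithTop ℕ∞) (fun x : ℝ ↦ x ^ r) t :=
    contDiffOn_fun_id.rpow_const_of_ne fun x hx ↦ (hpos x hx).ne'
  have hunique : UniqueDiffOn ℝ t := (isOpen_lt' (1 / 2)).uniqueDiffOn
  refine Function.HasTemperateGrowth.comp' (g := fun x : ℝ => x ^ r) ht hunique hdiff ?_ hf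
  intro N
  -- The derivatives of order at most `N` have exponents of absolute value at most |r| + N, and both
  -- x and 1/x are at most 2(1+x) when x > 1/2.
  obtain ⟨k, hk⟩ := exists_nat_ge (|r| + N)
  refine ⟨k, (∑ k ∈ Finset.range (N + 1), ‖Polynomial.eval r (descPochhammer ℝ k)‖) * 2 ^ k,
    by positivity, fun n hn x hx => ?_⟩
  have hx0 := hpos x hx
  have hx2 : 1 / 2 < x := hx
  have : ContDiffAt ℝ n (fun x : ℝ ↦ x ^ r) x := Real.contDiffAt_rpow_const <| Or.inl hx0.ne'
  rw [norm_iteratedFDerivWithin_eq_norm_iteratedDerivWithin,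
    iteratedDerivWithin_eq_iteratedDeriv hunique this hx, iteratedDeriv_eq_iterate,
    Real.iter_deriv_rpow_const, norm_mul, mul_assoc]
  have hle : |r - n| ≤ k := by
    have h1 : |r - n| ≤ |r| + n := by simpa using abs_sub r (n : ℝ)
    have h2 : (n : ℝ) ≤ N := by exact_mod_cast hn
    linarith
  gcongr ?_ * ?_
  · have : n ∈ Finset.range (N + 1) := by grind
    apply Finset.single_le_sum (fun _ _ ↦ by positivity) this
  · rw [Real.norm_of_nonneg (by positivity), Real.norm_of_nonneg hx0.le, ← mul_pow]
    have hB : 1 ≤ 2 * (1 + x) := by linarith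
    rw [← Real.rpow_natCast (2 * (1 + x))]
    rcases le_or_gt 0 (r - n) with h0 | h0
    · rw [abs_of_nonneg h0] at hle
      exact (Real.rpow_le_rpow hx0.le (by linarith) h0).trans
        (Real.rpow_le_rpow_of_exponent_le hB hle)
    · rw [abs_of_neg h0] at hle
      have : x ^ (r - n) = (x⁻¹) ^ (-(r - n)) := by
        rw [Real.inv_rpow hx0.le, Real.rpow_neg hx0.le, inv_inv]
      rw [this]
      refine (Real.rpow_le_rpow (by positivity) ?_ (by linarith)).trans
        (Real.rpow_le_rpow_of_exponent_le hB hle)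
      rw [inv_le_comm₀ hx0 (by positivity)]
      refine le_trans ?_ hx2.le
      rw [inv_le_comm₀ (by positivity) (by norm_num)]
      linarith

/-! ### Truncation of a power at the origin and its dyadic decomposition. -/

section Cutoff

variable {n : ℕ}

/-- One minus this function is smooth with compact support. -/
theorem hasTemperateGrowth_smoothTransition {a : ℝ} (ha : 0 < a) (b : ℝ) :
    (fun x : EuclideanSpace ℝ (Fin n) => Real.smoothTransition (a * ‖x‖ ^ 2 - b)).HasTemperateGrowth := by
  have h1 : (fun x : EuclideanSpace ℝ (Fin n) => 1 - Real.smoothTransition (a * ‖x‖ ^ 2 - b)).HasTemperateGrowth := by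
    refine HasCompactSupport.hasTemperateGrowth ?_ ?_
    · refine HasCompactSupport.intro (isCompact_closedBall (0 : EuclideanSpace ℝ (Fin n)) (√((1 + |b|) / a))) fun x hx => ?_
      have hx' : √((1 + |b|) / a) < ‖x‖ := by simpa using hx
      rw [Real.sqrt_lt' (lt_of_le_of_lt (Real.sqrt_nonneg _) hx'), div_lt_iff₀ ha] at hx'
      rw [Real.smoothTransition.one_of_one_le, sub_self]
      have := le_abs_self b
      nlinarith
    · exact contDiff_const.sub (Real.smoothTransition.contDiff.comp
        ((contDiff_const.mul (contDiff_norm_sq ℝ)).sub contDiff_const))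
  have h2 := (Function.HasTemperateGrowth.const (E := EuclideanSpace ℝ (Fin n)) (1 : ℝ)).sub h1
  convert h2 using 1
  ext x; simp

/-- The function `‖x‖ᵇ`, cut off near the origin. -/
def powCut (b : ℝ) (x : EuclideanSpace ℝ (Fin n)) : ℝ := ‖x‖ ^ b * Real.smoothTransition (‖x‖ ^ 2 - 1)

theorem powCut_eq_rpow {b : ℝ} {x : EuclideanSpace ℝ (Fin n)} (hx : 3 / 2 ≤ ‖x‖) : powCut b x = ‖x‖ ^ b := by
  rw [powCut, Real.smoothTransition.one_of_one_le, mul_one]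
  nlinarith [norm_nonneg x]

theorem powCut_nonneg (b : ℝ) (x : EuclideanSpace ℝ (Fin n)) : 0 ≤ powCut b x :=
  mul_nonneg (by positivity) (Real.smoothTransition.nonneg _)

theorem powCut_le (b : ℝ) (x : EuclideanSpace ℝ (Fin n)) : powCut b x ≤ ‖x‖ ^ b :=
  mul_le_of_le_one_right (by positivity) (Real.smoothTransition.le_one _)

/-- ‖x‖² is replaced by ‖x‖² + 1 - S(4‖x‖² - 3), with S the smooth transition: it agrees with ‖x‖²
wherever the cutoff is nonzero and stays above 1/2, so its power b/2 is harmless. -/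
theorem hasTemperateGrowth_powCut (b : ℝ) : (powCut b : EuclideanSpace ℝ (Fin n) → ℝ).HasTemperateGrowth := by
  have h1 : (fun x : EuclideanSpace ℝ (Fin n) => ‖x‖ ^ 2 +
      (1 - Real.smoothTransition (4 * ‖x‖ ^ 2 - 3))).HasTemperateGrowth := by
    have := (Function.hasTemperateGrowth_norm_sq (EuclideanSpace ℝ (Fin n))).add
      ((Function.HasTemperateGrowth.const (E := EuclideanSpace ℝ (Fin n)) (1 : ℝ)).sub
        (hasTemperateGrowth_smoothTransition (n := n) (a := 4) (by norm_num) 3))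
    exact this
  have h2 : ∀ x : EuclideanSpace ℝ (Fin n), 1 / 2 < ‖x‖ ^ 2 + (1 - Real.smoothTransition (4 * ‖x‖ ^ 2 - 3)) := by
    intro x
    rcases le_or_gt (4 * ‖x‖ ^ 2 - 3) 0 with h | h
    · rw [Real.smoothTransition.zero_of_nonpos h]; nlinarith [sq_nonneg ‖x‖]
    · linarith [Real.smoothTransition.le_one (4 * ‖x‖ ^ 2 - 3)]
  have h3 := (hasTemperateGrowth_rpow_comp h1 h2 (b / 2)).mul
    (hasTemperateGrowth_smoothTransition (n := n) (a := 1) (by norm_num) 1)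
  refine Eq.mpr (congrArg _ (funext fun x => ?_)) h3
  simp only [powCut, Pi.mul_apply, one_mul]
  rcases le_or_gt (‖x‖ ^ 2 - 1) 0 with h | h
  · rw [Real.smoothTransition.zero_of_nonpos h]; simp
  · rw [Real.smoothTransition.one_of_one_le (x := 4 * ‖x‖ ^ 2 - 3) (by linarith), sub_self, add_zero,
      ← Real.rpow_natCast, ← Real.rpow_mul (norm_nonneg _)]
    congr 2
    push_cast; ring

/-- The truncation of `‖x‖ᵇ` at scale `2⁻ᴶ`. -/
def trunc (b : ℝ) (J : ℕ) (x : EuclideanSpace ℝ (Fin n)) : ℝ := ((2 : ℝ) ^ (-b)) ^ J * powCut b ((2 : ℝ) ^ J • x)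

/-- The dyadic pieces of `trunc b J`, before rescaling. -/
def piece (b : ℝ) (z : Prop) [Decidable z] (x : EuclideanSpace ℝ (Fin n)) : ℝ :=
  if z then powCut b x else powCut b x - 2 ^ b * powCut b ((2 : ℝ)⁻¹ • x)

theorem hasTemperateGrowth_comp_smul {f : EuclideanSpace ℝ (Fin n) → ℝ} (hf : f.HasTemperateGrowth) (c : ℝ) :
    (fun x => f (c • x)).HasTemperateGrowth :=
  hf.comp (c • ContinuousLinearMap.id ℝ _).hasTemperateGrowth

theorem hasTemperateGrowth_trunc (b : ℝ) (J : ℕ) : (trunc b J : EuclideanSpace ℝ (Fin n) → ℝ).HasTemperateGrowth :=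
  (Function.HasTemperateGrowth.const (E := EuclideanSpace ℝ (Fin n)) (((2 : ℝ) ^ (-b)) ^ J)).mul
    (hasTemperateGrowth_comp_smul (hasTemperateGrowth_powCut b) _)

theorem hasTemperateGrowth_piece (b : ℝ) (z : Prop) [Decidable z] :
    (piece b z : EuclideanSpace ℝ (Fin n) → ℝ).HasTemperateGrowth := by
  unfold piece
  split_ifs
  · exact hasTemperateGrowth_powCut b
  · exact (hasTemperateGrowth_powCut b).sub
      ((Function.HasTemperateGrowth.const (E := EuclideanSpace ℝ (Fin n)) ((2 : ℝ) ^ b)).mul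
        (hasTemperateGrowth_comp_smul (hasTemperateGrowth_powCut b) _))

/-- Beyond radius 3 both cutoffs equal one, and homogeneity makes the two terms cancel. All pieces
but the first therefore have bounded support. -/
theorem piece_eq_zero {b : ℝ} {z : Prop} [Decidable z] (hz : ¬z) {x : EuclideanSpace ℝ (Fin n)} (hx : 3 < ‖x‖) :
    piece b z x = 0 := by
  have h2 : ‖(2 : ℝ)⁻¹ • x‖ = ‖x‖ / 2 := by rw [norm_smul]; norm_num; ring
  rw [piece, if_neg hz, powCut_eq_rpow (by linarith), powCut_eq_rpow (by rw [h2]; linarith), h2,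
    Real.div_rpow (by positivity) (by norm_num)]
  field_simp
  ring

/-- Telescoping: the term of index j > 0 is the difference of the truncations at scales j and j - 1.
-/
theorem trunc_eq_sum (b : ℝ) (J : ℕ) (x : EuclideanSpace ℝ (Fin n)) :
    trunc b J x = ∑ j ∈ Finset.range (J + 1),
      ((2 : ℝ) ^ (-b)) ^ j * piece b (j = 0) ((2 : ℝ) ^ j • x) := by
  induction J with
  | zero => simp [trunc, piece]
  | succ J ih =>
    rw [Finset.sum_range_succ, ← ih]
    simp only [trunc, piece, Nat.succ_ne_zero, if_false, smul_smul]
    have h1 : (2 : ℝ)⁻¹ * 2 ^ (J + 1) = 2 ^ J := by rw [pow_succ]; ring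
    have h2 : (2 : ℝ) ^ (-b) * 2 ^ b = 1 := by rw [← Real.rpow_add two_pos]; simp
    rw [h1, pow_succ ((2 : ℝ) ^ (-b))]
    linear_combination (((2 : ℝ) ^ (-b)) ^ J * powCut b ((2 : ℝ) ^ J • x)) * h2

theorem trunc_nonneg (b : ℝ) (J : ℕ) (x : EuclideanSpace ℝ (Fin n)) : 0 ≤ trunc b J x :=
  mul_nonneg (by positivity) (powCut_nonneg _ _)

theorem scale_rpow (b : ℝ) (J : ℕ) (x : EuclideanSpace ℝ (Fin n)) :
    ((2 : ℝ) ^ (-b)) ^ J * ‖(2 : ℝ) ^ J • x‖ ^ b = ‖x‖ ^ b := by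
  rw [norm_smul, Real.mul_rpow (by positivity) (by positivity), norm_pow, Real.norm_two,
    ← Real.rpow_natCast 2 J, ← Real.rpow_mul zero_le_two, mul_comm (J : ℝ) b,
    Real.rpow_mul zero_le_two, Real.rpow_natCast, ← mul_assoc, ← mul_pow, ← Real.rpow_add two_pos]
  simp

theorem trunc_le (b : ℝ) (J : ℕ) (x : EuclideanSpace ℝ (Fin n)) : trunc b J x ≤ ‖x‖ ^ b := by
  rw [← scale_rpow b J x]
  exact mul_le_mul_of_nonneg_left (powCut_le _ _) (by positivity)

theorem tendsto_trunc (b : ℝ) {x : EuclideanSpace ℝ (Fin n)} (hx : x ≠ 0) :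
    Tendsto (fun J => trunc b J x) atTop (𝓝 (‖x‖ ^ b)) := by
  refine tendsto_const_nhds.congr' ?_
  have h1 : Tendsto (fun J : ℕ => (2 : ℝ) ^ J * ‖x‖) atTop atTop :=
    (tendsto_pow_atTop_atTop_of_one_lt one_lt_two).atTop_mul_const (norm_pos_iff.2 hx)
  filter_upwards [h1.eventually_ge_atTop (3 / 2)] with J hJ
  rw [trunc, powCut_eq_rpow, scale_rpow]
  rwa [norm_smul, norm_pow, Real.norm_two]

end Cutoff

/-! ### Truncated products acting on the Schwartz space, uniformly in the scale. -/

/-- The truncation of `∏ₖ ‖xₖ‖^{bₖ}`. -/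
def truncProd {m n : ℕ} (b : Fin m → ℝ) (J : ℕ) (x : Space m n) : ℝ := ∏ k, trunc (b k) J (x k)

/-- The product of dyadic pieces indexed by `p`. -/
def pieceProd {m n : ℕ} (b : Fin m → ℝ) (p : Fin m → ℕ) (x : Space m n) : ℝ :=
  ∏ k, piece (b k) (p k = 0) (x k)

theorem hasTemperateGrowth_prod {H : Type*} [NormedAddCommGroup H] [NormedSpace ℝ H]
    {ι : Type*} (s : Finset ι) (f : ι → H → ℝ) (hf : ∀ i, (f i).HasTemperateGrowth) :
    (fun x => ∏ i ∈ s, f i x).HasTemperateGrowth := by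
  classical
  induction s using Finset.induction_on with
  | empty => simp
  | insert a s ha ih =>
    simp_rw [Finset.prod_insert ha]
    exact (hf a).mul ih

theorem hasTemperateGrowth_block {m n : ℕ} {f : EuclideanSpace ℝ (Fin n) → ℝ}
    (hf : f.HasTemperateGrowth) (k : Fin m) : (fun x : Space m n => f (x k)).HasTemperateGrowth :=
  hf.comp (PiLp.proj 2 (𝕜 := ℝ) (fun _ : Fin m => EuclideanSpace ℝ (Fin n)) k).hasTemperateGrowth

theorem hasTemperateGrowth_truncProd {m n : ℕ} (b : Fin m → ℝ) (J : ℕ) :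
    (truncProd b J : Space m n → ℝ).HasTemperateGrowth :=
  hasTemperateGrowth_prod _ _ fun k => hasTemperateGrowth_block (hasTemperateGrowth_trunc _ _) k

theorem hasTemperateGrowth_pieceProd {m n : ℕ} (b : Fin m → ℝ) (p : Fin m → ℕ) :
    (pieceProd b p : Space m n → ℝ).HasTemperateGrowth :=
  hasTemperateGrowth_prod _ _ fun k => hasTemperateGrowth_block (hasTemperateGrowth_piece _ _) k

theorem truncProd_eq_sum {m n : ℕ} (b : Fin m → ℝ) (J : ℕ) (x : Space m n) :
    truncProd b J x = ∑ p ∈ Fintype.piFinset fun _ : Fin m => Finset.range (J + 1),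
      (∏ k, ((2 : ℝ) ^ (-b k)) ^ p k) * pieceProd b p (dil (fun k => (2 : ℝ) ^ p k) x) := by
  simp only [truncProd, trunc_eq_sum, Finset.prod_univ_sum, pieceProd, ← Finset.prod_mul_distrib,
    dil_apply]

theorem norm_le_sum {m n : ℕ} (x : Space m n) : ‖x‖ ≤ ∑ k, ‖x k‖ := by
  refine abs_le_of_sq_le_sq' ?_ (by positivity) |>.2
  rw [PiLp.norm_sq_eq_of_L2]
  exact Finset.sum_sq_le_sq_sum_of_nonneg fun _ _ => norm_nonneg _

/-- An increasing sequence of norms defining the topology of the Schwartz space. -/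
def sNorm {m n : ℕ} (N : ℕ) (f : 𝓢(Space m n, ℂ)) : ℝ :=
  (Finset.Iic (N, N)).sup (schwartzSeminormFamily ℝ (Space m n) ℂ) f

theorem sNorm_nonneg {m n : ℕ} (N : ℕ) (f : 𝓢(Space m n, ℂ)) : 0 ≤ sNorm N f := apply_nonneg _ _

theorem one_add_pow_mul_le_sNorm {m n : ℕ} {k l N : ℕ} (hk : k ≤ N) (hl : l ≤ N)
    (f : 𝓢(Space m n, ℂ)) (x : Space m n) :
    (1 + ‖x‖) ^ k * ‖iteratedFDeriv ℝ l f x‖ ≤ 2 ^ N * sNorm N f :=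
  SchwartzMap.one_add_le_sup_seminorm_apply (𝕜 := ℝ) (m := (N, N)) hk hl f x

/-- Only finitely many seminorms enter `sNorm N`, so their separate bounds combine. The index `ι`
makes the constants uniform over a family of maps, later the family of all dyadic scales. -/
theorem sNorm_le_of_seminorm_le {m n : ℕ} {ι : Type*} (A : ι → 𝓢(Space m n, ℂ) → 𝓢(Space m n, ℂ))
    (h : ∀ k l : ℕ, ∃ (N : ℕ) (C : ℝ), 0 ≤ C ∧
      ∀ i f, SchwartzMap.seminorm ℝ k l (A i f) ≤ C * sNorm N f) (N : ℕ) :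
    ∃ (N' : ℕ) (C : ℝ), 0 ≤ C ∧ ∀ i f, sNorm N (A i f) ≤ C * sNorm N' f := by
  choose K C hC hK using h
  let N' := (Finset.Iic (N, N)).sup fun q => K q.1 q.2
  refine ⟨N', ∑ q ∈ Finset.Iic (N, N), C q.1 q.2, Finset.sum_nonneg fun q _ => hC _ _,
    fun i f => ?_⟩
  refine Seminorm.finset_sup_apply_le
    (mul_nonneg (Finset.sum_nonneg fun q _ => hC _ _) (sNorm_nonneg _ _)) fun q hq => ?_
  have hmono : sNorm (K q.1 q.2) f ≤ sNorm N' f := by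
    refine Seminorm.le_def.1 (Finset.sup_mono ?_) f
    have : K q.1 q.2 ≤ N' := Finset.le_sup (f := fun q : ℕ × ℕ => K q.1 q.2) hq
    exact Finset.Iic_subset_Iic.2 (Prod.mk_le_mk.2 ⟨this, this⟩)
  calc _ ≤ C q.1 q.2 * sNorm (K q.1 q.2) f := hK q.1 q.2 i f
    _ ≤ (∑ q ∈ Finset.Iic (N, N), C q.1 q.2) * sNorm N' f := by
      gcongr
      · exact sNorm_nonneg _ _
      · exact Finset.sum_nonneg fun q _ => hC _ _
      · exact Finset.single_le_sum (f := fun q : ℕ × ℕ => C q.1 q.2) (fun q _ => hC _ _) hq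

/-- The quantitative form of continuity, used for the Fourier transform. -/
theorem sNorm_clm_le {m n : ℕ} (A : 𝓢(Space m n, ℂ) →L[ℝ] 𝓢(Space m n, ℂ)) (N : ℕ) :
    ∃ (N' : ℕ) (C : ℝ), 0 ≤ C ∧ ∀ f, sNorm N (A f) ≤ C * sNorm N' f := by
  have := sNorm_le_of_seminorm_le (fun _ : Unit => A) (fun k l => ?_) N
  · obtain ⟨N', C, hC, h⟩ := this
    exact ⟨N', C, hC, h ()⟩
  have hc : Continuous ((SchwartzMap.seminorm ℝ k l).comp A.toLinearMap) :=
    ((schwartz_withSeminorms ℝ (Space m n) ℂ).continuous_seminorm (k, l)).comp A.continuous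
  obtain ⟨s, C, -, hC⟩ := Seminorm.bound_of_continuous (schwartz_withSeminorms ℝ (Space m n) ℂ) _ hc
  refine ⟨s.sup fun q => max q.1 q.2, C, C.2, fun _ f => (hC f).trans ?_⟩
  rw [_root_.smul_apply]
  refine mul_le_mul_of_nonneg_left ?_ C.2
  refine Seminorm.le_def.1 (Finset.sup_mono fun q hq => Finset.mem_Iic.2 ?_) f
  have := Finset.le_sup (f := fun q : ℕ × ℕ => max q.1 q.2) hq
  exact ⟨(le_max_left _ _).trans this, (le_max_right _ _).trans this⟩

/-- Rapid decay in all blocks separately. -/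
theorem schwartz_decay (m n M : ℕ) : ∃ (N : ℕ) (C : ℝ), 0 ≤ C ∧ ∀ (f : 𝓢(Space m n, ℂ)) (x),
    ‖f x‖ ≤ C * sNorm N f * ∏ k, ((1 + ‖x k‖) ^ M)⁻¹ := by
  refine ⟨m * M, 2 ^ (m * M), by positivity, fun f x => ?_⟩
  have h1 := one_add_pow_mul_le_sNorm (le_refl (m * M)) (Nat.zero_le (m * M)) f x
  rw [norm_iteratedFDeriv_zero] at h1
  have h2 : ∏ k, (1 + ‖x k‖) ^ M ≤ (1 + ‖x‖) ^ (m * M) := by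
    calc ∏ k, (1 + ‖x k‖) ^ M ≤ ∏ _k : Fin m, (1 + ‖x‖) ^ M := by
          gcongr with k
          exact PiLp.norm_apply_le x k
      _ = _ := by simp [← pow_mul, mul_comm]
  rw [Finset.prod_inv_distrib, ← div_eq_mul_inv, le_div_iff₀ (by positivity), mul_comm]
  exact (mul_le_mul_of_nonneg_right h2 (norm_nonneg _)).trans h1

/-- Multiplication of a Schwartz function by `truncProd b J`. -/
def mulTrunc {m n : ℕ} (b : Fin m → ℝ) (J : ℕ) : 𝓢(Space m n, ℂ) →L[ℝ] 𝓢(Space m n, ℂ) :=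
  SchwartzMap.smulLeftCLM ℂ (truncProd b J)

theorem mulTrunc_apply {m n : ℕ} (b : Fin m → ℝ) (J : ℕ) (f : 𝓢(Space m n, ℂ)) (x : Space m n) :
    mulTrunc b J f x = truncProd b J x • f x :=
  SchwartzMap.smulLeftCLM_apply_apply (hasTemperateGrowth_truncProd b J) f x

theorem two_pow_ne {m : ℕ} (p : Fin m → ℕ) (k : Fin m) : ((2 : ℝ) ^ p k)⁻¹ ≠ 0 := by positivity

/-- The normalized dyadic pieces of `mulTrunc b J f`. -/
def dyadic {m n : ℕ} (b : Fin m → ℝ) (p : Fin m → ℕ) (f : 𝓢(Space m n, ℂ)) : 𝓢(Space m n, ℂ) :=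
  SchwartzMap.smulLeftCLM ℂ (pieceProd b p)
    (SchwartzMap.compCLMOfContinuousLinearEquiv ℝ (dilEquiv _ (two_pow_ne p)) f)

theorem dyadic_apply {m n : ℕ} (b : Fin m → ℝ) (p : Fin m → ℕ) (f : 𝓢(Space m n, ℂ))
    (x : Space m n) :
    dyadic b p f x = pieceProd b p x • f (dil (fun k => ((2 : ℝ) ^ p k)⁻¹) x) :=
  SchwartzMap.smulLeftCLM_apply_apply (hasTemperateGrowth_pieceProd b p) _ x

theorem mulTrunc_eq_sum {m n : ℕ} (b : Fin m → ℝ) (J : ℕ) (f : 𝓢(Space m n, ℂ)) (x : Space m n) :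
    mulTrunc b J f x = ∑ p ∈ Fintype.piFinset fun _ : Fin m => Finset.range (J + 1),
      (∏ k, ((2 : ℝ) ^ (-b k)) ^ p k) • dyadic b p f (dil (fun k => (2 : ℝ) ^ p k) x) := by
  rw [mulTrunc_apply, truncProd_eq_sum, Finset.sum_smul]
  refine Finset.sum_congr rfl fun p _ => ?_
  rw [dyadic_apply, dil_inv_dil (fun k => by positivity), mul_smul]

theorem norm_dil_le {m n : ℕ} {t : Fin m → ℝ} (ht : ∀ k, |t k| ≤ 1) :
    ‖(dil t : Space m n →L[ℝ] Space m n)‖ ≤ 1 := by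
  refine ContinuousLinearMap.opNorm_le_bound _ zero_le_one fun x => ?_
  rw [one_mul]
  refine abs_le_of_sq_le_sq' ?_ (by positivity) |>.2
  rw [PiLp.norm_sq_eq_of_L2, PiLp.norm_sq_eq_of_L2]
  gcongr with k
  rw [dil_apply, norm_smul]
  exact mul_le_of_le_one_left (norm_nonneg _) (ht k)

theorem norm_iteratedFDeriv_comp_dil_le {m n : ℕ} {t : Fin m → ℝ} (ht : ∀ k, |t k| ≤ 1)
    (f : 𝓢(Space m n, ℂ)) (i : ℕ) (x : Space m n) :
    ‖iteratedFDeriv ℝ i (fun y => f (dil t y)) x‖ ≤ ‖iteratedFDeriv ℝ i f (dil t x)‖ := by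
  have := ContinuousLinearMap.iteratedFDeriv_comp_right (dil t) (f.smooth i) x (i := i) le_rfl
  rw [show (fun y => f (dil t y)) = f ∘ dil t from rfl, this]
  refine (ContinuousMultilinearMap.norm_compContinuousLinearMap_le _ _).trans ?_
  refine mul_le_of_le_one_right (norm_nonneg _) ?_
  exact Finset.prod_le_one (fun _ _ => norm_nonneg _) fun _ _ => norm_dil_le ht

/-- The function depends on `p` only through the set of indices with `p k = 0`, so only finitely
many functions occur and the bound is uniform in `p`. -/
theorem pieceProd_growth (m n : ℕ) (b : Fin m → ℝ) (l : ℕ) : ∃ (K : ℕ) (C : ℝ), 0 ≤ C ∧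
    ∀ (p : Fin m → ℕ), ∀ i ≤ l, ∀ x : Space m n,
      ‖iteratedFDeriv ℝ i (pieceProd b p) x‖ ≤ C * (1 + ‖x‖) ^ K := by
  have h (s : Fin m → Bool) := (hasTemperateGrowth_pieceProd (n := n) b
    fun k => if s k then 0 else 1).norm_iteratedFDeriv_le_uniform l
  choose K C hC hK using h
  refine ⟨Finset.univ.sup K, ∑ s, C s, Finset.sum_nonneg fun s _ => hC s, fun p i hi x => ?_⟩
  let s : Fin m → Bool := fun k => decide (p k = 0)
  have hs : (pieceProd b p : Space m n → ℝ) = pieceProd b fun k => if s k then 0 else 1 := by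
    ext x
    refine Finset.prod_congr rfl fun k _ => ?_
    by_cases h : p k = 0 <;> simp [s, h, piece]
  rw [hs]
  refine (hK s i hi x).trans ?_
  gcongr
  · exact Finset.sum_nonneg fun s _ => hC s
  · exact Finset.single_le_sum (f := C) (fun s _ => hC s) (Finset.mem_univ s)
  · linarith [norm_nonneg x]
  · exact Finset.le_sup (Finset.mem_univ s)

theorem pieceProd_eventually_zero {m n : ℕ} {b : Fin m → ℝ} {p : Fin m → ℕ} {x : Space m n}
    {k : Fin m} (hp : p k ≠ 0) (hx : 3 < ‖x k‖) : ∀ᶠ y in 𝓝 x, pieceProd b p y = 0 := by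
  have : ContinuousAt (fun y : Space m n => ‖y k‖) x := by fun_prop
  filter_upwards [this.eventually (lt_mem_nhds hx)] with y hy
  exact Finset.prod_eq_zero (Finset.mem_univ k) (piece_eq_zero hp hy)

/-- Blocks with `p k = 0` are not contracted, and the others have length at most 3; hence x and its
contraction differ by at most 3m. -/
theorem one_add_norm_le_dil {m n : ℕ} {p : Fin m → ℕ} {x : Space m n}
    (hx : ∀ k, p k ≠ 0 → ‖x k‖ ≤ 3) :
    1 + ‖x‖ ≤ (1 + 3 * m) * (1 + ‖dil (fun k => ((2 : ℝ) ^ p k)⁻¹) x‖) := by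
  set y := dil (fun k => ((2 : ℝ) ^ p k)⁻¹) x with hy
  have h1 : ‖x - y‖ ≤ 3 * m := by
    refine (norm_le_sum _).trans ?_
    calc ∑ k, ‖(x - y) k‖ ≤ ∑ _k : Fin m, (3 : ℝ) := by
          refine Finset.sum_le_sum fun k _ => ?_
          have : (x - y) k = (1 - ((2 : ℝ) ^ p k)⁻¹) • x k := by
            rw [sub_smul, one_smul]; rfl
          rw [this, norm_smul]
          by_cases hp : p k = 0
          · simp [hp]
          · have h2 : ((2 : ℝ) ^ p k)⁻¹ ≤ 1 := inv_le_one_of_one_le₀ (one_le_pow₀ one_le_two)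
            have h3 : 0 < ((2 : ℝ) ^ p k)⁻¹ := by positivity
            rw [Real.norm_of_nonneg (by linarith)]
            nlinarith [hx k hp, norm_nonneg (x k)]
      _ = 3 * m := by simp [mul_comm]
  have h2 : ‖x‖ ≤ ‖x - y‖ + ‖y‖ := by simpa using norm_add_le (x - y) y
  nlinarith [norm_nonneg y, (Nat.cast_nonneg m : (0 : ℝ) ≤ m)]

/-- The uniformity in `p` is the heart of the dyadic method. Contracting the argument of f does not
increase derivatives, but it weakens decay; decay is lost only in the contracted blocks, and there
the piece has bounded support. -/
theorem dyadic_sNorm_le (m n : ℕ) (b : Fin m → ℝ) (N : ℕ) : ∃ (N' : ℕ) (C : ℝ), 0 ≤ C ∧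
    ∀ (p : Fin m → ℕ) (f : 𝓢(Space m n, ℂ)), sNorm N (dyadic b p f) ≤ C * sNorm N' f := by
  refine sNorm_le_of_seminorm_le _ (fun k l => ?_) N
  obtain ⟨K, C, hC, hK⟩ := pieceProd_growth m n b l
  set B : ℝ := 1 + 3 * m
  set N' := max (k + K) l
  refine ⟨N', 2 ^ l * (C * (B ^ (k + K) * 2 ^ N')), by positivity, fun p f => ?_⟩
  have hpos := sNorm_nonneg N' f
  refine SchwartzMap.seminorm_le_bound ℝ k l _ (by positivity) fun x => ?_
  set t : Fin m → ℝ := fun k => ((2 : ℝ) ^ p k)⁻¹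
  have ht : ∀ k, |t k| ≤ 1 := fun k => by
    rw [abs_of_pos (by positivity)]
    exact inv_le_one_of_one_le₀ (one_le_pow₀ one_le_two)
  have hW : (dyadic b p f : Space m n → ℂ) = fun x => pieceProd b p x • f (dil t x) := by
    ext x; exact dyadic_apply b p f x
  -- Outside the support of the contracted factors the function vanishes near x, so all its
  -- derivatives do.
  by_cases hx : ∀ k, p k ≠ 0 → ‖x k‖ ≤ 3
  · have hB := one_add_norm_le_dil hx
    have h1 := norm_iteratedFDeriv_smul_le (𝕜 := ℝ) (n := l) (N := (l : ℕ∞))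
      ((hasTemperateGrowth_pieceProd (n := n) b p).1.of_le (by exact_mod_cast le_top))
      ((f.smooth l).comp (dil t).contDiff) x le_rfl
    rw [hW]
    calc ‖x‖ ^ k * ‖iteratedFDeriv ℝ l (fun x => pieceProd b p x • f (dil t x)) x‖
        ≤ (1 + ‖x‖) ^ k * ∑ i ∈ Finset.range (l + 1), (l.choose i : ℝ) *
            ‖iteratedFDeriv ℝ i (pieceProd b p) x‖ *
            ‖iteratedFDeriv ℝ (l - i) (fun y => f (dil t y)) x‖ := by
          gcongr
          · linarith
          · exact h1
      _ ≤ ∑ i ∈ Finset.range (l + 1), (l.choose i : ℝ) *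
            (C * (B ^ (k + K) * (2 ^ N' * sNorm N' f))) := by
          rw [Finset.mul_sum]
          refine Finset.sum_le_sum fun i hi => ?_
          have hi' : i ≤ l := Nat.lt_succ_iff.1 (Finset.mem_range.1 hi)
          have h2 := hK p i hi' x
          have h3 := norm_iteratedFDeriv_comp_dil_le ht f (l - i) x
          have h4 := one_add_pow_mul_le_sNorm (N := N') (le_max_left (k + K) l)
            ((Nat.sub_le l i).trans (le_max_right (k + K) l)) f (dil t x)
          have h5 : (1 + ‖x‖) ^ (k + K) ≤ B ^ (k + K) * (1 + ‖dil t x‖) ^ (k + K) := by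
            rw [← mul_pow]; exact pow_le_pow_left₀ (by positivity) hB _
          calc _ ≤ (1 + ‖x‖) ^ k * ((l.choose i : ℝ) * (C * (1 + ‖x‖) ^ K) *
                ‖iteratedFDeriv ℝ (l - i) f (dil t x)‖) := by gcongr
            _ = (l.choose i : ℝ) * (C * ((1 + ‖x‖) ^ (k + K) *
                ‖iteratedFDeriv ℝ (l - i) f (dil t x)‖)) := by ring
            _ ≤ (l.choose i : ℝ) * (C * (B ^ (k + K) * (1 + ‖dil t x‖) ^ (k + K) *
                ‖iteratedFDeriv ℝ (l - i) f (dil t x)‖)) := by gcongr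
            _ ≤ _ := by rw [mul_assoc (B ^ (k + K))]; gcongr
      _ = _ := by
          rw [← Finset.sum_mul]
          have := Nat.sum_range_choose l
          rw [← Nat.cast_sum, this]
          push_cast; ring
  · push Not at hx
    obtain ⟨k', hp, hx'⟩ := hx
    have h0 : (dyadic b p f : Space m n → ℂ) =ᶠ[𝓝 x] fun _ => 0 := by
      filter_upwards [pieceProd_eventually_zero (b := b) hp hx'] with y hy
      rw [dyadic_apply, hy, zero_smul]
    rw [(h0.iteratedFDeriv ℝ l).eq_of_nhds]
    simp only [iteratedFDeriv_fun_zero, Pi.zero_apply, norm_zero, mul_zero]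
    positivity

/-! ### Decay of the Fourier transform of a truncated product. -/

theorem schwartz_decay_rpow {m : ℕ} (n : ℕ) (a : Fin m → ℝ) : ∃ (N : ℕ) (C : ℝ), 0 ≤ C ∧
    ∀ (f : 𝓢(Space m n, ℂ)) (x), ‖f x‖ ≤ C * sNorm N f * ∏ k, (1 + ‖x k‖) ^ (-a k) := by
  obtain ⟨M, hM⟩ := exists_nat_ge (∑ k, |a k|)
  obtain ⟨N, C, hC, h⟩ := schwartz_decay m n M
  refine ⟨N, C, hC, fun f x => (h f x).trans ?_⟩
  have := sNorm_nonneg N f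
  gcongr with k
  rw [Real.rpow_neg (by positivity), ← Real.rpow_natCast]
  gcongr
  · linarith [norm_nonneg (x k)]
  · exact (le_abs_self _).trans
      ((Finset.single_le_sum (fun i _ => abs_nonneg (a i)) (Finset.mem_univ k)).trans hM)

/-- The sum over multi-indices factors into one geometric series per block. -/
theorem sum_prod_pow_le {m : ℕ} (J : ℕ) (r : Fin m → ℝ) (h0 : ∀ k, 0 ≤ r k) (h1 : ∀ k, r k < 1) :
    ∑ p ∈ Fintype.piFinset fun _ : Fin m => Finset.range (J + 1), ∏ k, r k ^ p k ≤
      ∏ k, (1 - r k)⁻¹ := by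
  rw [← Finset.prod_univ_sum (t := fun _ => Finset.range (J + 1)) (f := fun k j => r k ^ j)]
  refine Finset.prod_le_prod (fun k _ => Finset.sum_nonneg fun j _ => pow_nonneg (h0 k) _)
    fun k _ => ?_
  rw [← tsum_geometric_of_lt_one (h0 k) (h1 k)]
  exact (summable_geometric_of_lt_one (h0 k) (h1 k)).sum_le_tsum _ fun j _ => pow_nonneg (h0 k) _

theorem fourier_mulTrunc_eq {m n : ℕ} (b : Fin m → ℝ) (J : ℕ) (f : 𝓢(Space m n, ℂ))
    (ξ : Space m n) :
    𝓕 (mulTrunc b J f : Space m n → ℂ) ξ =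
      ∑ p ∈ Fintype.piFinset fun _ : Fin m => Finset.range (J + 1),
        (∏ k, (((2 : ℝ) ^ (-b k)) ^ p k * (((2 : ℝ) ^ p k) ^ n)⁻¹)) •
          𝓕 (dyadic b p f : Space m n → ℂ) (dil (fun k => ((2 : ℝ) ^ p k)⁻¹) ξ) := by
  have hne : ∀ (p : Fin m → ℕ) k, (2 : ℝ) ^ p k ≠ 0 := fun p k => by positivity
  have h1 : mulTrunc b J f = ∑ p ∈ Fintype.piFinset fun _ : Fin m => Finset.range (J + 1),
      (∏ k, ((2 : ℝ) ^ (-b k)) ^ p k) •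
        SchwartzMap.compCLMOfContinuousLinearEquiv ℝ (dilEquiv _ (hne p)) (dyadic b p f) := by
    ext x
    rw [mulTrunc_eq_sum, _root_.sum_apply]
    rfl
  rw [h1, ← SchwartzMap.fourier_coe, ← SchwartzMap.fourierTransformCLM_apply ℝ, map_sum,
    _root_.sum_apply]
  refine Finset.sum_congr rfl fun p _ => ?_
  rw [map_smul, _root_.smul_apply, SchwartzMap.fourierTransformCLM_apply, SchwartzMap.fourier_coe,
    SchwartzMap.compCLMOfContinuousLinearEquiv_apply, Finset.prod_mul_distrib, mul_smul]
  congr 1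
  refine (fourier_comp_dil (hne p) (dyadic b p f) ξ).trans ?_
  congr 1
  exact Finset.prod_congr rfl fun k _ => abs_of_nonneg (by positivity)

/-- The scale `p` contributes ∏ 2^(-(b_k+n)p_k) (1 + 2^(-p_k)|ξ_k|)^(-a_k), hence at most ∏
2^((a_k-n-b_k)p_k) (1+|ξ_k|)^(-a_k); the condition a_k < n + b_k makes the sum converge
independently of `J`. -/
theorem fourier_mulTrunc_le {m : ℕ} (n : ℕ) (b a : Fin m → ℝ) (ha : ∀ k, 0 ≤ a k)
    (hab : ∀ k, a k < n + b k) : ∃ (N : ℕ) (C : ℝ), 0 ≤ C ∧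
    ∀ (J : ℕ) (f : 𝓢(Space m n, ℂ)) (ξ : Space m n),
      ‖𝓕 (mulTrunc b J f : Space m n → ℂ) ξ‖ ≤ C * sNorm N f * ∏ k, (1 + ‖ξ k‖) ^ (-a k) := by
  obtain ⟨N₁, C₁, hC₁, h₁⟩ := schwartz_decay_rpow n a
  obtain ⟨N₂, C₂, hC₂, h₂⟩ := sNorm_clm_le (m := m) (n := n)
    (SchwartzMap.fourierTransformCLM ℝ) N₁
  obtain ⟨N₃, C₃, hC₃, h₃⟩ := dyadic_sNorm_le m n b N₂
  set r : Fin m → ℝ := fun k => 2 ^ (a k - n - b k)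
  have hr0 : ∀ k, 0 ≤ r k := fun k => by positivity
  have hr1 : ∀ k, r k < 1 := fun k => Real.rpow_lt_one_of_one_lt_of_neg one_lt_two
    (by linarith [hab k])
  refine ⟨N₃, C₁ * (C₂ * C₃) * ∏ k, (1 - r k)⁻¹, ?_, fun J f ξ => ?_⟩
  · exact mul_nonneg (by positivity) (Finset.prod_nonneg fun k _ => inv_nonneg.2
      (by linarith [hr1 k]))
  have hs := sNorm_nonneg N₃ f
  rw [fourier_mulTrunc_eq]
  refine (norm_sum_le _ _).trans ?_
  calc _ ≤ ∑ p ∈ Fintype.piFinset fun _ : Fin m => Finset.range (J + 1),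
        (C₁ * (C₂ * C₃) * sNorm N₃ f * ∏ k, (1 + ‖ξ k‖) ^ (-a k)) * ∏ k, r k ^ p k := by
        refine Finset.sum_le_sum fun p _ => ?_
        rw [norm_smul, Real.norm_of_nonneg (by positivity)]
        have h4 := h₁ (SchwartzMap.fourierTransformCLM ℝ (dyadic b p f))
          (dil (fun k => ((2 : ℝ) ^ p k)⁻¹) ξ)
        have h5 : sNorm N₁ (SchwartzMap.fourierTransformCLM ℝ (dyadic b p f)) ≤
            C₂ * (C₃ * sNorm N₃ f) := (h₂ _).trans (by gcongr; exact h₃ p f)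
        calc _ ≤ (∏ k, (((2 : ℝ) ^ (-b k)) ^ p k * (((2 : ℝ) ^ p k) ^ n)⁻¹)) *
              (C₁ * (C₂ * (C₃ * sNorm N₃ f)) *
                ∏ k, (1 + ‖dil (fun k => ((2 : ℝ) ^ p k)⁻¹) ξ k‖) ^ (-a k)) := by
              gcongr
              exact h4.trans (by gcongr)
          _ = (C₁ * (C₂ * C₃) * sNorm N₃ f) *
              ∏ k, ((((2 : ℝ) ^ (-b k)) ^ p k * (((2 : ℝ) ^ p k) ^ n)⁻¹) *
                (1 + ‖dil (fun k => ((2 : ℝ) ^ p k)⁻¹) ξ k‖) ^ (-a k)) := by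
              rw [Finset.prod_mul_distrib (f := fun k =>
                (((2 : ℝ) ^ (-b k)) ^ p k * (((2 : ℝ) ^ p k) ^ n)⁻¹))]
              ring
          _ ≤ (C₁ * (C₂ * C₃) * sNorm N₃ f) *
              ∏ k, ((1 + ‖ξ k‖) ^ (-a k) * r k ^ p k) := by
              refine mul_le_mul_of_nonneg_left (Finset.prod_le_prod (fun k _ => by positivity)
                fun k _ => ?_) (by positivity)
              -- Since 2^(-p) ≤ 1, rescaling the frequency costs at most the factor 2^(-p) in 1 +
              -- |ξ|, that is 2^(ap) in the bound.
              have hle : ((2 : ℝ) ^ p k)⁻¹ * (1 + ‖ξ k‖) ≤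
                  1 + ‖dil (fun k => ((2 : ℝ) ^ p k)⁻¹) ξ k‖ := by
                rw [dil_apply, norm_smul, Real.norm_of_nonneg (by positivity), mul_add, mul_one]
                gcongr
                exact inv_le_one_of_one_le₀ (one_le_pow₀ one_le_two)
              have h6 : (1 + ‖dil (fun k => ((2 : ℝ) ^ p k)⁻¹) ξ k‖) ^ (-a k) ≤
                  ((2 : ℝ) ^ (a k)) ^ p k * (1 + ‖ξ k‖) ^ (-a k) := by
                refine (Real.rpow_le_rpow_of_nonpos (by positivity) hle
                  (by linarith [ha k])).trans_eq ?_
                rw [Real.mul_rpow (by positivity) (by positivity), Real.inv_rpow (by positivity),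
                  Real.rpow_neg (by positivity), inv_inv, ← Real.rpow_natCast 2 (p k),
                  ← Real.rpow_natCast _ (p k), ← Real.rpow_mul zero_le_two,
                  ← Real.rpow_mul zero_le_two, mul_comm (a k)]
              refine (mul_le_mul_of_nonneg_left h6 (by positivity)).trans_eq ?_
              have h7 : r k = 2 ^ (-b k) * (2 ^ n)⁻¹ * 2 ^ (a k) := by
                rw [← Real.rpow_natCast 2 n, ← Real.rpow_neg zero_le_two, ← Real.rpow_add two_pos,
                  ← Real.rpow_add two_pos, show -b k + -(n : ℝ) + a k = a k - n - b k by ring]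
              rw [h7, mul_pow, mul_pow, inv_pow, ← pow_mul, ← pow_mul, mul_comm n]
              ring
          _ = _ := by rw [Finset.prod_mul_distrib]; ring
    _ = (C₁ * (C₂ * C₃) * sNorm N₃ f * ∏ k, (1 + ‖ξ k‖) ^ (-a k)) *
        ∑ p ∈ Fintype.piFinset fun _ : Fin m => Finset.range (J + 1), ∏ k, r k ^ p k := by
        rw [Finset.mul_sum]
    _ ≤ (C₁ * (C₂ * C₃) * sNorm N₃ f * ∏ k, (1 + ‖ξ k‖) ^ (-a k)) * ∏ k, (1 - r k)⁻¹ := by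
        gcongr
        exact sum_prod_pow_le J r hr0 hr1
    _ = _ := by ring

/-! ### Removing the truncation; fractional derivatives of truncations. -/

theorem ae_block_ne_zero (m : ℕ) {n : ℕ} (hn : 0 < n) : ∀ᵐ x : Space m n, ∀ k, x k ≠ 0 := by
  have : Nonempty (Fin n) := ⟨⟨0, hn⟩⟩
  rw [ae_all_iff]
  intro k
  have h1 : ∀ᵐ x : EuclideanSpace ℝ (Fin n), x ≠ 0 := Measure.ae_ne volume 0
  have h2 : ∀ᵐ x : Fin m → EuclideanSpace ℝ (Fin n), x k ≠ 0 :=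
    (Measure.tendsto_eval_ae_ae (μ := fun _ : Fin m =>
      (volume : Measure (EuclideanSpace ℝ (Fin n)))) (i := k)).eventually h1
  exact (volume_preserving_ofLp m n).quasiMeasurePreserving.ae h2

theorem weight_nonneg {m n : ℕ} (s : Fin m → ℝ) (x : Space m n) : 0 ≤ weight s x :=
  Finset.prod_nonneg fun _ _ => by positivity

theorem measurable_weight {m n : ℕ} (s : Fin m → ℝ) : Measurable (weight s : Space m n → ℝ) := by
  unfold weight
  refine Finset.measurable_fun_prod _ fun k _ => ?_
  have : Measurable fun x : Space m n => x k :=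
    (PiLp.continuous_apply 2 (fun _ : Fin m => EuclideanSpace ℝ (Fin n)) k).measurable
  fun_prop

theorem integrable_prod_one_add {m n : ℕ} {a : Fin m → ℝ} (ha : ∀ k, (n : ℝ) < a k) :
    Integrable fun x : Space m n => ∏ k, (1 + ‖x k‖) ^ (-a k) :=
  integrable_space_prod (fun k y => (1 + ‖y‖) ^ (-a k)) fun k =>
    integrable_one_add_norm (by simpa using ha k)

theorem norm_weighted {m n : ℕ} (s : Fin m → ℝ) (f : Space m n → ℂ) (x : Space m n) :
    ‖weighted s f x‖ = weight s x * ‖f x‖ := by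
  rw [weighted, norm_mul, Complex.norm_real, Real.norm_of_nonneg (weight_nonneg _ _)]

theorem integrable_weighted {m n : ℕ} {s : Fin m → ℝ} (hs : ∀ k, 0 ≤ s k)
    (f : 𝓢(Space m n, ℂ)) : Integrable (weighted s f) := by
  obtain ⟨N, C, hC, h⟩ := schwartz_decay_rpow n (fun k => (n : ℝ) + 1 + s k / 2)
  have h1 := (integrable_prod_one_add (m := m) (n := n) (a := fun _ => (n : ℝ) + 1)
    fun k => by linarith).const_mul (C * sNorm N f)
  refine h1.mono' ?_ (Eventually.of_forall fun x => ?_)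
  · have := measurable_weight (n := n) s
    have := f.continuous
    unfold weighted
    fun_prop
  rw [norm_weighted]
  refine (mul_le_mul_of_nonneg_left (h f x) (weight_nonneg s x)).trans ?_
  have := sNorm_nonneg N f
  rw [mul_left_comm, weight, ← Finset.prod_mul_distrib]
  gcongr with k
  calc ‖x k‖ ^ (s k / 2) * (1 + ‖x k‖) ^ (-((n : ℝ) + 1 + s k / 2))
      ≤ (1 + ‖x k‖) ^ (s k / 2) * (1 + ‖x k‖) ^ (-((n : ℝ) + 1 + s k / 2)) := by
        gcongr
        · linarith [hs k]
        · linarith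
    _ = _ := by rw [← Real.rpow_add (by positivity)]; ring_nf

theorem truncProd_nonneg {m n : ℕ} (b : Fin m → ℝ) (J : ℕ) (x : Space m n) :
    0 ≤ truncProd b J x := Finset.prod_nonneg fun _ _ => trunc_nonneg _ _ _

theorem truncProd_le {m n : ℕ} (s : Fin m → ℝ) (J : ℕ) (x : Space m n) :
    truncProd (fun k => s k / 2) J x ≤ weight s x :=
  Finset.prod_le_prod (fun _ _ => trunc_nonneg _ _ _) fun _ _ => trunc_le _ _ _

theorem tendsto_truncProd {m n : ℕ} (s : Fin m → ℝ) {x : Space m n} (hx : ∀ k, x k ≠ 0) :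
    Tendsto (fun J => truncProd (fun k => s k / 2) J x) atTop (𝓝 (weight s x)) :=
  tendsto_finsetProd _ fun k _ => tendsto_trunc _ (hx k)

theorem norm_mulTrunc_le {m n : ℕ} (s : Fin m → ℝ) (J : ℕ) (f : 𝓢(Space m n, ℂ)) (x) :
    ‖mulTrunc (fun k => s k / 2) J f x‖ ≤ ‖weighted s f x‖ := by
  rw [mulTrunc_apply, norm_weighted, norm_smul, Real.norm_of_nonneg (truncProd_nonneg _ _ _)]
  exact mul_le_mul_of_nonneg_right (truncProd_le s J x) (norm_nonneg _)

theorem tendsto_mulTrunc {m n : ℕ} (s : Fin m → ℝ) (f : 𝓢(Space m n, ℂ)) {x : Space m n}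
    (hx : ∀ k, x k ≠ 0) :
    Tendsto (fun J => mulTrunc (fun k => s k / 2) J f x) atTop (𝓝 (weighted s f x)) := by
  simp_rw [mulTrunc_apply, weighted, ← smul_eq_mul, Complex.coe_smul]
  exact (tendsto_truncProd s hx).smul_const _

theorem tendsto_fourier_mulTrunc {m n : ℕ} (hn : 0 < n) {s : Fin m → ℝ} (hs : ∀ k, 0 ≤ s k)
    (f : 𝓢(Space m n, ℂ)) (ξ : Space m n) :
    Tendsto (fun J => 𝓕 (mulTrunc (fun k => s k / 2) J f : Space m n → ℂ) ξ) atTop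
      (𝓝 (𝓕 (weighted s f) ξ)) := by
  simp only [Real.fourier_eq]
  refine tendsto_integral_of_dominated_convergence (fun x => ‖weighted s f x‖)
    (fun J => ?_) (integrable_weighted hs f).norm (fun J => ?_) ?_
  · have := (mulTrunc (fun k => s k / 2) J f).continuous
    exact Continuous.aestronglyMeasurable (by fun_prop)
  · refine Eventually.of_forall fun x => ?_
    rw [Circle.norm_smul]
    exact norm_mulTrunc_le s J f x
  · filter_upwards [ae_block_ne_zero m hn] with x hx
    exact (tendsto_mulTrunc s f hx).const_smul _

/-- The zero of |x_k|^(s_k/2) at the origin limits smoothness, and therefore the decay rate, to less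
than n + s_k/2. The bound passes to the limit from the truncations. -/
theorem fourier_weighted_le {m n : ℕ} (hn : 0 < n) {s a : Fin m → ℝ} (hs : ∀ k, 0 ≤ s k)
    (ha : ∀ k, 0 ≤ a k) (hab : ∀ k, a k < n + s k / 2) : ∃ (N : ℕ) (C : ℝ), 0 ≤ C ∧
    ∀ (f : 𝓢(Space m n, ℂ)) (ξ : Space m n),
      ‖𝓕 (weighted s f) ξ‖ ≤ C * sNorm N f * ∏ k, (1 + ‖ξ k‖) ^ (-a k) := by
  obtain ⟨N, C, hC, h⟩ := fourier_mulTrunc_le n (fun k => s k / 2) a ha hab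
  exact ⟨N, C, hC, fun f ξ => le_of_tendsto (tendsto_fourier_mulTrunc hn hs f ξ).norm
    (Eventually.of_forall fun J => h J f ξ)⟩

theorem weight_dil {m n : ℕ} (s : Fin m → ℝ) {t : Fin m → ℝ} (ht : ∀ k, 0 ≤ t k) (x : Space m n) :
    weight s (dil t x) = (∏ k, t k ^ (s k / 2)) * weight s x := by
  simp only [weight, dil_apply, norm_smul, ← Finset.prod_mul_distrib]
  refine Finset.prod_congr rfl fun k _ => ?_
  rw [Real.norm_of_nonneg (ht k), Real.mul_rpow (ht k) (norm_nonneg _)]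

theorem fracLapFourier_eq {m n : ℕ} (α : Fin m → ℝ) (f : 𝓢(Space m n, ℂ)) :
    fracLapFourier α f = weighted α (𝓕 f : 𝓢(Space m n, ℂ)) := rfl

/-- The multiplier is homogeneous, so the fractional derivative of a dyadic piece at scale 2^(-p) is
a rescaled derivative of a unit-scale piece, with gain ∏ 2^((α_k/2-b_k)p_k). -/
theorem fourierInv_fracLapFourier_mulTrunc {m n : ℕ} {α : Fin m → ℝ} (hα : ∀ k, 0 ≤ α k)
    (b : Fin m → ℝ) (J : ℕ) (f : 𝓢(Space m n, ℂ)) (x : Space m n) :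
    𝓕⁻ (fracLapFourier α (mulTrunc b J f)) x =
      ∑ p ∈ Fintype.piFinset fun _ : Fin m => Finset.range (J + 1),
        (∏ k, ((2 : ℝ) ^ (α k / 2 - b k)) ^ p k) •
          𝓕⁻ (fracLapFourier α (dyadic b p f)) (dil (fun k => (2 : ℝ) ^ p k) x) := by
  have hne : ∀ (p : Fin m → ℕ) k, ((2 : ℝ) ^ p k)⁻¹ ≠ 0 := fun p k => by positivity
  -- Three factors: the amplitude of the piece, the Jacobian from its Fourier transform, and the
  -- homogeneity of the multiplier. The Jacobian is undone by the inverse transform below.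
  set c : (Fin m → ℕ) → ℝ := fun p => ∏ k, (((2 : ℝ) ^ (-b k)) ^ p k * (((2 : ℝ) ^ p k) ^ n)⁻¹ *
    ((2 : ℝ) ^ p k) ^ (α k / 2)) with hc
  have h1 : fracLapFourier α (mulTrunc b J f) = fun ξ =>
      ∑ p ∈ Fintype.piFinset fun _ : Fin m => Finset.range (J + 1),
        c p • fracLapFourier α (dyadic b p f) (dil (fun k => ((2 : ℝ) ^ p k)⁻¹) ξ) := by
    ext ξ
    rw [fracLapFourier, fourier_mulTrunc_eq, Finset.mul_sum]
    refine Finset.sum_congr rfl fun p _ => ?_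
    have h2 : weight α ξ = (∏ k, ((2 : ℝ) ^ p k) ^ (α k / 2)) *
        weight α (dil (fun k => ((2 : ℝ) ^ p k)⁻¹) ξ) := by
      rw [← weight_dil α (fun k => by positivity), dil_dil_inv (fun k => by positivity)]
    simp only [hc, Finset.prod_mul_distrib (g := fun k => ((2 : ℝ) ^ p k) ^ (α k / 2))]
    rw [fracLapFourier, h2]
    simp only [Complex.real_smul]
    push_cast
    ring
  have hint (p : Fin m → ℕ) : Integrable fun ξ =>
      fracLapFourier α (dyadic b p f) (dil (fun k => ((2 : ℝ) ^ p k)⁻¹) ξ) := by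
    have h3 : Integrable (fracLapFourier α (dyadic b p f)) :=
      integrable_weighted hα (𝓕 (dyadic b p f))
    have he : MeasurableEmbedding (dil (n := n) fun k => ((2 : ℝ) ^ p k)⁻¹) :=
      (dilEquiv _ (hne p)).toHomeomorph.measurableEmbedding
    refine (he.integrable_map_iff (g := fracLapFourier α (dyadic b p f))).1 ?_
    rw [map_dil_volume (hne p)]
    exact Integrable.smul_measure h3 (ENNReal.prod_ne_top fun _ _ => ENNReal.ofReal_ne_top)
  rw [h1, Real.fourierInv_eq]
  simp_rw [Finset.smul_sum]
  rw [integral_finsetSum]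
  swap
  · intro p _
    have := ((hint p).smul (c p))
    refine this.norm.mono' ?_ (Eventually.of_forall fun ξ => by rw [Circle.norm_smul]; rfl)
    exact AEStronglyMeasurable.smul (Continuous.aestronglyMeasurable (by fun_prop)) this.1
  refine Finset.sum_congr rfl fun p _ => ?_
  simp_rw [smul_comm _ (c p)]
  rw [integral_smul, ← Real.fourierInv_eq, fourierInv_comp_dil (hne p), smul_smul]
  simp only [inv_inv]
  congr 1
  rw [hc, ← Finset.prod_mul_distrib]
  refine Finset.prod_congr rfl fun k _ => ?_
  rw [inv_pow, inv_inv, abs_of_nonneg (by positivity), ← Real.rpow_natCast 2 (p k),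
    Real.rpow_sub two_pos, div_pow, ← Real.rpow_natCast _ (p k), ← Real.rpow_natCast _ (p k),
    ← Real.rpow_natCast _ (p k), ← Real.rpow_mul zero_le_two, ← Real.rpow_mul zero_le_two,
    ← Real.rpow_mul zero_le_two, ← Real.rpow_mul zero_le_two, neg_mul, Real.rpow_neg zero_le_two,
    mul_comm (p k : ℝ) (α k / 2)]
  field_simp

theorem fourierInv_weighted_le {m n : ℕ} (hn : 0 < n) {s a : Fin m → ℝ} (hs : ∀ k, 0 ≤ s k)
    (ha : ∀ k, 0 ≤ a k) (hab : ∀ k, a k < n + s k / 2) : ∃ (N : ℕ) (C : ℝ), 0 ≤ C ∧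
    ∀ (f : 𝓢(Space m n, ℂ)) (ξ : Space m n),
      ‖𝓕⁻ (weighted s f) ξ‖ ≤ C * sNorm N f * ∏ k, (1 + ‖ξ k‖) ^ (-a k) := by
  obtain ⟨N, C, hC, h⟩ := fourier_weighted_le hn hs ha hab
  refine ⟨N, C, hC, fun f ξ => ?_⟩
  rw [Real.fourierInv_eq_fourier_neg]
  simpa using h f (-ξ)

/-- The fractional derivatives of truncations are dominated, uniformly in the truncation. -/
theorem fracDeriv_mulTrunc_le {m n : ℕ} (hn : 0 < n) {α b κ a : Fin m → ℝ} (hα : ∀ k, 0 ≤ α k)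
    (hκ : ∀ k, 0 ≤ κ k) (hκa : ∀ k, κ k ≤ a k) (ha : ∀ k, a k < n + α k / 2)
    (hb : ∀ k, α k / 2 - b k < κ k) : ∃ (N : ℕ) (C : ℝ), 0 ≤ C ∧
    ∀ (J : ℕ) (f : 𝓢(Space m n, ℂ)) (x : Space m n), (∀ k, x k ≠ 0) →
      ‖𝓕⁻ (fracLapFourier α (mulTrunc b J f)) x‖ ≤
        C * sNorm N f * ∏ k, powTail (κ k) (a k) ‖x k‖ := by
  obtain ⟨N₁, C₁, hC₁, h₁⟩ := fourierInv_weighted_le hn hα (fun k => (hκ k).trans (hκa k)) ha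
  obtain ⟨N₂, C₂, hC₂, h₂⟩ := sNorm_clm_le (m := m) (n := n)
    (SchwartzMap.fourierTransformCLM ℝ) N₁
  obtain ⟨N₃, C₃, hC₃, h₃⟩ := dyadic_sNorm_le m n b N₂
  set r : Fin m → ℝ := fun k => 2 ^ (α k / 2 - b k - κ k)
  have hr0 : ∀ k, 0 ≤ r k := fun k => by positivity
  have hr1 : ∀ k, r k < 1 := fun k => Real.rpow_lt_one_of_one_lt_of_neg one_lt_two
    (by linarith [hb k])
  refine ⟨N₃, C₁ * (C₂ * C₃) * ∏ k, (1 - r k)⁻¹, ?_, fun J f x hx => ?_⟩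
  · exact mul_nonneg (by positivity) (Finset.prod_nonneg fun k _ => inv_nonneg.2
      (by linarith [hr1 k]))
  have hs := sNorm_nonneg N₃ f
  have hpt : 0 ≤ ∏ k, powTail (κ k) (a k) ‖x k‖ :=
    Finset.prod_nonneg fun k _ => by unfold powTail; positivity
  rw [fourierInv_fracLapFourier_mulTrunc hα]
  refine (norm_sum_le _ _).trans ?_
  calc _ ≤ ∑ p ∈ Fintype.piFinset fun _ : Fin m => Finset.range (J + 1),
        (C₁ * (C₂ * C₃) * sNorm N₃ f * ∏ k, powTail (κ k) (a k) ‖x k‖) * ∏ k, r k ^ p k := by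
        refine Finset.sum_le_sum fun p _ => ?_
        rw [norm_smul, Real.norm_of_nonneg (by positivity)]
        have h4 := h₁ (SchwartzMap.fourierTransformCLM ℝ (dyadic b p f))
          (dil (fun k => (2 : ℝ) ^ p k) x)
        have h5 : sNorm N₁ (SchwartzMap.fourierTransformCLM ℝ (dyadic b p f)) ≤
            C₂ * (C₃ * sNorm N₃ f) := (h₂ _).trans (by gcongr; exact h₃ p f)
        calc _ ≤ (∏ k, ((2 : ℝ) ^ (α k / 2 - b k)) ^ p k) *
              (C₁ * (C₂ * (C₃ * sNorm N₃ f)) *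
                ∏ k, (1 + ‖dil (fun k => (2 : ℝ) ^ p k) x k‖) ^ (-a k)) := by
              gcongr
              exact h4.trans (by gcongr)
          _ = (C₁ * (C₂ * C₃) * sNorm N₃ f) *
              ∏ k, (((2 : ℝ) ^ (α k / 2 - b k)) ^ p k *
                (1 + ‖dil (fun k => (2 : ℝ) ^ p k) x k‖) ^ (-a k)) := by
              rw [Finset.prod_mul_distrib]
              ring
          _ ≤ (C₁ * (C₂ * C₃) * sNorm N₃ f) *
              ∏ k, (powTail (κ k) (a k) ‖x k‖ * r k ^ p k) := by
              refine mul_le_mul_of_nonneg_left (Finset.prod_le_prod (fun k _ => by positivity)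
                fun k _ => ?_) (by positivity)
              have hy : 0 < ‖x k‖ := norm_pos_iff.2 (hx k)
              have h1p : (1 : ℝ) ≤ 2 ^ p k := one_le_pow₀ one_le_two
              rw [dil_apply, norm_smul, Real.norm_of_nonneg (by positivity)]
              -- The exponent a is split as κ + (a-κ): the first part uses 2^p|x| and supplies the
              -- factor 2^(-κp) that makes the series converge, the second uses 1 + |x| and keeps
              -- the decay at infinity.
              have h6 : (1 + (2 : ℝ) ^ p k * ‖x k‖) ^ (-a k) ≤
                  ((2 : ℝ) ^ (-κ k)) ^ p k * powTail (κ k) (a k) ‖x k‖ := by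
                calc (1 + (2 : ℝ) ^ p k * ‖x k‖) ^ (-a k)
                    = (1 + (2 : ℝ) ^ p k * ‖x k‖) ^ (-κ k) *
                      (1 + (2 : ℝ) ^ p k * ‖x k‖) ^ (-(a k - κ k)) := by
                      rw [← Real.rpow_add (by positivity)]; ring_nf
                  _ ≤ ((2 : ℝ) ^ p k * ‖x k‖) ^ (-κ k) * (1 + ‖x k‖) ^ (-(a k - κ k)) := by
                      gcongr ?_ * ?_
                      · exact Real.rpow_le_rpow_of_nonpos (by positivity) (by linarith)
                          (by linarith [hκ k])
                      · exact Real.rpow_le_rpow_of_nonpos (by positivity) (by nlinarith)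
                          (by linarith [hκa k])
                  _ = _ := by
                      rw [Real.mul_rpow (by positivity) (by positivity), powTail,
                        ← Real.rpow_natCast 2 (p k), ← Real.rpow_natCast _ (p k),
                        ← Real.rpow_mul zero_le_two, ← Real.rpow_mul zero_le_two,
                        mul_comm (-κ k)]
                      ring
              refine (mul_le_mul_of_nonneg_left h6 (by positivity)).trans_eq ?_
              have h7 : r k = 2 ^ (α k / 2 - b k) * 2 ^ (-κ k) := by
                rw [← Real.rpow_add two_pos]
                rfl
              rw [h7, mul_pow]
              ring
          _ = _ := by rw [Finset.prod_mul_distrib]; ring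
    _ = (C₁ * (C₂ * C₃) * sNorm N₃ f * ∏ k, powTail (κ k) (a k) ‖x k‖) *
        ∑ p ∈ Fintype.piFinset fun _ : Fin m => Finset.range (J + 1), ∏ k, r k ^ p k := by
        rw [Finset.mul_sum]
    _ ≤ (C₁ * (C₂ * C₃) * sNorm N₃ f * ∏ k, powTail (κ k) (a k) ‖x k‖) * ∏ k, (1 - r k)⁻¹ := by
        gcongr
        exact sum_prod_pow_le J r hr0 hr1
    _ = _ := by ring

/-! ### Products of power majorants in L¹ and L², and dominated convergence in L². -/

theorem measurable_block {m n : ℕ} (k : Fin m) : Measurable fun x : Space m n => x k :=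
  (PiLp.continuous_apply 2 (fun _ : Fin m => EuclideanSpace ℝ (Fin n)) k).measurable

theorem powTail_nonneg (κ τ : ℝ) {r : ℝ} (hr : 0 ≤ r) : 0 ≤ powTail κ τ r := by
  unfold powTail; positivity

theorem powTail_mul (κ τ κ' τ' : ℝ) {r : ℝ} (hr : 0 < r) :
    powTail κ τ r * powTail κ' τ' r = powTail (κ + κ') (τ + τ') r := by
  unfold powTail
  rw [mul_mul_mul_comm, ← Real.rpow_add hr, ← Real.rpow_add (by positivity)]
  ring_nf

theorem measurable_powTail (κ τ : ℝ) : Measurable (powTail κ τ) := by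
  unfold powTail; fun_prop

theorem measurable_prod_powTail {m n : ℕ} (κ τ : Fin m → ℝ) :
    Measurable fun x : Space m n => ∏ k, powTail (κ k) (τ k) ‖x k‖ :=
  Finset.measurable_fun_prod _ fun k _ =>
    (measurable_powTail _ _).comp (measurable_block k).norm

theorem integrable_of_le_powTail {m n : ℕ} {κ τ : Fin m → ℝ} (h1 : ∀ k, κ k < n)
    (h2 : ∀ k, (n : ℝ) < τ k) {F : Space m n → ℂ} (hF : AEStronglyMeasurable F) {C : ℝ}
    (h : ∀ᵐ x, ‖F x‖ ≤ C * ∏ k, powTail (κ k) (τ k) ‖x k‖) : Integrable F :=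
  ((integrable_space_prod (fun k y => powTail (κ k) (τ k) ‖y‖)
    fun k => integrable_powTail (h1 k) (h2 k)).const_mul C).mono' hF h

theorem memLp_prod_powTail {m n : ℕ} (hn : 0 < n) {κ τ : Fin m → ℝ} (h1 : ∀ k, 2 * κ k < n)
    (h2 : ∀ k, (n : ℝ) < 2 * τ k) (C : ℝ) :
    MemLp (fun x : Space m n => C * ∏ k, powTail (κ k) (τ k) ‖x k‖) 2 := by
  refine MemLp.const_mul ?_ C
  rw [memLp_two_iff_integrable_sq_norm (measurable_prod_powTail κ τ).aestronglyMeasurable]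
  refine (integrable_space_prod (fun k y => powTail (2 * κ k) (2 * τ k) ‖y‖)
    fun k => integrable_powTail (h1 k) (h2 k)).congr ?_
  filter_upwards [ae_block_ne_zero m hn] with x hx
  rw [norm_prod, ← Finset.prod_pow]
  refine Finset.prod_congr rfl fun k _ => ?_
  rw [Real.norm_of_nonneg (powTail_nonneg _ _ (norm_nonneg _)), sq,
    powTail_mul _ _ _ _ (norm_pos_iff.2 (hx k))]
  ring_nf

/-- A weight only shifts both exponents, so its effect on integrability can be read off from
inequalities between numbers. -/
theorem weight_mul_prod_powTail {m n : ℕ} (s κ τ : Fin m → ℝ) {x : Space m n}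
    (hx : ∀ k, x k ≠ 0) :
    weight s x * ∏ k, powTail (κ k) (τ k) ‖x k‖ =
      ∏ k, powTail (κ k - s k / 2) (τ k - s k / 2) ‖x k‖ := by
  rw [weight, ← Finset.prod_mul_distrib]
  refine Finset.prod_congr rfl fun k _ => ?_
  have h := powTail_mul (-(s k / 2)) (-(s k / 2)) (κ k) (τ k) (norm_pos_iff.2 (hx k))
  rw [← neg_add_eq_sub, ← neg_add_eq_sub, ← h]
  simp [powTail]

theorem prod_one_add_eq {m n : ℕ} (a : Fin m → ℝ) (x : Space m n) :
    ∏ k, (1 + ‖x k‖) ^ (-a k) = ∏ k, powTail 0 (a k) ‖x k‖ := by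
  simp [powTail]

/-- The limit inherits the majorant, so |F_J - f|² ≤ (2G)², and dominated convergence applies. -/
theorem tendsto_eLpNorm_sub_zero {X : Type*} [MeasurableSpace X] {μ : Measure X}
    {F : ℕ → X → ℂ} {f : X → ℂ} {G : X → ℝ} (hF : ∀ J, AEStronglyMeasurable (F J) μ)
    (hG : MemLp G 2 μ) (hb : ∀ J, ∀ᵐ x ∂μ, ‖F J x‖ ≤ G x)
    (hl : ∀ᵐ x ∂μ, Tendsto (fun J => F J x) atTop (𝓝 (f x))) :
    Tendsto (fun J => eLpNorm (F J - f) 2 μ) atTop (𝓝 0) := by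
  have hf : AEStronglyMeasurable f μ := aestronglyMeasurable_of_tendsto_ae _ hF hl
  have hint : ∫⁻ x, (2 * ‖G x‖ₑ) ^ (2 : ℝ) ∂μ ≠ ∞ := by
    have h2 := (hG.const_mul (2 : ℝ)).2
    rw [eLpNorm_lt_top_iff_lintegral_rpow_enorm_lt_top (by norm_num) (by norm_num)] at h2
    refine (lt_of_eq_of_lt (lintegral_congr fun x => ?_) h2).ne
    rw [enorm_mul, Real.enorm_eq_ofReal zero_le_two, ENNReal.ofReal_ofNat]
    rfl
  have key : Tendsto (fun J => ∫⁻ x, ‖F J x - f x‖ₑ ^ (2 : ℝ) ∂μ) atTop (𝓝 (∫⁻ _, 0 ∂μ)) := by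
    refine tendsto_lintegral_of_dominated_convergence' (fun x => (2 * ‖G x‖ₑ) ^ (2 : ℝ))
      (fun J => ((hF J).sub hf).enorm.pow_const _) (fun J => ?_) hint ?_
    · filter_upwards [hb J, hl, ae_all_iff.2 hb] with x hx hx' hall
      have h1 : ‖f x‖ ≤ G x := le_of_tendsto hx'.norm (Eventually.of_forall hall)
      have h0 : 0 ≤ G x := (norm_nonneg _).trans h1
      gcongr
      rw [← ofReal_norm, ← ofReal_norm, Real.norm_of_nonneg h0, ← ENNReal.ofReal_ofNat 2,
        ← ENNReal.ofReal_mul (by norm_num)]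
      exact ENNReal.ofReal_le_ofReal ((norm_sub_le _ _).trans (by linarith))
    · filter_upwards [hl] with x hx
      have h1 : Tendsto (fun J => F J x - f x) atTop (𝓝 0) := by
        simpa using hx.sub_const (f x)
      have h2 := (ENNReal.continuous_rpow_const (y := 2)).continuousAt.tendsto.comp h1.enorm
      simpa [Function.comp_def] using h2
  have h3 := (ENNReal.continuous_rpow_const (y := 1 / 2)).continuousAt.tendsto.comp key
  simp only [lintegral_const, zero_mul] at h3
  rw [ENNReal.zero_rpow_of_pos (by norm_num)] at h3
  refine h3.congr fun J => ?_
  rw [eLpNorm_eq_lintegral_rpow_enorm_toReal (by norm_num) (by norm_num)]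
  rfl

/-! ### The Fourier transform on L² against the Fourier integral. -/

section Plancherel

variable {V : Type*} [NormedAddCommGroup V] [InnerProductSpace ℝ V] [FiniteDimensional ℝ V]
  [MeasurableSpace V] [BorelSpace V]

theorem continuous_fourier {g : V → ℂ} (hg : Integrable g) : Continuous (𝓕 g) :=
  VectorFourier.fourierIntegral_continuous Real.continuous_fourierChar
    (by exact continuous_inner) hg

theorem fourierInv_eq_comp_neg (g : V → ℂ) : 𝓕⁻ g = fun x => 𝓕 g (-x) :=
  funext fun x => Real.fourierInv_eq_fourier_neg g x

theorem continuous_fourierInv {g : V → ℂ} (hg : Integrable g) : Continuous (𝓕⁻ g) := by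
  rw [fourierInv_eq_comp_neg]
  exact (continuous_fourier hg).comp continuous_neg

theorem integral_fourier_mul_eq {f g : V → ℂ} (hf : Integrable f) (hg : Integrable g) :
    ∫ x, 𝓕 f x * g x = ∫ x, f x * 𝓕 g x := by
  simpa using! (VectorFourier.integral_fourierIntegral_smul_eq_flip (L := innerₗ V)
      Real.continuous_fourierChar continuous_inner hf hg)

theorem integral_fourierInv_mul_eq {f g : V → ℂ} (hf : Integrable f) (hg : Integrable g) :
    ∫ x, 𝓕⁻ f x * g x = ∫ x, f x * 𝓕⁻ g x := by
  have hg' : Integrable fun x => g (-x) := hg.comp_neg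
  have h := integral_fourier_mul_eq hf hg'
  rw [fourierInv_eq_comp_neg, fourierInv_eq_comp_neg, ← integral_neg_eq_self]
  simp only [neg_neg]
  rw [h]
  congr 1
  ext x
  rw [← Real.fourierInv_eq_fourier_comp_neg, ← Real.fourierInv_eq_fourier_neg]

/-- Both sides agree as distributions: against a test function, the L² transform and the Fourier
integral both obey the multiplication formula. -/
theorem coeFn_fourier_toLp {g : V → ℂ} (h1 : Integrable g) (h2 : MemLp g 2) :
    (𝓕 (h2.toLp g) : Lp ℂ 2 (volume : Measure V)) =ᵐ[volume] 𝓕 g := by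
  refine ae_eq_of_integral_contDiff_smul_eq ((Lp.memLp _).locallyIntegrable (by norm_num))
    (continuous_fourier h1).locallyIntegrable fun φ hφ hφc => ?_
  have hg₁ : HasCompactSupport (Complex.ofRealCLM ∘ φ) := hφc.comp_left rfl
  have hg₂ : ContDiff ℝ ((⊤ : ℕ∞) : WithTop ℕ∞) (Complex.ofRealCLM ∘ φ) := by fun_prop
  set ψ : 𝓢(V, ℂ) := hg₁.toSchwartzMap hg₂ with hψ
  have e : ∀ x, ψ x = φ x := fun x => rfl
  calc ∫ x, φ x • (𝓕 (h2.toLp g) : Lp ℂ 2 (volume : Measure V)) x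
      = Lp.toTemperedDistribution (𝓕 (h2.toLp g) : Lp ℂ 2 (volume : Measure V)) ψ := by
        rw [Lp.toTemperedDistribution_apply]; simp [e]
    _ = Lp.toTemperedDistribution (h2.toLp g) (𝓕 ψ) := by
        rw [← Lp.fourier_toTemperedDistribution_eq, TemperedDistribution.fourier_apply]
    _ = ∫ x, 𝓕 (ψ : V → ℂ) x * g x := by
        rw [Lp.toTemperedDistribution_apply]
        refine integral_congr_ae ?_
        filter_upwards [h2.coeFn_toLp] with x hx
        rw [hx, SchwartzMap.fourier_coe, smul_eq_mul]
    _ = ∫ x, ψ x * 𝓕 g x := integral_fourier_mul_eq ψ.integrable h1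
    _ = _ := by simp [e]

theorem coeFn_fourierInv_toLp {g : V → ℂ} (h1 : Integrable g) (h2 : MemLp g 2) :
    (𝓕⁻ (h2.toLp g) : Lp ℂ 2 (volume : Measure V)) =ᵐ[volume] 𝓕⁻ g := by
  refine ae_eq_of_integral_contDiff_smul_eq ((Lp.memLp _).locallyIntegrable (by norm_num))
    (continuous_fourierInv h1).locallyIntegrable fun φ hφ hφc => ?_
  have hg₁ : HasCompactSupport (Complex.ofRealCLM ∘ φ) := hφc.comp_left rfl
  have hg₂ : ContDiff ℝ ((⊤ : ℕ∞) : WithTop ℕ∞) (Complex.ofRealCLM ∘ φ) := by fun_prop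
  set ψ : 𝓢(V, ℂ) := hg₁.toSchwartzMap hg₂ with hψ
  have e : ∀ x, ψ x = φ x := fun x => rfl
  calc ∫ x, φ x • (𝓕⁻ (h2.toLp g) : Lp ℂ 2 (volume : Measure V)) x
      = Lp.toTemperedDistribution (𝓕⁻ (h2.toLp g) : Lp ℂ 2 (volume : Measure V)) ψ := by
        rw [Lp.toTemperedDistribution_apply]; simp [e]
    _ = Lp.toTemperedDistribution (h2.toLp g) (𝓕⁻ ψ) := by
        rw [← Lp.fourierInv_toTemperedDistribution_eq, TemperedDistribution.fourierInv_apply]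
    _ = ∫ x, 𝓕⁻ (ψ : V → ℂ) x * g x := by
        rw [Lp.toTemperedDistribution_apply]
        refine integral_congr_ae ?_
        filter_upwards [h2.coeFn_toLp] with x hx
        rw [hx, SchwartzMap.fourierInv_coe, smul_eq_mul]
    _ = ∫ x, ψ x * 𝓕⁻ g x := integral_fourierInv_mul_eq ψ.integrable h1
    _ = _ := by simp [e]

theorem norm_fourierInv_toLp_sub {f g : V → ℂ} (hf : MemLp f 2) (hg : MemLp g 2) :
    eLpNorm (((𝓕⁻ (hf.toLp f) : Lp ℂ 2 (volume : Measure V)) : V → ℂ) -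
      ((𝓕⁻ (hg.toLp g) : Lp ℂ 2 (volume : Measure V)) : V → ℂ)) 2 volume =
      eLpNorm (f - g) 2 volume := by
  have h : ‖(𝓕⁻ (hf.toLp f) - 𝓕⁻ (hg.toLp g) : Lp ℂ 2 (volume : Measure V))‖ =
      ‖hf.toLp f - hg.toLp g‖ := by
    have h0 : ∀ A B : Lp ℂ 2 (volume : Measure V), 𝓕 (A - B) = 𝓕 A - 𝓕 B :=
      map_sub (Lp.fourierTransformₗᵢ V ℂ)
    rw [← Lp.norm_fourier_eq, h0, FourierTransform.fourier_fourierInv_eq, FourierTransform.fourier_fourierInv_eq]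
  rw [← MemLp.toLp_sub, Lp.norm_toLp, Lp.norm_def,
    ENNReal.toReal_eq_toReal_iff' (Lp.eLpNorm_ne_top _) (hf.sub hg).2.ne] at h
  rw [← h]
  exact eLpNorm_congr_ae (Lp.coeFn_sub _ _).symm

end Plancherel

/-! ### Square integrability of the multiplier side and of Tf. -/

/-- The exponent (3n+α_k)/4 lies below n, so it is an admissible Fourier decay rate, and above
(n+α_k)/2, so the weighted bound is in L²; both follow from α_k < n. -/
theorem memLp_weight_mul {m n : ℕ} (hn : 0 < n) {α : Fin m → ℝ}
    (hα : ∀ k, 0 ≤ α k ∧ α k < n) {a : Fin m → ℝ}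
    (ha : a = fun k => (3 * n + α k) / 4) (C : ℝ) :
    MemLp (fun ξ : Space m n => weight α ξ * (C * ∏ k, (1 + ‖ξ k‖) ^ (-a k))) 2 := by
  have h := memLp_prod_powTail (m := m) hn (κ := fun k => -(α k / 2))
    (τ := fun k => a k - α k / 2) (fun k => by have := hα k; linarith)
    (fun k => by have := hα k; simp only [ha]; linarith) C
  refine h.ae_eq ?_
  filter_upwards [ae_block_ne_zero m hn] with x hx
  rw [prod_one_add_eq, mul_left_comm, weight_mul_prod_powTail _ _ _ hx]
  simp

theorem aestronglyMeasurable_fracLapFourier {m n : ℕ} (α : Fin m → ℝ) {u : Space m n → ℂ}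
    (hu : Integrable u) : AEStronglyMeasurable (fracLapFourier α u) := by
  have h1 := (measurable_weight (n := n) α).complex_ofReal.aestronglyMeasurable
    (μ := (volume : Measure (Space m n)))
  exact h1.mul (continuous_fourier hu).aestronglyMeasurable

theorem norm_fracLapFourier {m n : ℕ} (α : Fin m → ℝ) (u : Space m n → ℂ) (ξ : Space m n) :
    ‖fracLapFourier α u ξ‖ = weight α ξ * ‖𝓕 u ξ‖ := norm_weighted α (𝓕 u) ξ

theorem memLp_fracLapFourier {m n : ℕ} (hn : 0 < n) {α β : Fin m → ℝ}
    (hα : ∀ k, 0 ≤ α k ∧ α k < n) (hβ : ∀ k, 0 ≤ β k) (f : 𝓢(Space m n, ℂ)) :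
    MemLp (fracLapFourier α (weighted β f)) 2 := by
  obtain ⟨N, C, hC, h⟩ := fourier_weighted_le hn hβ (a := fun k => (3 * n + α k) / 4)
    (fun k => by have := hα k; linarith) (fun k => by have := hα k; have := hβ k; linarith)
  refine (memLp_weight_mul hn hα rfl (C * sNorm N f)).mono'
    (aestronglyMeasurable_fracLapFourier α (integrable_weighted hβ f))
    (Eventually.of_forall fun ξ => ?_)
  rw [norm_fracLapFourier]
  exact mul_le_mul_of_nonneg_left (h f ξ) (weight_nonneg _ _)

theorem integrable_fracLapFourier {m n : ℕ} {α : Fin m → ℝ} (hα : ∀ k, 0 ≤ α k)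
    (f : 𝓢(Space m n, ℂ)) : Integrable (fracLapFourier α f) := by
  rw [fracLapFourier_eq]; exact integrable_weighted hα _

theorem memLp_fracLapFourier_schwartz {m n : ℕ} (hn : 0 < n) {α : Fin m → ℝ}
    (hα : ∀ k, 0 ≤ α k ∧ α k < n) (f : 𝓢(Space m n, ℂ)) :
    MemLp (fracLapFourier α f) 2 := by
  have h := memLp_fracLapFourier hn hα (β := 0) (fun _ => le_rfl) f
  have e : weighted 0 (f : Space m n → ℂ) = f := by ext x; simp [weighted, weight]
  rwa [e] at h

theorem fracLap_eq {m n : ℕ} {α : Fin m → ℝ} {u : Space m n → ℂ}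
    (h : MemLp (fracLapFourier α u) 2) : fracLap α u = 𝓕⁻ (h.toLp _) := dif_pos h

theorem fracLap_schwartz {m n : ℕ} (hn : 0 < n) {α : Fin m → ℝ}
    (hα : ∀ k, 0 ≤ α k ∧ α k < n) (f : 𝓢(Space m n, ℂ)) :
    fracLap α f =ᵐ[volume] 𝓕⁻ (fracLapFourier α f) := by
  rw [fracLap_eq (memLp_fracLapFourier_schwartz hn hα f)]
  exact coeFn_fourierInv_toLp (integrable_fracLapFourier (fun k => (hα k).1) f) _

theorem tendsto_fracLapFourier_mulTrunc {m n : ℕ} (hn : 0 < n) {α β : Fin m → ℝ}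
    (hα : ∀ k, 0 ≤ α k ∧ α k < n) (hβ : ∀ k, 0 ≤ β k) (f : 𝓢(Space m n, ℂ)) :
    Tendsto (fun J => eLpNorm (fracLapFourier α (mulTrunc (fun k => β k / 2) J f) -
      fracLapFourier α (weighted β f)) 2 volume) atTop (𝓝 0) := by
  obtain ⟨N, C, hC, h⟩ := fourier_mulTrunc_le n (fun k => β k / 2) (fun k => (3 * n + α k) / 4)
    (fun k => by have := hα k; linarith) (fun k => by have := hα k; have := hβ k; linarith)
  refine tendsto_eLpNorm_sub_zero
    (fun J => (integrable_fracLapFourier (fun k => (hα k).1) _).aestronglyMeasurable)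
    (memLp_weight_mul hn hα rfl (C * sNorm N f)) (fun J => Eventually.of_forall fun ξ => ?_)
    (Eventually.of_forall fun ξ => ?_)
  · rw [norm_fracLapFourier]
    exact mul_le_mul_of_nonneg_left (h J f ξ) (weight_nonneg _ _)
  · exact (tendsto_fourier_mulTrunc hn hβ f ξ).const_mul _

/-- Convergence on the Fourier side is transported by Plancherel; a subsequence then converges
almost everywhere, which lets pointwise bounds for truncations survive. -/
theorem exists_seq_tendsto_fracLap {m n : ℕ} (hn : 0 < n) {α β : Fin m → ℝ}
    (hα : ∀ k, 0 ≤ α k ∧ α k < n) (hβ : ∀ k, 0 ≤ β k) (f : 𝓢(Space m n, ℂ)) :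
    ∃ ns : ℕ → ℕ, StrictMono ns ∧ ∀ᵐ x, Tendsto
      (fun i => 𝓕⁻ (fracLapFourier α (mulTrunc (fun k => β k / 2) (ns i) f)) x) atTop
      (𝓝 (fracLap α (weighted β f) x)) := by
  have h1 := tendsto_fracLapFourier_mulTrunc hn hα hβ f
  have h2 : Tendsto (fun J => fracLap α (mulTrunc (fun k => β k / 2) J f)) atTop
      (𝓝 (fracLap α (weighted β f))) := by
    rw [Lp.tendsto_Lp_iff_tendsto_eLpNorm']
    refine h1.congr fun J => ?_
    rw [fracLap_eq (memLp_fracLapFourier_schwartz hn hα _),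
      fracLap_eq (memLp_fracLapFourier hn hα hβ f), norm_fourierInv_toLp_sub]
  obtain ⟨ns, hns, h3⟩ := (tendstoInMeasure_of_tendsto_Lp h2).exists_seq_tendsto_ae
  refine ⟨ns, hns, ?_⟩
  filter_upwards [h3, ae_all_iff.2 fun J =>
    fracLap_schwartz hn hα (mulTrunc (fun k => β k / 2) J f)] with x hx hall
  exact hx.congr fun i => hall _

theorem fracLap_weighted_le {m n : ℕ} (hn : 0 < n) {α β κ a : Fin m → ℝ}
    (hα : ∀ k, 0 ≤ α k ∧ α k < n) (hβ : ∀ k, 0 ≤ β k)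
    (hκ : ∀ k, 0 ≤ κ k) (hκa : ∀ k, κ k ≤ a k) (ha : ∀ k, a k < n + α k / 2)
    (hb : ∀ k, α k / 2 - β k / 2 < κ k) : ∃ (N : ℕ) (C : ℝ), 0 ≤ C ∧
    ∀ f : 𝓢(Space m n, ℂ),
      (∀ J x, (∀ k, x k ≠ 0) → ‖𝓕⁻ (fracLapFourier α (mulTrunc (fun k => β k / 2) J f)) x‖ ≤
        C * sNorm N f * ∏ k, powTail (κ k) (a k) ‖x k‖) ∧
      ∀ᵐ x, ‖fracLap α (weighted β f) x‖ ≤ C * sNorm N f * ∏ k, powTail (κ k) (a k) ‖x k‖ := by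
  obtain ⟨N, C, hC, h⟩ := fracDeriv_mulTrunc_le hn (fun k => (hα k).1) hκ hκa ha hb
  refine ⟨N, C, hC, fun f => ⟨fun J => h J f, ?_⟩⟩
  obtain ⟨ns, -, h1⟩ := exists_seq_tendsto_fracLap hn hα hβ f
  filter_upwards [h1, ae_block_ne_zero m hn] with x hx hx0
  exact le_of_tendsto hx.norm (Eventually.of_forall fun i => h _ f x hx0)

/-- The exponent κ = (α+n)/4 exceeds α/2, hence α/2 - β/2, and is below n; a = n + α/4 lies strictly
between n and n + α/2. The same pair is reused for every later bound on the fractional derivative.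
-/
theorem integrable_fracLap {m n : ℕ} (hn : 0 < n) {α β : Fin m → ℝ}
    (hα : ∀ k, 0 < α k ∧ α k < n) (hβ : ∀ k, 0 ≤ β k) (f : 𝓢(Space m n, ℂ)) :
    Integrable (fracLap α (weighted β f)) := by
  obtain ⟨N, C, hC, h⟩ := fracLap_weighted_le hn (κ := fun k => (α k + n) / 4)
    (a := fun k => n + α k / 4) (fun k => ⟨(hα k).1.le, (hα k).2⟩) hβ
    (fun k => by have := hα k; linarith) (fun k => by have := hα k; linarith)
    (fun k => by have := hα k; linarith) (fun k => by have := hα k; have := hβ k; linarith)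
  exact integrable_of_le_powTail (fun k => by have := hα k; linarith)
    (fun k => by have := hα k; linarith) (Lp.aestronglyMeasurable _) (h f).2

theorem aestronglyMeasurable_weighted {m n : ℕ} (s : Fin m → ℝ) {u : Space m n → ℂ}
    (hu : AEStronglyMeasurable u) : AEStronglyMeasurable (weighted s u) :=
  (measurable_weight s).complex_ofReal.aestronglyMeasurable.mul hu

/-- After multiplication by |x|^(ρ/2) the majorant has exponents (α+n)/4 - ρ/2 at the origin and n +
α/4 - ρ/2 at infinity; these lie on the two sides of n/2 because α, ρ < n. One majorant gives both
membership in L² and convergence of the truncations. -/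
theorem memLp_iterated_and_tendsto {m n : ℕ} (hn : 0 < n) {α β ρ : Fin m → ℝ}
    (hα : ∀ k, 0 < α k ∧ α k < n) (hβ : ∀ k, 0 ≤ β k) (hρ : ∀ k, 0 ≤ ρ k ∧ ρ k < n)
    (f : 𝓢(Space m n, ℂ)) :
    MemLp (iterated α β ρ f) 2 ∧ ∃ ns : ℕ → ℕ, StrictMono ns ∧ Tendsto (fun i =>
      eLpNorm (weighted ρ (fracLap α (mulTrunc (fun k => β k / 2) (ns i) f)) -
        iterated α β ρ f) 2 volume) atTop (𝓝 0) := by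
  have hα' : ∀ k, 0 ≤ α k ∧ α k < n := fun k => ⟨(hα k).1.le, (hα k).2⟩
  obtain ⟨N, C, hC, h⟩ := fracLap_weighted_le hn (κ := fun k => (α k + n) / 4)
    (a := fun k => n + α k / 4) hα' hβ
    (fun k => by have := hα k; linarith) (fun k => by have := hα k; linarith)
    (fun k => by have := hα k; linarith) (fun k => by have := hα k; have := hβ k; linarith)
  obtain ⟨ns, hns, hlim⟩ := exists_seq_tendsto_fracLap hn hα' hβ f
  have hG := memLp_prod_powTail (m := m) hn (κ := fun k => (α k + n) / 4 - ρ k / 2)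
    (τ := fun k => n + α k / 4 - ρ k / 2)
    (fun k => by have := hα k; have := hρ k; linarith)
    (fun k => by have := hα k; have := hρ k; linarith) (C * sNorm N f)
  have hle : ∀ {u : Space m n → ℂ}, (∀ᵐ x, ‖u x‖ ≤
      C * sNorm N f * ∏ k, powTail ((α k + n) / 4) (n + α k / 4) ‖x k‖) →
      ∀ᵐ x, ‖weighted ρ u x‖ ≤ C * sNorm N f *
        ∏ k, powTail ((α k + n) / 4 - ρ k / 2) (n + α k / 4 - ρ k / 2) ‖x k‖ := by
    intro u hu
    filter_upwards [hu, ae_block_ne_zero m hn] with x hx hx0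
    rw [norm_weighted, ← weight_mul_prod_powTail ρ (fun k => (α k + n) / 4) _ hx0,
      mul_left_comm]
    exact mul_le_mul_of_nonneg_left hx (weight_nonneg _ _)
  have hJ : ∀ J, fracLap α (mulTrunc (fun k => β k / 2) J f) =ᵐ[volume]
    𝓕⁻ (fracLapFourier α (mulTrunc (fun k => β k / 2) J f)) := fun J => fracLap_schwartz hn hα' _
  refine ⟨hG.mono' (aestronglyMeasurable_weighted _ (Lp.aestronglyMeasurable _)) (hle (h f).2),
    ns, hns, tendsto_eLpNorm_sub_zero
      (fun i => aestronglyMeasurable_weighted _ (Lp.aestronglyMeasurable _)) hG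
      (fun i => hle ?_) ?_⟩
  · filter_upwards [hJ (ns i), ae_block_ne_zero m hn] with x hx hx0
    rw [hx]
    exact (h f).1 _ x hx0
  · filter_upwards [hlim, ae_all_iff.2 hJ] with x hx hall
    simp only [weighted, iterated]
    refine Tendsto.const_mul _ (hx.congr fun i => ?_)
    rw [hall]

/-! ### Density in L² of the functions Tf. -/

theorem weighted_zero {m n : ℕ} (f : Space m n → ℂ) : weighted 0 f = f := by
  ext x; simp [weighted, weight]

theorem trunc_apply_zero {n : ℕ} (b : ℝ) (J : ℕ) : trunc b J (0 : EuclideanSpace ℝ (Fin n)) = 0 := by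
  simp [trunc, powCut, Real.smoothTransition.zero_of_nonpos]

theorem rpow_mul_trunc_neg {n : ℕ} (b : ℝ) (J : ℕ) (x : EuclideanSpace ℝ (Fin n)) :
    ‖x‖ ^ b * trunc (-b) J x = trunc 0 J x := by
  rcases eq_or_ne x 0 with rfl | hx
  · simp [trunc_apply_zero]
  have hx' : 0 < ‖x‖ := norm_pos_iff.2 hx
  simp only [trunc, powCut, norm_smul, norm_pow, Real.norm_ofNat, neg_neg, neg_zero,
    Real.rpow_zero, one_pow, one_mul]
  rw [Real.mul_rpow (by positivity) hx'.le, ← Real.rpow_natCast, ← Real.rpow_natCast,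
    ← Real.rpow_mul (by norm_num), ← Real.rpow_mul (by norm_num)]
  have h1 : ‖x‖ ^ b * ‖x‖ ^ (-b) = 1 := by rw [← Real.rpow_add hx']; simp
  have h2 : (2 : ℝ) ^ (b * J) * (2 : ℝ) ^ (J * -b) = 1 := by
    rw [← Real.rpow_add (by norm_num)]; ring_nf; simp
  set S := Real.smoothTransition _
  calc _ = (‖x‖ ^ b * ‖x‖ ^ (-b)) * ((2 : ℝ) ^ (b * J) * (2 : ℝ) ^ (J * -b)) * S := by ring
    _ = S := by rw [h1, h2, one_mul, one_mul]

/-- Truncation with the opposite exponent inverts the weight up to a smooth cutoff near the zeros of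
the blocks, while staying within Schwartz functions. -/
theorem weighted_mulTrunc_neg {m n : ℕ} (s : Fin m → ℝ) (J : ℕ) (f : 𝓢(Space m n, ℂ)) :
    weighted s (mulTrunc (fun k => -(s k / 2)) J f) = mulTrunc (fun _ => 0) J f := by
  ext x
  have h : weight s x * truncProd (fun k => -(s k / 2)) J x = truncProd (fun _ => 0) J x := by
    simp only [weight, truncProd, ← Finset.prod_mul_distrib]
    exact Finset.prod_congr rfl fun k _ => rpow_mul_trunc_neg _ _ _
  rw [weighted, mulTrunc_apply, mulTrunc_apply, ← h, ← Complex.coe_smul, ← Complex.coe_smul,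
    smul_eq_mul, smul_eq_mul, Complex.ofReal_mul, mul_assoc]

theorem tendsto_weighted_mulTrunc_neg {m n : ℕ} (hn : 0 < n) (s : Fin m → ℝ)
    (f : 𝓢(Space m n, ℂ)) :
    Tendsto (fun J => eLpNorm ((weighted s (mulTrunc (fun k => -(s k / 2)) J f)) - (f : _ → ℂ)) 2
      volume) atTop (𝓝 0) := by
  simp_rw [weighted_mulTrunc_neg]
  have e : (fun _ : Fin m => (0 : ℝ)) = fun k => (0 : Fin m → ℝ) k / 2 := by simp
  refine tendsto_eLpNorm_sub_zero (G := fun x => ‖f x‖)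
    (fun J => (mulTrunc _ J f).continuous.aestronglyMeasurable) (f.memLp 2).norm
    (fun J => Eventually.of_forall fun x => ?_) ?_
  · rw [e]
    simpa [weighted_zero] using norm_mulTrunc_le 0 J f x
  · filter_upwards [ae_block_ne_zero m hn] with x hx
    rw [e]
    simpa [weighted_zero] using tendsto_mulTrunc 0 f hx

/-- The functions in the `L²` closure of the range of `iterated α β ρ` on Schwartz functions. -/
def Approx {m n : ℕ} (α β ρ : Fin m → ℝ) (g : Space m n → ℂ) : Prop :=
  ∀ ε : ℝ≥0∞, 0 < ε → ∃ f : 𝓢(Space m n, ℂ), eLpNorm (iterated α β ρ f - g) 2 volume < ε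

/-- The set described by `Approx` is closed, so targets can be reached in several successive limits.
-/
theorem approx_of_tendsto {m n : ℕ} {α β ρ : Fin m → ℝ} {u : ℕ → Space m n → ℂ}
    {g : Space m n → ℂ} (hu : ∀ i, AEStronglyMeasurable (u i)) (hg : AEStronglyMeasurable g)
    (h : ∀ i, Approx α β ρ (u i)) (hl : Tendsto (fun i => eLpNorm (u i - g) 2 volume) atTop (𝓝 0)) :
    Approx α β ρ g := by
  intro ε hε
  obtain ⟨i, hi⟩ := (hl.eventually_lt_const (ENNReal.half_pos hε.ne')).exists
  obtain ⟨f, hf⟩ := h i (ε / 2) (ENNReal.half_pos hε.ne')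
  refine ⟨f, ?_⟩
  have hm : AEStronglyMeasurable (iterated α β ρ f) :=
    aestronglyMeasurable_weighted _ (Lp.aestronglyMeasurable _)
  calc eLpNorm (iterated α β ρ f - g) 2 volume
      = eLpNorm ((iterated α β ρ f - u i) + (u i - g)) 2 volume := by rw [sub_add_sub_cancel]
    _ ≤ _ := eLpNorm_add_le (hm.sub (hu i)) ((hu i).sub hg) (by norm_num)
    _ < ε / 2 + ε / 2 := ENNReal.add_lt_add hf hi
    _ = ε := ENNReal.add_halves ε

theorem iterated_congr_weighted {m n : ℕ} {α β ρ : Fin m → ℝ} {f g : Space m n → ℂ}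
    (h : weighted β f = g) : iterated α β ρ f = weighted ρ (fracLap α g) := by rw [iterated, h]

/-- The Schwartz function φ is built so that its fractional derivative is exactly the inverse
transform of a cutoff of h. Dividing a cutoff of φ by the weight |x|^(β/2) gives Schwartz functions
whose images under T converge, by the case β = 0 of the truncation result. -/
theorem approx_fourierInv_mulTrunc {m n : ℕ} (hn : 0 < n) {α β ρ : Fin m → ℝ}
    (hα : ∀ k, 0 < α k ∧ α k < n) (hρ : ∀ k, 0 ≤ ρ k ∧ ρ k < n)
    (J : ℕ) (h : 𝓢(Space m n, ℂ)) :
    Approx α β ρ (weighted ρ (𝓕⁻ (mulTrunc (fun _ => 0) J h) : 𝓢(Space m n, ℂ))) := by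
  set φ : 𝓢(Space m n, ℂ) := 𝓕⁻ (mulTrunc (fun k => -(α k / 2)) J h) with hφ
  have hα' : ∀ k, 0 ≤ α k ∧ α k < n := fun k => ⟨(hα k).1.le, (hα k).2⟩
  obtain ⟨-, ns, hns, hl⟩ := memLp_iterated_and_tendsto hn hα (β := 0) (ρ := ρ) (fun _ => le_rfl)
    hρ φ
  have h1 : fracLapFourier α φ = mulTrunc (fun _ => 0) J h := by
    rw [fracLapFourier_eq, hφ, FourierTransform.fourier_fourierInv_eq, weighted_mulTrunc_neg]
  have h2 : iterated α 0 ρ φ =ᵐ[volume]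
      weighted ρ (𝓕⁻ (mulTrunc (fun _ => 0) J h) : 𝓢(Space m n, ℂ)) := by
    rw [iterated_congr_weighted (weighted_zero _)]
    filter_upwards [fracLap_schwartz hn hα' φ] with x hx
    rw [weighted, weighted, hx, h1, SchwartzMap.fourierInv_coe]
  intro ε hε
  obtain ⟨i, hi⟩ := (hl.eventually_lt_const hε).exists
  refine ⟨mulTrunc (fun k => -(β k / 2)) (ns i) φ, ?_⟩
  rw [iterated_congr_weighted (weighted_mulTrunc_neg β (ns i) φ)]
  have e : (fun _ : Fin m => (0 : ℝ)) = fun k => (0 : Fin m → ℝ) k / 2 := by simp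
  rw [eLpNorm_congr_ae ((EventuallyEq.refl _ _).sub h2), ← e] at hi
  exact hi

theorem aestronglyMeasurable_weighted_schwartz {m n : ℕ} (s : Fin m → ℝ) (f : 𝓢(Space m n, ℂ)) :
    AEStronglyMeasurable (weighted s f) :=
  aestronglyMeasurable_weighted s f.continuous.aestronglyMeasurable

/-- The frequency cutoff is removed by letting J → ∞ with h the Fourier transform of w. The decay
rate (3n+ρ_k)/4 below n is uniform in the cutoff and beats the weight |x|^(ρ/2) in L². -/
theorem approx_weighted {m n : ℕ} (hn : 0 < n) {α β ρ : Fin m → ℝ}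
    (hα : ∀ k, 0 < α k ∧ α k < n) (hρ : ∀ k, 0 ≤ ρ k ∧ ρ k < n) (w : 𝓢(Space m n, ℂ)) :
    Approx α β ρ (weighted ρ w) := by
  refine approx_of_tendsto (fun J => aestronglyMeasurable_weighted_schwartz _ _)
    (aestronglyMeasurable_weighted_schwartz _ _)
    (fun J => approx_fourierInv_mulTrunc hn hα hρ J (𝓕 w)) ?_
  obtain ⟨N, C, hC, h⟩ := fourier_mulTrunc_le n (fun _ => 0) (fun k => (3 * n + ρ k) / 4)
    (fun k => by have := hρ k; linarith) (fun k => by have := hρ k; linarith)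
  refine tendsto_eLpNorm_sub_zero (fun J => aestronglyMeasurable_weighted_schwartz _ _)
    (memLp_weight_mul hn hρ rfl (C * sNorm N (𝓕 w))) (fun J => Eventually.of_forall fun x => ?_)
    (Eventually.of_forall fun x => ?_)
  · rw [norm_weighted, SchwartzMap.fourierInv_coe, fourierInv_eq_comp_neg]
    have := h J (𝓕 w) (-x)
    simp only [PiLp.neg_apply, norm_neg] at this
    exact mul_le_mul_of_nonneg_left this (weight_nonneg _ _)
  · refine Tendsto.const_mul _ ?_
    have := tendsto_fourier_mulTrunc hn (s := (0 : Fin m → ℝ)) (fun _ => le_rfl) (𝓕 w) (-x)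
    rw [weighted_zero, ← SchwartzMap.fourier_coe] at this
    have e : 𝓕 (𝓕 w) (-x) = w x := by
      rw [SchwartzMap.fourier_coe, ← Real.fourierInv_eq_fourier_neg, ← SchwartzMap.fourierInv_coe,
        FourierTransform.fourierInv_fourier_eq]
    rw [e] at this
    refine this.congr fun J => ?_
    rw [SchwartzMap.fourierInv_coe, fourierInv_eq_comp_neg]
    simp

/-- The functions `iterated α β ρ f`, `f` Schwartz, are dense in `L²`. -/
theorem approx_of_memLp {m n : ℕ} (hn : 0 < n) {α β ρ : Fin m → ℝ}
    (hα : ∀ k, 0 < α k ∧ α k < n) (hρ : ∀ k, 0 ≤ ρ k ∧ ρ k < n) {g : Space m n → ℂ}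
    (hg : MemLp g 2) : Approx α β ρ g := by
  -- The weight |x|^(ρ/2) is inverted on a cutoff of h, and the cutoff is then removed; Schwartz
  -- functions being dense, this suffices.
  have h1 : ∀ h : 𝓢(Space m n, ℂ), Approx α β ρ h := fun h =>
    approx_of_tendsto (fun J => aestronglyMeasurable_weighted_schwartz _ _)
      h.continuous.aestronglyMeasurable (fun J => approx_weighted hn hα hρ _)
      (tendsto_weighted_mulTrunc_neg hn ρ h)
  have h2 := (SchwartzMap.denseRange_toLpCLM (E := Space m n) (F := ℂ)
    (p := 2) (μ := volume) ENNReal.ofNat_ne_top) (hg.toLp g)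
  obtain ⟨u, hu, hl⟩ := mem_closure_iff_seq_limit.1 h2
  choose v hv using hu
  refine approx_of_tendsto (u := fun i => v i) (fun i => (v i).continuous.aestronglyMeasurable)
    hg.aestronglyMeasurable (fun i => h1 _) ?_
  rw [Lp.tendsto_Lp_iff_tendsto_eLpNorm'] at hl
  refine hl.congr fun i => eLpNorm_congr_ae ?_
  rw [← hv i]
  exact ((v i).coeFn_toLp 2 volume).sub hg.coeFn_toLp

/-! ### Gaussian subordination of powers. -/

section Subordination

theorem integrableOn_rpow_mul_exp {s A : ℝ} (hs : 0 < s) (hA : 0 < A) :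
    IntegrableOn (fun t : ℝ => t ^ (s / 2 - 1) * Real.exp (-(Real.pi * A ^ 2 * t))) (Set.Ioi 0) := by
  have := integrableOn_rpow_mul_exp_neg_mul_rpow (p := 1) (s := s / 2 - 1)
    (b := Real.pi * A ^ 2) (by linarith) one_pos (by positivity)
  simpa using this

theorem integral_rpow_mul_exp {s A : ℝ} (hs : 0 < s) (hA : 0 < A) :
    ∫ t in Set.Ioi (0 : ℝ), t ^ (s / 2 - 1) * Real.exp (-(Real.pi * A ^ 2 * t)) =
      Real.Gamma (s / 2) * Real.pi ^ (-(s / 2)) * A ^ (-s) := by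
  rw [Real.integral_rpow_mul_exp_neg_mul_Ioi (by positivity) (by positivity), one_div,
    Real.inv_rpow (by positivity), ← Real.rpow_neg (by positivity),
    Real.mul_rpow Real.pi_pos.le (by positivity), ← Real.rpow_natCast A 2, ← Real.rpow_mul hA.le]
  ring_nf

/-- The substitution t ↦ 1/t turns the space-side integral with parameter s into the Gamma integral
with parameter n - s. -/
theorem rpow_inv_kernel_eq {n : ℕ} {s A t : ℝ} (ht : 0 < t) :
    (|(-1 : ℝ)| * t ^ ((-1 : ℝ) - 1)) • ((t ^ (-1 : ℝ)) ^ ((n - s) / 2 - 1) *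
      Real.exp (-(Real.pi * A ^ 2 * t ^ (-1 : ℝ)))) =
    t ^ (s / 2 - 1) * (t⁻¹ ^ ((n : ℝ) / 2) * Real.exp (-(Real.pi * A ^ 2 / t))) := by
  rw [Real.rpow_neg_one, Real.inv_rpow ht.le, Real.inv_rpow ht.le, ← Real.rpow_neg ht.le,
    ← Real.rpow_neg ht.le, smul_eq_mul, abs_neg, abs_one, one_mul, ← mul_assoc, ← mul_assoc,
    ← Real.rpow_add ht, ← Real.rpow_add ht, ← div_eq_mul_inv]
  ring_nf

theorem integrableOn_rpow_mul_exp_inv {n : ℕ} {s A : ℝ} (hs : s < n) (hA : 0 < A) :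
    IntegrableOn (fun t : ℝ => t ^ (s / 2 - 1) * (t⁻¹ ^ ((n : ℝ) / 2) *
      Real.exp (-(Real.pi * A ^ 2 / t)))) (Set.Ioi 0) := by
  have := (integrableOn_Ioi_comp_rpow_iff _ (p := -1) (by norm_num)).2
    (integrableOn_rpow_mul_exp (s := n - s) (by linarith) hA)
  exact this.congr_fun (fun t ht => rpow_inv_kernel_eq ht) measurableSet_Ioi

theorem integral_rpow_mul_exp_inv {n : ℕ} {s A : ℝ} (hs : s < n) (hA : 0 < A) :
    ∫ t in Set.Ioi (0 : ℝ), t ^ (s / 2 - 1) * (t⁻¹ ^ ((n : ℝ) / 2) *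
      Real.exp (-(Real.pi * A ^ 2 / t))) =
      Real.Gamma ((n - s) / 2) * Real.pi ^ (-((n - s) / 2)) * A ^ (-(n - s)) := by
  rw [← integral_rpow_mul_exp (s := n - s) (by linarith) hA,
    ← integral_comp_rpow_Ioi (p := -1)
      (fun t => t ^ ((n - s) / 2 - 1) * Real.exp (-(Real.pi * A ^ 2 * t))) (by norm_num)]
  refine (setIntegral_congr_fun measurableSet_Ioi fun t ht => ?_).symm
  exact rpow_inv_kernel_eq ht

/-- Fubini for one subordination parameter per block; `hint` is absolute convergence after
integrating out the parameters. -/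
theorem integral_integral_prod {m n : ℕ} {W : Space m n → ℂ} (hW : AEStronglyMeasurable W)
    {h : Fin m → ℝ → EuclideanSpace ℝ (Fin n) → ℂ} (hm : ∀ k, Measurable (Function.uncurry (h k)))
    (hi : ∀ᵐ y : Space m n, ∀ k, IntegrableOn (fun t => h k t (y k)) (Set.Ioi 0))
    (hint : Integrable fun y : Space m n => ‖W y‖ * ∏ k, ∫ t in Set.Ioi 0, ‖h k t (y k)‖) :
    ∫ t, (∫ y : Space m n, W y * ∏ k, h k (t k) (y k))
      ∂(Measure.pi fun _ : Fin m => (volume : Measure ℝ).restrict (Set.Ioi 0)) =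
    ∫ y, W y * ∏ k, ∫ t in Set.Ioi 0, h k t (y k) := by
  have hmeas : Measurable fun p : (Fin m → ℝ) × Space m n => ∏ k, h k (p.1 k) (p.2 k) := by
    refine Finset.measurable_fun_prod _ fun k _ => (hm k).comp (Measurable.prodMk ?_ ?_)
    · exact (measurable_pi_apply k).comp measurable_fst
    · exact (measurable_block k).comp measurable_snd
  rw [integral_integral_swap]
  · refine integral_congr_ae (Eventually.of_forall fun y => ?_)
    simp only
    rw [integral_const_mul, integral_fintype_prod_eq_prod (fun k t => h k t (y k))]
  · have : Function.uncurry (fun (t : Fin m → ℝ) (y : Space m n) => W y * ∏ k, h k (t k) (y k)) =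
        fun p => W p.2 * ∏ k, h k (p.1 k) (p.2 k) := rfl
    have hm' : AEStronglyMeasurable (fun p : (Fin m → ℝ) × Space m n =>
        W p.2 * ∏ k, h k (p.1 k) (p.2 k))
        ((Measure.pi fun _ : Fin m => (volume : Measure ℝ).restrict (Set.Ioi 0)).prod volume) :=
      hW.comp_snd.mul hmeas.aestronglyMeasurable
    rw [this, integrable_prod_iff' hm']
    refine ⟨?_, hint.congr (Eventually.of_forall fun y => ?_)⟩
    · filter_upwards [hi] with y hy
      exact (Integrable.fintype_prod hy).const_mul _
    · simp only [norm_mul, norm_prod]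
      rw [integral_const_mul, integral_fintype_prod_eq_prod (fun k t => ‖h k t (y k)‖)]

end Subordination

theorem fourier_space_prod {m n : ℕ} (g : Fin m → EuclideanSpace ℝ (Fin n) → ℂ) (y : Space m n) :
    𝓕 (fun ξ : Space m n => ∏ k, g k (ξ k)) y = ∏ k, 𝓕 (g k) (y k) := by
  simp only [Real.fourier_eq]
  rw [← integral_space_prod]
  congr 1
  ext ξ
  simp only [Circle.smul_def, Real.fourierChar_apply, smul_eq_mul, Finset.prod_mul_distrib,
    ← Complex.exp_sum]
  rw [PiLp.inner_apply, ← Finset.sum_neg_distrib, Finset.mul_sum, Complex.ofReal_sum,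
    Finset.sum_mul]

/-- The frequency side of the Gaussian subordination formula for `|ξ|^{-s}`, modulated to `X`. -/
def gaussFreq {n : ℕ} (s : ℝ) (X : EuclideanSpace ℝ (Fin n)) (t : ℝ)
    (ξ : EuclideanSpace ℝ (Fin n)) : ℂ :=
  ((t ^ (s / 2 - 1) * Real.exp (-(Real.pi * ‖ξ‖ ^ 2 * t)) : ℝ) : ℂ) *
    Complex.exp (2 * Real.pi * Complex.I * (inner ℝ X ξ : ℝ))

/-- The space side of the Gaussian subordination formula for `|ξ|^{-s}`. -/
def gaussSpace {n : ℕ} (s : ℝ) (X : EuclideanSpace ℝ (Fin n)) (t : ℝ)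
    (y : EuclideanSpace ℝ (Fin n)) : ℂ :=
  ((t ^ (s / 2 - 1) * (t⁻¹ ^ ((n : ℝ) / 2) * Real.exp (-(Real.pi * ‖X - y‖ ^ 2 / t))) : ℝ) : ℂ)

theorem gaussFreq_eq {n : ℕ} (s : ℝ) (X : EuclideanSpace ℝ (Fin n)) (t : ℝ) :
    gaussFreq s X t = fun ξ => ((t ^ (s / 2 - 1) : ℝ) : ℂ) *
      Complex.exp (-(Real.pi * t : ℝ) * (‖ξ‖ : ℂ) ^ 2 +
        2 * Real.pi * Complex.I * (inner ℝ X ξ : ℝ)) := by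
  ext ξ
  rw [gaussFreq, Complex.exp_add]
  push_cast
  ring_nf

theorem integrable_gaussFreq {n : ℕ} (s : ℝ) (X : EuclideanSpace ℝ (Fin n)) {t : ℝ} (ht : 0 < t) :
    Integrable (gaussFreq s X t) := by
  rw [gaussFreq_eq]
  exact (GaussianFourier.integrable_cexp_neg_mul_sq_norm_add
    (b := ((Real.pi * t : ℝ) : ℂ)) (by rw [Complex.ofReal_re]; positivity) _ X).const_mul _

theorem fourier_gaussFreq {n : ℕ} (s : ℝ) (X : EuclideanSpace ℝ (Fin n)) {t : ℝ} (ht : 0 < t) :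
    𝓕 (gaussFreq s X t) = gaussSpace s X t := by
  ext y
  have h := fourier_gaussian_innerProductSpace' (b := ((Real.pi * t : ℝ) : ℂ))
    (by rw [Complex.ofReal_re]; positivity) X y
  have e : gaussFreq s X t = ((t ^ (s / 2 - 1) : ℝ) : ℂ) • fun ξ =>
      Complex.exp (-(Real.pi * t : ℝ) * (‖ξ‖ : ℂ) ^ 2 +
        2 * Real.pi * Complex.I * (inner ℝ X ξ : ℝ)) := gaussFreq_eq s X t
  rw [e, Real.fourier_eq]
  simp only [Pi.smul_apply, smul_comm (_ : Circle) (_ : ℂ), integral_smul]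
  rw [← Real.fourier_eq, h, gaussSpace, smul_eq_mul, finrank_euclideanSpace_fin,
    Complex.ofReal_mul (t ^ _), Complex.ofReal_mul (t⁻¹ ^ _)]
  congr 2
  · rw [← Complex.ofReal_div, div_mul_cancel_left₀ Real.pi_ne_zero,
      Complex.ofReal_cpow (by positivity)]
    simp
  · have : (Real.pi : ℂ) ≠ 0 := by exact_mod_cast Real.pi_ne_zero
    have ht' : (t : ℂ) ≠ 0 := by exact_mod_cast ht.ne'
    push_cast
    congr 1
    field_simp

theorem norm_gaussFreq {n : ℕ} (s : ℝ) (X : EuclideanSpace ℝ (Fin n)) {t : ℝ} (ht : 0 < t) (ξ) :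
    ‖gaussFreq s X t ξ‖ = t ^ (s / 2 - 1) * Real.exp (-(Real.pi * ‖ξ‖ ^ 2 * t)) := by
  have e : 2 * (Real.pi : ℂ) * Complex.I * (inner ℝ X ξ : ℝ) =
    ((2 * Real.pi * inner ℝ X ξ : ℝ) : ℂ) * Complex.I := by push_cast; ring
  rw [gaussFreq, norm_mul, Complex.norm_real, e, Complex.norm_exp_ofReal_mul_I, mul_one,
    Real.norm_of_nonneg (by positivity)]

theorem norm_gaussSpace {n : ℕ} (s : ℝ) (X : EuclideanSpace ℝ (Fin n)) {t : ℝ} (ht : 0 < t) (y) :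
    ‖gaussSpace s X t y‖ =
      t ^ (s / 2 - 1) * (t⁻¹ ^ ((n : ℝ) / 2) * Real.exp (-(Real.pi * ‖X - y‖ ^ 2 / t))) := by
  rw [gaussSpace, Complex.norm_real, Real.norm_of_nonneg (by positivity)]

theorem measurable_gaussFreq {n : ℕ} (s : ℝ) (X : EuclideanSpace ℝ (Fin n)) :
    Measurable (Function.uncurry (gaussFreq s X)) := by
  unfold gaussFreq Function.uncurry
  fun_prop

theorem measurable_gaussSpace {n : ℕ} (s : ℝ) (X : EuclideanSpace ℝ (Fin n)) :
    Measurable (Function.uncurry (gaussSpace s X)) := by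
  unfold gaussSpace Function.uncurry
  fun_prop

section Subordination

variable {n : ℕ} {s : ℝ} (X : EuclideanSpace ℝ (Fin n))

theorem integrableOn_gaussFreq (hs : 0 < s) {ξ : EuclideanSpace ℝ (Fin n)} (hξ : ξ ≠ 0) :
    IntegrableOn (fun t => gaussFreq s X t ξ) (Set.Ioi 0) := by
  have h := (integrableOn_rpow_mul_exp hs (norm_pos_iff.2 hξ)).ofReal (𝕜 := ℂ)
  exact h.mul_const _

theorem integral_gaussFreq (hs : 0 < s) {ξ : EuclideanSpace ℝ (Fin n)} (hξ : ξ ≠ 0) :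
    ∫ t in Set.Ioi 0, gaussFreq s X t ξ =
      ((Real.Gamma (s / 2) * Real.pi ^ (-(s / 2)) * ‖ξ‖ ^ (-s) : ℝ) : ℂ) *
        Complex.exp (2 * Real.pi * Complex.I * (inner ℝ X ξ : ℝ)) := by
  simp only [gaussFreq]
  rw [integral_mul_const, integral_complex_ofReal, integral_rpow_mul_exp hs (norm_pos_iff.2 hξ)]

theorem integral_norm_gaussFreq (hs : 0 < s) {ξ : EuclideanSpace ℝ (Fin n)} (hξ : ξ ≠ 0) :
    ∫ t in Set.Ioi 0, ‖gaussFreq s X t ξ‖ =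
      Real.Gamma (s / 2) * Real.pi ^ (-(s / 2)) * ‖ξ‖ ^ (-s) := by
  rw [← integral_rpow_mul_exp hs (norm_pos_iff.2 hξ)]
  exact setIntegral_congr_fun measurableSet_Ioi fun t ht => norm_gaussFreq s X ht ξ

variable {X}

theorem integrableOn_gaussSpace (hs : s < n) {y : EuclideanSpace ℝ (Fin n)} (hy : y ≠ X) :
    IntegrableOn (fun t => gaussSpace s X t y) (Set.Ioi 0) :=
  (integrableOn_rpow_mul_exp_inv hs (norm_pos_iff.2 (sub_ne_zero.2 hy.symm))).ofReal (𝕜 := ℂ)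

theorem integral_gaussSpace (hs : s < n) {y : EuclideanSpace ℝ (Fin n)} (hy : y ≠ X) :
    ∫ t in Set.Ioi 0, gaussSpace s X t y =
      ((Real.Gamma ((n - s) / 2) * Real.pi ^ (-((n - s) / 2)) * ‖X - y‖ ^ (-(n - s)) : ℝ) : ℂ) := by
  simp only [gaussSpace]
  rw [integral_complex_ofReal, integral_rpow_mul_exp_inv hs (norm_pos_iff.2 (sub_ne_zero.2 hy.symm))]

theorem integral_norm_gaussSpace (hs : s < n) {y : EuclideanSpace ℝ (Fin n)} (hy : y ≠ X) :
    ∫ t in Set.Ioi 0, ‖gaussSpace s X t y‖ =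
      Real.Gamma ((n - s) / 2) * Real.pi ^ (-((n - s) / 2)) * ‖X - y‖ ^ (-(n - s)) := by
  rw [← integral_rpow_mul_exp_inv hs (norm_pos_iff.2 (sub_ne_zero.2 hy.symm))]
  exact setIntegral_congr_fun measurableSet_Ioi fun t ht => norm_gaussSpace s X ht y

/-- Within |X|/2 of X the second factor is bounded, elsewhere the first is; the two singularities
never meet because X ≠ 0. -/
theorem integrable_riesz_mul_powTail {l κ a : ℝ} (hX : X ≠ 0) (hl : 0 ≤ l) (hln : l < n)
    (hκ : 0 ≤ κ) (hκn : κ < n) (ha : n < a) :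
    Integrable fun y : EuclideanSpace ℝ (Fin n) => ‖X - y‖ ^ (-l) * powTail κ a ‖y‖ := by
  set R := ‖X‖ / 2 with hR
  have hR0 : 0 < R := by have := norm_pos_iff.2 hX; positivity
  have h1 : Integrable fun y : EuclideanSpace ℝ (Fin n) =>
      R ^ (-κ) * (1 + R) ^ ((n : ℝ) + 1 - l) * powTail l (n + 1) ‖X - y‖ :=
    ((integrable_powTail (n := n) hln (lt_add_one _)).comp_sub_left X).const_mul _
  have h2 : Integrable fun y : EuclideanSpace ℝ (Fin n) => R ^ (-l) * powTail κ a ‖y‖ :=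
    (integrable_powTail hκn ha).const_mul _
  refine (h1.add h2).mono' ?_ (Eventually.of_forall fun y => ?_)
  · have := measurable_powTail κ a
    have h3 : Measurable fun y : EuclideanSpace ℝ (Fin n) => powTail κ a ‖y‖ := by fun_prop
    have h4 : Measurable fun y : EuclideanSpace ℝ (Fin n) => ‖X - y‖ ^ (-l) := by fun_prop
    exact (h4.mul h3).aestronglyMeasurable
  have hn1 : 0 ≤ powTail κ a ‖y‖ := powTail_nonneg _ _ (norm_nonneg _)
  have hn2 : 0 ≤ powTail l (n + 1) ‖X - y‖ := powTail_nonneg _ _ (norm_nonneg _)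
  rw [Real.norm_of_nonneg (by positivity), Pi.add_apply]
  by_cases h : ‖X - y‖ < R
  · have hy : R ≤ ‖y‖ := by
      have := norm_sub_norm_le X y
      simp only [hR] at h ⊢; linarith
    have hb : powTail κ a ‖y‖ ≤ R ^ (-κ) := by
      rw [powTail]
      refine (mul_le_of_le_one_right (by positivity) ?_).trans
        (Real.rpow_le_rpow_of_nonpos hR0 hy (by linarith))
      exact Real.rpow_le_one_of_one_le_of_nonpos (by linarith [norm_nonneg y]) (by linarith)
    have hc : ‖X - y‖ ^ (-l) ≤ (1 + R) ^ ((n : ℝ) + 1 - l) * powTail l (n + 1) ‖X - y‖ := by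
      rw [powTail, mul_left_comm]
      refine le_mul_of_one_le_right (by positivity) ?_
      rw [Real.rpow_neg (by positivity), ← div_eq_mul_inv, one_le_div (by positivity)]
      exact Real.rpow_le_rpow (by positivity) (by linarith) (by linarith)
    have : ‖X - y‖ ^ (-l) * powTail κ a ‖y‖ ≤
        ((1 + R) ^ ((n : ℝ) + 1 - l) * powTail l (n + 1) ‖X - y‖) * R ^ (-κ) := by gcongr
    have h0 : 0 ≤ R ^ (-l) * powTail κ a ‖y‖ := by positivity
    linarith
  · have : ‖X - y‖ ^ (-l) * powTail κ a ‖y‖ ≤ R ^ (-l) * powTail κ a ‖y‖ := by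
      gcongr ?_ * _
      exact Real.rpow_le_rpow_of_nonpos hR0 (not_lt.1 h) (by linarith)
    have h0 : 0 ≤ R ^ (-κ) * (1 + R) ^ ((n : ℝ) + 1 - l) * powTail l (n + 1) ‖X - y‖ := by
      positivity
    linarith

end Subordination

/-! ### Representation by Riesz potentials. -/

theorem continuous_weighted {m n : ℕ} {s : Fin m → ℝ} (hs : ∀ k, 0 ≤ s k) (f : 𝓢(Space m n, ℂ)) :
    Continuous (weighted s f) := by
  have hw : Continuous (weight s : Space m n → ℝ) := by
    unfold weight
    refine continuous_finsetProd _ fun k _ => ?_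
    have h : Continuous fun x : Space m n => x k :=
      PiLp.continuous_apply 2 (fun _ : Fin m => EuclideanSpace ℝ (Fin n)) k
    exact h.norm.rpow_const fun x => Or.inr (by have := hs k; positivity)
  exact (Complex.continuous_ofReal.comp hw).mul f.continuous

/-- The rate n + s/4 lies strictly between n and n + s/2, which needs s > 0. Fourier inversion then
holds at every point, so values on the diagonal, a null set when m > 1, are meaningful. -/
theorem integrable_fourier_weighted {m n : ℕ} (hn : 0 < n) {s : Fin m → ℝ} (hs : ∀ k, 0 < s k)
    (f : 𝓢(Space m n, ℂ)) : Integrable (𝓕 (weighted s f)) := by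
  obtain ⟨N, C, hC, h⟩ := fourier_weighted_le (m := m) hn (fun k => (hs k).le)
    (a := fun k => n + s k / 4)
    (fun k => by have := hs k; positivity) (fun k => by have := hs k; linarith)
  exact ((integrable_prod_one_add fun k => by have := hs k; linarith).const_mul
    (C * sNorm N f)).mono'
    (continuous_fourier (integrable_weighted (fun k => (hs k).le) f)).aestronglyMeasurable
    (Eventually.of_forall fun ξ => h f ξ)

theorem weighted_eq_integral_fourier {m n : ℕ} (hn : 0 < n) {s : Fin m → ℝ} (hs : ∀ k, 0 < s k)
    (f : 𝓢(Space m n, ℂ)) (X : Space m n) :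
    weighted s f X = ∫ ξ, 𝓕 (weighted s f) ξ *
      ∏ k, Complex.exp (2 * Real.pi * Complex.I * (inner ℝ (X k) (ξ k) : ℝ)) := by
  have h := congrFun ((continuous_weighted (fun k => (hs k).le) f).fourierInv_fourier_eq
    (integrable_weighted (fun k => (hs k).le) f) (integrable_fourier_weighted hn hs f)) X
  rw [← h, Real.fourierInv_eq]
  congr 1
  ext ξ
  rw [Circle.smul_def, Real.fourierChar_apply, smul_eq_mul, mul_comm, ← Complex.exp_sum,
    real_inner_comm, PiLp.inner_apply, ← Finset.mul_sum]
  push_cast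
  ring_nf

theorem fourier_fracLap_ae {m n : ℕ} (hn : 0 < n) {α β : Fin m → ℝ}
    (hα : ∀ k, 0 < α k ∧ α k < n) (hβ : ∀ k, 0 ≤ β k) (f : 𝓢(Space m n, ℂ)) :
    𝓕 (fracLap α (weighted β f) : Space m n → ℂ) =ᵐ[volume] fracLapFourier α (weighted β f) := by
  have hα' : ∀ k, 0 ≤ α k ∧ α k < n := fun k => ⟨(hα k).1.le, (hα k).2⟩
  have h := coeFn_fourier_toLp (integrable_fracLap hn hα hβ f) (Lp.memLp _)
  rw [Lp.toLp_coeFn] at h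
  refine h.symm.trans ?_
  rw [fracLap_eq (memLp_fracLapFourier hn hα' hβ f), FourierTransform.fourier_fourierInv_eq]
  exact MemLp.coeFn_toLp _

theorem integrable_fracLap_mul_riesz {m n : ℕ} (hn : 0 < n) {α β : Fin m → ℝ}
    (hα : ∀ k, 0 < α k ∧ α k < n) (hβ : ∀ k, 0 ≤ β k) (f : 𝓢(Space m n, ℂ)) {X : Space m n}
    (hX : ∀ k, X k ≠ 0) :
    Integrable fun y : Space m n => ‖fracLap α (weighted β f) y‖ *
      ∏ k, ‖X k - y k‖ ^ (-(n - α k / 2)) := by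
  obtain ⟨N, C, hC, h⟩ := fracLap_weighted_le hn (κ := fun k => (α k + n) / 4)
    (a := fun k => n + α k / 4) (fun k => ⟨(hα k).1.le, (hα k).2⟩) hβ
    (fun k => by have := hα k; linarith) (fun k => by have := hα k; linarith)
    (fun k => by have := hα k; linarith) (fun k => by have := hα k; have := hβ k; linarith)
  have h1 := integrable_space_prod (fun k y => ‖X k - y‖ ^ (-(n - α k / 2)) *
    powTail ((α k + n) / 4) (n + α k / 4) ‖y‖) fun k => integrable_riesz_mul_powTail (hX k)
      (by have := hα k; linarith) (by have := hα k; linarith) (by have := hα k; linarith)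
      (by have := hα k; linarith) (by have := hα k; linarith)
  refine (h1.const_mul (C * sNorm N f)).mono' ?_ ?_
  · refine (Lp.aestronglyMeasurable _).norm.mul (Measurable.aestronglyMeasurable ?_)
    refine Finset.measurable_fun_prod _ fun k _ => ?_
    have := measurable_block (n := n) k
    fun_prop
  · filter_upwards [(h f).2] with y hy
    have h0 : 0 ≤ ∏ k, ‖X k - y k‖ ^ (-(n - α k / 2)) :=
      Finset.prod_nonneg fun k _ => by positivity
    rw [Real.norm_of_nonneg (by positivity), Finset.prod_mul_distrib]
    refine (mul_le_mul_of_nonneg_right hy h0).trans_eq ?_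
    ring

theorem ae_block_ne {m n : ℕ} (hn : 0 < n) (X : Space m n) :
    ∀ᵐ y : Space m n, ∀ k, y k ≠ X k := by
  have h := (measurePreserving_sub_right volume X).quasiMeasurePreserving.ae
    (ae_block_ne_zero m hn)
  filter_upwards [h] with y hy k hk
  exact hy k (by simp [hk])

/-- The inverse of the fractional Laplacian is a product of Riesz potentials. -/
theorem riesz_representation {m n : ℕ} (hn : 0 < n) {α β : Fin m → ℝ}
    (hα : ∀ k, 0 < α k ∧ α k < n) (hβ : ∀ k, 0 < β k) (f : 𝓢(Space m n, ℂ)) {X : Space m n}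
    (hX : ∀ k, X k ≠ 0) :
    ((∏ k, Real.Gamma (α k / 4) * Real.pi ^ (-(α k / 4)) : ℝ) : ℂ) * weighted β f X =
      ((∏ k, Real.Gamma ((2 * n - α k) / 4) * Real.pi ^ (-((2 * n - α k) / 4)) : ℝ) : ℂ) *
        ∫ y, fracLap α (weighted β f) y * ((∏ k, ‖X k - y k‖ ^ (-(n - α k / 2)) : ℝ) : ℂ) := by
  have hβ' : ∀ k, 0 ≤ β k := fun k => (hβ k).le
  have hs : ∀ k, 0 < α k / 2 := fun k => half_pos (hα k).1
  have hs' : ∀ k, α k / 2 < n := fun k => by have := hα k; linarith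
  have hcancel : ∀ ξ : Space m n, (∀ k, ξ k ≠ 0) →
      -- The Riesz multiplier |ξ|^(-α/2) cancels the fractional Laplacian wherever no block of ξ
      -- vanishes.
      weight α ξ * ∏ k, ‖ξ k‖ ^ (-(α k / 2)) = 1 := by
    intro ξ hξ
    rw [weight, ← Finset.prod_mul_distrib]
    refine Finset.prod_eq_one fun k _ => ?_
    rw [← Real.rpow_add (norm_pos_iff.2 (hξ k)), add_neg_cancel, Real.rpow_zero]
  set u := weighted β (f : Space m n → ℂ) with hu
  have hfreq : ((∏ k, Real.Gamma (α k / 4) * Real.pi ^ (-(α k / 4)) : ℝ) : ℂ) * u X =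
      ∫ ξ : Space m n, fracLapFourier α u ξ *
        ∏ k, ∫ t in Set.Ioi 0, gaussFreq (α k / 2) (X k) t (ξ k) := by
    rw [hu, weighted_eq_integral_fourier hn hβ f X, ← integral_const_mul]
    refine integral_congr_ae ?_
    filter_upwards [ae_block_ne_zero m hn] with ξ hξ
    have h1 : ∏ k, ∫ t in Set.Ioi 0, gaussFreq (α k / 2) (X k) t (ξ k) =
        ((∏ k, Real.Gamma (α k / 4) * Real.pi ^ (-(α k / 4)) : ℝ) : ℂ) *
          ((∏ k, ‖ξ k‖ ^ (-(α k / 2)) : ℝ) : ℂ) *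
          ∏ k, Complex.exp (2 * Real.pi * Complex.I * (inner ℝ (X k) (ξ k) : ℝ)) := by
      rw [← Complex.ofReal_mul, ← Finset.prod_mul_distrib, Complex.ofReal_prod,
        ← Finset.prod_mul_distrib]
      refine Finset.prod_congr rfl fun k _ => ?_
      rw [integral_gaussFreq _ (hs k) (hξ k)]
      ring_nf
    have h2 : (weight α ξ : ℂ) * ((∏ k, ‖ξ k‖ ^ (-(α k / 2)) : ℝ) : ℂ) = 1 := by
      exact_mod_cast hcancel ξ hξ
    rw [h1, fracLapFourier]
    linear_combination (-((∏ k, Real.Gamma (α k / 4) * Real.pi ^ (-(α k / 4)) : ℝ) : ℂ) *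
      𝓕 (weighted β (f : Space m n → ℂ)) ξ *
      ∏ k, Complex.exp (2 * Real.pi * Complex.I * (inner ℝ (X k) (ξ k) : ℝ))) * h2
  have hspace : ((∏ k, Real.Gamma ((2 * n - α k) / 4) * Real.pi ^ (-((2 * n - α k) / 4)) : ℝ) : ℂ) *
        ∫ y, fracLap α u y * ((∏ k, ‖X k - y k‖ ^ (-(n - α k / 2)) : ℝ) : ℂ) =
      ∫ y, fracLap α u y * ∏ k, ∫ t in Set.Ioi 0, gaussSpace (α k / 2) (X k) t (y k) := by
    rw [← integral_const_mul]
    refine integral_congr_ae ?_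
    filter_upwards [ae_block_ne hn X] with y hy
    rw [mul_left_comm, ← Complex.ofReal_mul, ← Finset.prod_mul_distrib, Complex.ofReal_prod]
    congr 1
    refine Finset.prod_congr rfl fun k _ => ?_
    rw [integral_gaussSpace (hs' k) (hy k)]
    ring_nf
  have hv := integrable_fracLap hn hα hβ' f
  have hV := integrable_fourier_weighted hn hβ f
  -- With the order of integration exchanged, both sides are integrals over the Gaussian parameters;
  -- for fixed parameters the integrands agree by the multiplication formula, Gaussians being
  -- transformed into Gaussians.
  rw [hfreq, hspace, ← integral_integral_prod, ← integral_integral_prod]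
  · have hpos : ∀ᵐ t : Fin m → ℝ ∂(Measure.pi fun _ => (volume : Measure ℝ).restrict (Set.Ioi 0)),
        ∀ k, 0 < t k := by
      rw [ae_all_iff]
      intro k
      have h2 : ∀ᵐ r : ℝ ∂(volume : Measure ℝ).restrict (Set.Ioi 0), 0 < r :=
        ae_restrict_mem measurableSet_Ioi
      exact (Measure.tendsto_eval_ae_ae (μ := fun _ : Fin m =>
        (volume : Measure ℝ).restrict (Set.Ioi 0)) (i := k)).eventually h2
    refine integral_congr_ae ?_
    filter_upwards [hpos] with t ht
    have hG : Integrable fun ξ : Space m n => ∏ k, gaussFreq (α k / 2) (X k) (t k) (ξ k) :=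
      ((volume_preserving_ofLp m n).integrable_comp_emb (measurableEmbedding_ofLp m n)).2
        (Integrable.fintype_prod fun k => integrable_gaussFreq _ _ (ht k))
    have h3 := integral_fourier_mul_eq hv hG
    have h4 : ∫ ξ, fracLapFourier α u ξ * ∏ k, gaussFreq (α k / 2) (X k) (t k) (ξ k) =
        ∫ ξ, 𝓕 (fracLap α u : Space m n → ℂ) ξ * ∏ k, gaussFreq (α k / 2) (X k) (t k) (ξ k) := by
      refine integral_congr_ae ?_
      filter_upwards [fourier_fracLap_ae hn hα hβ' f] with ξ hξ
      rw [hu, hξ]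
    refine h4.trans (h3.trans ?_)
    simp only [fourier_space_prod]
    congr 1
    ext y
    congr 1
    exact Finset.prod_congr rfl fun k _ => by rw [fourier_gaussFreq _ _ (ht k)]
  · exact hv.aestronglyMeasurable
  · exact fun k => measurable_gaussSpace _ _
  · filter_upwards [ae_block_ne hn X] with y hy k
    exact integrableOn_gaussSpace (hs' k) (hy k)
  · refine ((integrable_fracLap_mul_riesz hn hα hβ' f hX).const_mul
      (∏ k, Real.Gamma ((n - α k / 2) / 2) * Real.pi ^ (-((n - α k / 2) / 2)))).congr ?_
    filter_upwards [ae_block_ne hn X] with y hy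
    rw [mul_left_comm, ← Finset.prod_mul_distrib]
    congr 1
    exact Finset.prod_congr rfl fun k _ => (integral_norm_gaussSpace (hs' k) (hy k)).symm
  · exact aestronglyMeasurable_fracLapFourier α (integrable_weighted hβ' f)
  · exact fun k => measurable_gaussFreq _ _
  · filter_upwards [ae_block_ne_zero m hn] with ξ hξ k
    exact integrableOn_gaussFreq _ (hs k) (hξ k)
  · refine (hV.norm.const_mul
      (∏ k, Real.Gamma (α k / 2 / 2) * Real.pi ^ (-(α k / 2 / 2)))).congr ?_
    filter_upwards [ae_block_ne_zero m hn] with ξ hξ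
    have h1 : ∏ k, ∫ t in Set.Ioi 0, ‖gaussFreq (α k / 2) (X k) t (ξ k)‖ =
        (∏ k, Real.Gamma (α k / 2 / 2) * Real.pi ^ (-(α k / 2 / 2))) *
          ∏ k, ‖ξ k‖ ^ (-(α k / 2)) := by
      rw [← Finset.prod_mul_distrib]
      exact Finset.prod_congr rfl fun k _ => integral_norm_gaussFreq _ (hs k) (hξ k)
    rw [h1, norm_fracLapFourier]
    linear_combination (-(∏ k, Real.Gamma (α k / 2 / 2) * Real.pi ^ (-(α k / 2 / 2))) *
      ‖𝓕 u ξ‖) * hcancel ξ hξ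

/-! ### The kernel representing diagonal values. -/

/-- The kernel of the positive operator representing `f(x,…,x)` in terms of `iterated α β ρ f`. -/
def kern {m n : ℕ} (α β ρ : Fin m → ℝ) (x : EuclideanSpace ℝ (Fin n)) (y : Space m n) : ℝ≥0∞ :=
  ‖x‖ₑ ^ (-((∑ k, β k) / 2)) *
    ∏ k, (‖x - y k‖ₑ ^ (-((n : ℝ) - α k / 2)) * ‖y k‖ₑ ^ (-(ρ k / 2)))

/-- The product of the constants of the Riesz potentials. -/
def rieszConst {m : ℕ} (n : ℕ) (α : Fin m → ℝ) : ℝ :=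
  ∏ k, (Real.pi ^ (α k / 2 - n / 2) * (Real.Gamma ((2 * n - α k) / 4) / Real.Gamma (α k / 4)))

theorem rieszConst_pos {m n : ℕ} {α : Fin m → ℝ} (hα : ∀ k, 0 < α k ∧ α k < n) :
    0 < rieszConst n α := by
  refine Finset.prod_pos fun k _ => ?_
  have h1 := Real.Gamma_pos_of_pos (s := (2 * n - α k) / 4) (by have := hα k; linarith)
  have h2 := Real.Gamma_pos_of_pos (s := α k / 4) (by have := hα k; linarith)
  positivity

theorem enorm_rpow_eq {n : ℕ} {x : EuclideanSpace ℝ (Fin n)} (hx : x ≠ 0) (s : ℝ) :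
    ‖x‖ₑ ^ s = ENNReal.ofReal (‖x‖ ^ s) := by
  rw [← ofReal_norm, ENNReal.ofReal_rpow_of_pos (norm_pos_iff.2 hx)]

theorem enorm_rpow_ne_zero {n : ℕ} (x : EuclideanSpace ℝ (Fin n)) {s : ℝ} (hs : s ≤ 0) :
    ‖x‖ₑ ^ s ≠ 0 := by
  rw [Ne, ENNReal.rpow_eq_zero_iff]
  rintro (⟨-, h⟩ | ⟨h, -⟩)
  · linarith
  · exact enorm_ne_top h

theorem measurable_kern_comp {m n : ℕ} (α β ρ : Fin m → ℝ) {Z : Type*} [MeasurableSpace Z]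
    {f : Z → EuclideanSpace ℝ (Fin n)} {g : Z → Space m n} (hf : Measurable f)
    (hg : Measurable g) : Measurable fun z => kern α β ρ (f z) (g z) := by
  have h : ∀ k, Measurable fun z => g z k := fun k => (measurable_block k).comp hg
  unfold kern
  refine (hf.enorm.pow_const _).mul (Finset.measurable_fun_prod _ fun k _ => ?_)
  exact ((hf.sub (h k)).enorm.pow_const _).mul ((h k).enorm.pow_const _)

theorem measurable_kern {m n : ℕ} (α β ρ : Fin m → ℝ) :
    Measurable (Function.uncurry (kern (n := n) α β ρ)) :=
  measurable_kern_comp α β ρ measurable_fst measurable_snd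

/-- All exponents are nonpositive, so no factor vanishes; infinite values occur only on the singular
set. Strict positivity drives the equality case of Schur's test. -/
theorem kern_ne_zero {m n : ℕ} {α β ρ : Fin m → ℝ} (hα : ∀ k, α k ≤ 2 * n) (hβ : ∀ k, 0 ≤ β k)
    (hρ : ∀ k, 0 ≤ ρ k) (x : EuclideanSpace ℝ (Fin n)) (y : Space m n) : kern α β ρ x y ≠ 0 := by
  refine mul_ne_zero (enorm_rpow_ne_zero _ ?_) (Finset.prod_ne_zero_iff.2 fun k _ =>
    mul_ne_zero (enorm_rpow_ne_zero _ ?_) (enorm_rpow_ne_zero _ ?_))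
  · have := Finset.sum_nonneg fun k (_ : k ∈ Finset.univ) => hβ k
    linarith
  · have := hα k; linarith
  · have := hρ k; linarith

theorem kern_eq_ofReal {m n : ℕ} (α β ρ : Fin m → ℝ) {x : EuclideanSpace ℝ (Fin n)} (hx : x ≠ 0)
    {y : Space m n} (hy : ∀ k, y k ≠ 0) (hxy : ∀ k, y k ≠ x) :
    kern α β ρ x y = ENNReal.ofReal (‖x‖ ^ (-((∑ k, β k) / 2)) *
      ((∏ k, ‖x - y k‖ ^ (-((n : ℝ) - α k / 2))) * ∏ k, ‖y k‖ ^ (-(ρ k / 2)))) := by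
  rw [← Finset.prod_mul_distrib, ENNReal.ofReal_mul (by positivity),
    ENNReal.ofReal_prod_of_nonneg fun k _ => by positivity, kern, enorm_rpow_eq hx]
  congr 1
  refine Finset.prod_congr rfl fun k _ => ?_
  rw [enorm_rpow_eq (sub_ne_zero.2 (hxy k).symm), enorm_rpow_eq (hy k),
    ENNReal.ofReal_mul (by positivity)]

theorem ae_kern_eq {m n : ℕ} (hn : 0 < n) (α β ρ : Fin m → ℝ) {x : EuclideanSpace ℝ (Fin n)}
    (hx : x ≠ 0) : ∀ᵐ y : Space m n, kern α β ρ x y =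
      ENNReal.ofReal (‖x‖ ^ (-((∑ k, β k) / 2)) *
      ((∏ k, ‖x - y k‖ ^ (-((n : ℝ) - α k / 2))) * ∏ k, ‖y k‖ ^ (-(ρ k / 2)))) := by
  filter_upwards [ae_block_ne_zero m hn, ae_block_ne hn (diag m x)] with y hy hxy
  exact kern_eq_ofReal α β ρ hx hy hxy

theorem weight_diag {m n : ℕ} (s : Fin m → ℝ) {x : EuclideanSpace ℝ (Fin n)} (hx : x ≠ 0) :
    weight s (diag m x) = ‖x‖ ^ ((∑ k, s k) / 2) := by
  rw [Finset.sum_div, Real.rpow_sum_of_pos (norm_pos_iff.2 hx)]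
  rfl

/-- The values of `f` on the diagonal in terms of `iterated α β ρ f`. -/
theorem diag_representation {m n : ℕ} (hn : 0 < n) {α β : Fin m → ℝ} (ρ : Fin m → ℝ)
    (hα : ∀ k, 0 < α k ∧ α k < n) (hβ : ∀ k, 0 < β k) (f : 𝓢(Space m n, ℂ))
    {x : EuclideanSpace ℝ (Fin n)} (hx : x ≠ 0) :
    Integrable (fun y => ((kern α β ρ x y).toReal : ℂ) * iterated α β ρ f y) ∧
    f (diag m x) = rieszConst n α * ∫ y, ((kern α β ρ x y).toReal : ℂ) * iterated α β ρ f y := by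
  have hX : ∀ k, (diag m x) k ≠ 0 := fun k => hx
  have key : (fun y => ((kern α β ρ x y).toReal : ℂ) * iterated α β ρ f y) =ᵐ[volume]
      fun y => ((‖x‖ ^ (-((∑ k, β k) / 2)) : ℝ) : ℂ) * (fracLap α (weighted β f) y *
        ((∏ k, ‖(diag m x) k - y k‖ ^ (-(n - α k / 2)) : ℝ) : ℂ)) := by
    filter_upwards [ae_kern_eq hn α β ρ hx, ae_block_ne_zero m hn] with y hy hy0
    have h0 : 0 ≤ ‖x‖ ^ (-((∑ k, β k) / 2)) *
      ((∏ k, ‖x - y k‖ ^ (-((n : ℝ) - α k / 2))) * ∏ k, ‖y k‖ ^ (-(ρ k / 2))) :=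
      mul_nonneg (by positivity) (mul_nonneg (Finset.prod_nonneg fun k _ => by positivity)
        (Finset.prod_nonneg fun k _ => by positivity))
    have hc : ((∏ k, ‖y k‖ ^ (-(ρ k / 2)) : ℝ) : ℂ) * (weight ρ y : ℂ) = 1 := by
      rw [← Complex.ofReal_mul, weight, ← Finset.prod_mul_distrib, ← Complex.ofReal_one]
      congr 1
      refine Finset.prod_eq_one fun k _ => ?_
      rw [← Real.rpow_add (norm_pos_iff.2 (hy0 k)), neg_add_cancel, Real.rpow_zero]
    rw [hy, ENNReal.toReal_ofReal h0, iterated, weighted, Complex.ofReal_mul, Complex.ofReal_mul]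
    change _ = ((‖x‖ ^ (-((∑ k, β k) / 2)) : ℝ) : ℂ) * (fracLap α (weighted β f) y *
        ((∏ k, ‖x - y k‖ ^ (-(n - α k / 2)) : ℝ) : ℂ))
    linear_combination (((‖x‖ ^ (-((∑ k, β k) / 2)) : ℝ) : ℂ) * (fracLap α (weighted β f) y *
        ((∏ k, ‖x - y k‖ ^ (-(n - α k / 2)) : ℝ) : ℂ))) * hc
  have hint := integrable_fracLap_mul_riesz hn hα (fun k => (hβ k).le) f hX
  have hmeas : AEStronglyMeasurable (fun y : Space m n => fracLap α (weighted β f) y *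
        ((∏ k, ‖(diag m x) k - y k‖ ^ (-(n - α k / 2)) : ℝ) : ℂ)) := by
    refine (Lp.aestronglyMeasurable _).mul (Measurable.aestronglyMeasurable ?_)
    refine Complex.measurable_ofReal.comp (Finset.measurable_fun_prod _ fun k _ => ?_)
    have := measurable_block (n := n) k
    fun_prop
  constructor
  · refine Integrable.congr ?_ key.symm
    refine Integrable.const_mul ?_ _
    refine hint.mono hmeas (Eventually.of_forall fun y => ?_)
    have h0 : 0 ≤ ∏ k, ‖(diag m x) k - y k‖ ^ (-(n - α k / 2)) :=
      Finset.prod_nonneg fun k _ => by positivity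
    rw [norm_mul, norm_mul, norm_norm, Complex.norm_real]
  · rw [integral_congr_ae key, integral_const_mul]
    have h := riesz_representation hn hα hβ f hX
    rw [weighted, weight_diag β hx] at h
    have hc : ((‖x‖ ^ (-((∑ k, β k) / 2)) : ℝ) : ℂ) * ((‖x‖ ^ ((∑ k, β k) / 2) : ℝ) : ℂ) = 1 := by
      rw [← Complex.ofReal_mul, ← Real.rpow_add (norm_pos_iff.2 hx), neg_add_cancel,
        Real.rpow_zero, Complex.ofReal_one]
    have hG : (0 : ℝ) < ∏ k, Real.Gamma (α k / 4) * Real.pi ^ (-(α k / 4)) :=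
      Finset.prod_pos fun k _ => by
        have := Real.Gamma_pos_of_pos (s := α k / 4) (by have := hα k; linarith)
        positivity
    have hr : rieszConst n α * ∏ k, Real.Gamma (α k / 4) * Real.pi ^ (-(α k / 4)) =
        ∏ k, Real.Gamma ((2 * n - α k) / 4) * Real.pi ^ (-((2 * n - α k) / 4)) := by
      rw [rieszConst, ← Finset.prod_mul_distrib]
      refine Finset.prod_congr rfl fun k _ => ?_
      have h3 := (Real.Gamma_pos_of_pos (s := α k / 4) (by have := hα k; linarith)).ne'
      have h4 : Real.pi ^ (-((2 * n - α k) / 4)) =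
          Real.pi ^ (α k / 2 - n / 2) * Real.pi ^ (-(α k / 4)) := by
        rw [← Real.rpow_add Real.pi_pos]; ring_nf
      rw [h4]
      field_simp
    rw [← hr, Complex.ofReal_mul] at h
    have hG' : ((∏ k, Real.Gamma (α k / 4) * Real.pi ^ (-(α k / 4)) : ℝ) : ℂ) ≠ 0 := by
      exact_mod_cast hG.ne'
    refine mul_left_cancel₀ hG' ?_
    linear_combination ((‖x‖ ^ (-((∑ k, β k) / 2)) : ℝ) : ℂ) * h -
      ((∏ k, Real.Gamma (α k / 4) * Real.pi ^ (-(α k / 4)) : ℝ) : ℂ) * f (diag m x) * hc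

/-! ### Schur's test for positive kernels, with its equality case. -/

section Schur

theorem sq_lintegral_le {Y : Type*} [MeasurableSpace Y] (ν : Measure Y) {φ : Y → ℝ≥0∞}
    (hφ : AEMeasurable φ ν) : (∫⁻ y, φ y ∂ν) ^ 2 ≤ ν Set.univ * ∫⁻ y, φ y ^ 2 ∂ν := by
  have h := ENNReal.lintegral_mul_le_Lp_mul_Lq ν (p := 2) (q := 2)
    (Real.holderConjugate_iff.2 ⟨by norm_num, by norm_num⟩) (aemeasurable_const (b := (1 : ℝ≥0∞))) hφ
  simp only [Pi.mul_apply, one_mul, lintegral_const, ENNReal.rpow_ofNat, one_pow] at h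
  calc (∫⁻ y, φ y ∂ν) ^ 2 ≤ (ν Set.univ ^ (1 / 2 : ℝ) * (∫⁻ y, φ y ^ 2 ∂ν) ^ (1 / 2 : ℝ)) ^ 2 := by
        gcongr
    _ = _ := by
        rw [mul_pow, ← ENNReal.rpow_natCast, ← ENNReal.rpow_natCast, ← ENNReal.rpow_mul,
          ← ENNReal.rpow_mul]
        norm_num

/-- The case of equality in the Cauchy–Schwarz inequality against a constant. -/
theorem exists_ae_eq_const_of_sq_lintegral {Y : Type*} [MeasurableSpace Y] (ν : Measure Y)
    [IsFiniteMeasure ν] {φ : Y → ℝ≥0∞} (hφ : AEMeasurable φ ν) (hfin : ∫⁻ y, φ y ^ 2 ∂ν ≠ ∞)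
    (h : (∫⁻ y, φ y ∂ν) ^ 2 = ν Set.univ * ∫⁻ y, φ y ^ 2 ∂ν) : ∃ c : ℝ≥0∞, ∀ᵐ y ∂ν, φ y = c := by
  rcases eq_or_ne ν 0 with rfl | hν
  · exact ⟨0, by simp⟩
  have hM0 : ν.real Set.univ ≠ 0 := by
    rw [Ne, measureReal_eq_zero_iff, Measure.measure_univ_eq_zero]; exact hν
  have hfin1 : ∫⁻ y, φ y ∂ν ≠ ∞ := by
    intro h'
    rw [h'] at h
    exact ENNReal.mul_ne_top (measure_ne_top _ _) hfin (h.symm.trans (by simp))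
  have hae : ∀ᵐ y ∂ν, φ y < ∞ := ae_lt_top' hφ hfin1
  have hI1 : Integrable (fun y => (φ y).toReal) ν := integrable_toReal_of_lintegral_ne_top hφ hfin1
  have hI2 : Integrable (fun y => (φ y).toReal ^ 2) ν := by
    have := integrable_toReal_of_lintegral_ne_top (hφ.pow_const 2) hfin
    simpa [ENNReal.toReal_pow] using this
  have e1 : ∫ y, (φ y).toReal ∂ν = (∫⁻ y, φ y ∂ν).toReal := integral_toReal hφ hae
  have e2 : ∫ y, (φ y).toReal ^ 2 ∂ν = (∫⁻ y, φ y ^ 2 ∂ν).toReal := by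
    rw [← integral_toReal (hφ.pow_const 2) (by filter_upwards [hae] with y hy using by finiteness)]
    simp [ENNReal.toReal_pow]
  have h' : (∫ y, (φ y).toReal ∂ν) ^ 2 = ν.real Set.univ * ∫ y, (φ y).toReal ^ 2 ∂ν := by
    rw [e1, e2, ← ENNReal.toReal_pow, h, ENNReal.toReal_mul, measureReal_def]
  set c := (∫ y, (φ y).toReal ∂ν) / ν.real Set.univ with hc
  have hz : ∫ y, ((φ y).toReal - c) ^ 2 ∂ν = 0 := by
    have : ∀ y, ((φ y).toReal - c) ^ 2 = (φ y).toReal ^ 2 - 2 * c * (φ y).toReal + c ^ 2 :=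
      fun y => by ring
    simp_rw [this]
    have hI4 : Integrable (fun y => (φ y).toReal ^ 2 - 2 * c * (φ y).toReal) ν :=
      hI2.sub (hI1.const_mul _)
    rw [integral_add hI4 (integrable_const _), integral_sub hI2 (hI1.const_mul _), integral_const_mul, integral_const, smul_eq_mul, hc]
    field_simp
    linarith
  have hI3 : Integrable (fun y => ((φ y).toReal - c) ^ 2) ν := by
    have : (fun y => ((φ y).toReal - c) ^ 2) =
        fun y => (φ y).toReal ^ 2 - 2 * c * (φ y).toReal + c ^ 2 := by ext y; ring
    rw [this]
    exact (hI2.sub (hI1.const_mul _)).add (integrable_const _)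
  rw [integral_eq_zero_iff_of_nonneg (fun y => sq_nonneg _) hI3] at hz
  refine ⟨ENNReal.ofReal c, ?_⟩
  filter_upwards [hz, hae] with y hy hy'
  have : (φ y).toReal = c := by
    have := pow_eq_zero_iff (two_ne_zero) |>.1 hy
    linarith
  rw [← this, ENNReal.ofReal_toReal hy'.ne]

variable {X Y : Type*} [MeasurableSpace X] [MeasurableSpace Y] {μ : Measure X} {ν : Measure Y}
  {κ : X → Y → ℝ≥0∞} {p : X → ℝ≥0∞} {A : ℝ≥0∞} {g : Y → ℝ≥0∞}

/-- Cauchy–Schwarz for g/q against the constant 1, with respect to the measure k q dν. -/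
theorem sq_lintegral_mul_le {k q : Y → ℝ≥0∞} (hk : Measurable k) (hq : Measurable q)
    (hq0 : ∀ᵐ y ∂ν, q y ≠ 0 ∧ q y ≠ ∞) (hg : Measurable g) :
    (∫⁻ y, k y * g y ∂ν) ^ 2 ≤ (∫⁻ y, k y * q y ∂ν) * ∫⁻ y, k y * (g y ^ 2 / q y) ∂ν := by
  have hkq : Measurable fun y => k y * q y := hk.mul hq
  have hgq : Measurable fun y => g y / q y := hg.div hq
  have h := sq_lintegral_le (ν.withDensity fun y => k y * q y) hgq.aemeasurable
  rw [lintegral_withDensity_eq_lintegral_mul _ hkq hgq,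
    lintegral_withDensity_eq_lintegral_mul _ hkq (hgq.pow_const 2),
    withDensity_apply _ MeasurableSet.univ, Measure.restrict_univ] at h
  refine le_of_eq_of_le ?_ (h.trans_eq ?_)
  · congr 1
    refine lintegral_congr_ae ?_
    filter_upwards [hq0] with y hy
    rw [Pi.mul_apply, mul_assoc, ENNReal.mul_div_cancel hy.1 hy.2]
  · congr 1
    refine lintegral_congr_ae ?_
    filter_upwards [hq0] with y hy
    rw [Pi.mul_apply, mul_assoc, sq, sq, ← mul_assoc (q y), ENNReal.mul_div_cancel hy.1 hy.2,
      mul_div_assoc]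

/-- Equality in Cauchy–Schwarz makes g/q constant for the measure k q dν, which has the same null
sets as ν because k and q do not vanish. -/
theorem exists_ae_eq_const_mul {k q : Y → ℝ≥0∞} (hk : Measurable k) (hk0 : ∀ y, k y ≠ 0)
    (hq : Measurable q) (hq0 : ∀ᵐ y ∂ν, q y ≠ 0 ∧ q y ≠ ∞) (hg : Measurable g)
    (hkq : ∫⁻ y, k y * q y ∂ν ≠ ∞) (hkg : ∫⁻ y, k y * (g y ^ 2 / q y) ∂ν ≠ ∞)
    (h : (∫⁻ y, k y * g y ∂ν) ^ 2 = (∫⁻ y, k y * q y ∂ν) * ∫⁻ y, k y * (g y ^ 2 / q y) ∂ν) :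
    ∃ c, ∀ᵐ y ∂ν, g y = c * q y := by
  have hfin : IsFiniteMeasure (ν.withDensity fun y => k y * q y) := isFiniteMeasure_withDensity hkq
  have hkq' : Measurable fun y => k y * q y := hk.mul hq
  have hgq : Measurable fun y => g y / q y := hg.div hq
  have e1 : ∫⁻ y, k y * (g y ^ 2 / q y) ∂ν =
      ∫⁻ y, (g y / q y) ^ 2 ∂(ν.withDensity fun y => k y * q y) := by
    rw [lintegral_withDensity_eq_lintegral_mul _ hkq' (hgq.pow_const 2)]
    refine lintegral_congr_ae ?_
    filter_upwards [hq0] with y hy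
    rw [Pi.mul_apply, mul_assoc, sq, sq, ← mul_assoc (q y), ENNReal.mul_div_cancel hy.1 hy.2,
      mul_div_assoc]
  have e2 : ∫⁻ y, k y * g y ∂ν = ∫⁻ y, g y / q y ∂(ν.withDensity fun y => k y * q y) := by
    rw [lintegral_withDensity_eq_lintegral_mul _ hkq' hgq]
    refine lintegral_congr_ae ?_
    filter_upwards [hq0] with y hy
    rw [Pi.mul_apply, mul_assoc, ENNReal.mul_div_cancel hy.1 hy.2]
  have e3 : ∫⁻ y, k y * q y ∂ν = (ν.withDensity fun y => k y * q y) Set.univ := by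
    rw [withDensity_apply _ MeasurableSet.univ, Measure.restrict_univ]
  rw [e1] at hkg
  rw [e1, e2, e3] at h
  obtain ⟨c, hc⟩ := exists_ae_eq_const_of_sq_lintegral _ hgq.aemeasurable hkg h
  refine ⟨c, ?_⟩
  rw [ae_withDensity_iff hkq'] at hc
  filter_upwards [hc, hq0] with y hy hy0
  rw [← hy (mul_ne_zero (hk0 y) hy0.1), ENNReal.div_mul_cancel hy0.1 hy0.2]

theorem measurable_left (hκ : Measurable (Function.uncurry κ)) (x : X) :
    Measurable fun y => κ x y := hκ.comp measurable_prodMk_left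

theorem measurable_left_mul (hκ : Measurable (Function.uncurry κ)) (hg : Measurable g) (x : X) :
    Measurable fun y => κ x y * g y := (measurable_left hκ x).mul hg

theorem measurable_right_mul (hκ : Measurable (Function.uncurry κ)) (hp : Measurable p) (y : Y) :
    Measurable fun x => κ x y * p x := Measurable.mul (hκ.comp measurable_prodMk_right) hp

variable [SFinite μ] [SFinite ν]

/-- By SS*p = A p and Tonelli, the kernel is integrated against p first, giving q = S*p, which
cancels the denominator. -/
theorem lintegral_schur_eq (hκ : Measurable (Function.uncurry κ)) (hp : Measurable p)
    (hq0 : ∀ᵐ y ∂ν, ∫⁻ x, κ x y * p x ∂μ ≠ 0 ∧ ∫⁻ x, κ x y * p x ∂μ ≠ ∞)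
    (hA : ∀ᵐ x ∂μ, ∫⁻ y, κ x y * ∫⁻ z, κ z y * p z ∂μ ∂ν = A * p x) (hg : Measurable g) :
    ∫⁻ x, (∫⁻ y, κ x y * ∫⁻ z, κ z y * p z ∂μ ∂ν) *
      (∫⁻ y, κ x y * (g y ^ 2 / ∫⁻ z, κ z y * p z ∂μ) ∂ν) ∂μ = A * ∫⁻ y, g y ^ 2 ∂ν := by
  have hq : Measurable fun y => ∫⁻ z, κ z y * p z ∂μ :=
    (hκ.mul (hp.comp measurable_fst)).lintegral_prod_left'
  have hm : Measurable fun x => ∫⁻ y, κ x y * (g y ^ 2 / ∫⁻ z, κ z y * p z ∂μ) ∂ν :=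
    (hκ.mul (((hg.pow_const 2).div hq).comp measurable_snd)).lintegral_prod_right'
  have hm2 : Measurable (Function.uncurry fun x y =>
      p x * (κ x y * (g y ^ 2 / ∫⁻ z, κ z y * p z ∂μ))) :=
    (hp.comp measurable_fst).mul (hκ.mul (((hg.pow_const 2).div hq).comp measurable_snd))
  calc _ = ∫⁻ x, A * (p x * ∫⁻ y, κ x y * (g y ^ 2 / ∫⁻ z, κ z y * p z ∂μ) ∂ν) ∂μ := by
        refine lintegral_congr_ae ?_
        filter_upwards [hA] with x hx
        rw [hx, mul_assoc]
    _ = A * ∫⁻ x, ∫⁻ y, p x * (κ x y * (g y ^ 2 / ∫⁻ z, κ z y * p z ∂μ)) ∂ν ∂μ := by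
        have hpm : Measurable fun x =>
          p x * ∫⁻ y, κ x y * (g y ^ 2 / ∫⁻ z, κ z y * p z ∂μ) ∂ν := hp.mul hm
        rw [lintegral_const_mul _ hpm]
        congr 1
        refine lintegral_congr fun x => ?_
        rw [lintegral_const_mul]
        exact measurable_left_mul hκ ((hg.pow_const 2).div hq) x
    _ = A * ∫⁻ y, ∫⁻ x, p x * (κ x y * (g y ^ 2 / ∫⁻ z, κ z y * p z ∂μ)) ∂μ ∂ν := by
        rw [lintegral_lintegral_swap hm2.aemeasurable]
    _ = _ := by
        congr 1
        refine lintegral_congr_ae ?_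
        filter_upwards [hq0] with y hy
        have : ∀ x, p x * (κ x y * (g y ^ 2 / ∫⁻ z, κ z y * p z ∂μ)) =
            (g y ^ 2 / ∫⁻ z, κ z y * p z ∂μ) * (κ x y * p x) := fun x => by ring
        simp_rw [this]
        rw [lintegral_const_mul _ (measurable_right_mul hκ hp _),
          ENNReal.div_mul_cancel hy.1 hy.2]

/-- Schur's test. -/
theorem schur_le (hκ : Measurable (Function.uncurry κ)) (hp : Measurable p)
    (hq0 : ∀ᵐ y ∂ν, ∫⁻ x, κ x y * p x ∂μ ≠ 0 ∧ ∫⁻ x, κ x y * p x ∂μ ≠ ∞)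
    (hA : ∀ᵐ x ∂μ, ∫⁻ y, κ x y * ∫⁻ z, κ z y * p z ∂μ ∂ν = A * p x) (hg : Measurable g) :
    ∫⁻ x, (∫⁻ y, κ x y * g y ∂ν) ^ 2 ∂μ ≤ A * ∫⁻ y, g y ^ 2 ∂ν := by
  have hq : Measurable fun y => ∫⁻ z, κ z y * p z ∂μ :=
    (hκ.mul (hp.comp measurable_fst)).lintegral_prod_left'
  rw [← lintegral_schur_eq hκ hp hq0 hA hg]
  exact lintegral_mono fun x => sq_lintegral_mul_le (measurable_left hκ x) hq hq0 hg

/-- Schur's test is strict if `p` is not square integrable. -/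
theorem schur_lt (hκ : Measurable (Function.uncurry κ)) (hκ0 : ∀ x y, κ x y ≠ 0) (hp : Measurable p)
    (hp0 : ∀ᵐ x ∂μ, p x ≠ ∞) (hpi : ∫⁻ x, p x ^ 2 ∂μ = ∞)
    (hq0 : ∀ᵐ y ∂ν, ∫⁻ x, κ x y * p x ∂μ ≠ 0 ∧ ∫⁻ x, κ x y * p x ∂μ ≠ ∞)
    (hA : ∀ᵐ x ∂μ, ∫⁻ y, κ x y * ∫⁻ z, κ z y * p z ∂μ ∂ν = A * p x) (hA' : A ≠ ∞)
    (hg : Measurable g) (hgi : ∫⁻ y, g y ^ 2 ∂ν ≠ ∞) (hg0 : ¬ g =ᵐ[ν] 0) :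
    ∫⁻ x, (∫⁻ y, κ x y * g y ∂ν) ^ 2 ∂μ < A * ∫⁻ y, g y ^ 2 ∂ν := by
  refine lt_of_le_of_ne (schur_le hκ hp hq0 hA hg) fun heq => ?_
  have hq : Measurable fun y => ∫⁻ z, κ z y * p z ∂μ :=
    (hκ.mul (hp.comp measurable_fst)).lintegral_prod_left'
  have hν : ν ≠ 0 := by rintro rfl; exact hg0 (by simp [EventuallyEq])
  have hμ : μ ≠ 0 := by rintro rfl; simp at hpi
  have : NeBot (ae μ) := ae_neBot.2 hμ
  have htot := lintegral_schur_eq hκ hp hq0 hA hg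
  have htop : A * ∫⁻ y, g y ^ 2 ∂ν ≠ ∞ := ENNReal.mul_ne_top hA' hgi
  have hm1 : Measurable fun x => ∫⁻ y, κ x y * ∫⁻ z, κ z y * p z ∂μ ∂ν :=
    (hκ.mul (hq.comp measurable_snd)).lintegral_prod_right'
  have hm2 : Measurable fun x => ∫⁻ y, κ x y * (g y ^ 2 / ∫⁻ z, κ z y * p z ∂μ) ∂ν :=
    (hκ.mul (((hg.pow_const 2).div hq).comp measurable_snd)).lintegral_prod_right'
  -- Equality of the finite total integrals forces equality in Cauchy–Schwarz for almost every x; a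
  -- single good x then gives g = c q.
  have hpt : (fun x => (∫⁻ y, κ x y * g y ∂ν) ^ 2) =ᵐ[μ]
      fun x => (∫⁻ y, κ x y * ∫⁻ z, κ z y * p z ∂μ ∂ν) *
        ∫⁻ y, κ x y * (g y ^ 2 / ∫⁻ z, κ z y * p z ∂μ) ∂ν :=
    ae_eq_of_ae_le_of_lintegral_le (Eventually.of_forall fun x =>
      sq_lintegral_mul_le (measurable_left hκ x) hq hq0 hg) (by rwa [heq])
      (hm1.mul hm2).aemeasurable (by rw [heq, ← htot])
  have hlt := ae_lt_top (hm1.mul hm2) (by rw [← htot] at htop; exact htop)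
  obtain ⟨x, hx1, hx2, hx3, hx4⟩ := (hpt.and (hlt.and (hA.and hp0))).exists
  have hne : ∫⁻ y, κ x y * ∫⁻ z, κ z y * p z ∂μ ∂ν ≠ 0 := by
    have hmm : Measurable fun y => κ x y * ∫⁻ z, κ z y * p z ∂μ :=
      measurable_left_mul hκ hq x
    rw [Ne, lintegral_eq_zero_iff hmm]
    intro h0
    have : NeBot (ae ν) := ae_neBot.2 hν
    obtain ⟨y, hy1, hy2⟩ := (h0.and hq0).exists
    exact mul_ne_zero (hκ0 x y) hy2.1 hy1
  have hkq : ∫⁻ y, κ x y * ∫⁻ z, κ z y * p z ∂μ ∂ν ≠ ∞ := by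
    rw [hx3]; exact ENNReal.mul_ne_top hA' hx4
  have hkg : ∫⁻ y, κ x y * (g y ^ 2 / ∫⁻ z, κ z y * p z ∂μ) ∂ν ≠ ∞ := fun h => by
    rw [Pi.mul_apply, h, ENNReal.mul_top hne] at hx2
    exact lt_irrefl _ hx2
  obtain ⟨c, hc⟩ := exists_ae_eq_const_mul (measurable_left hκ x) (fun y => hκ0 x y) hq
    hq0 hg hkq hkg hx1
  have hA0 : A ≠ 0 := fun h => by rw [hx3, h, zero_mul] at hne; exact hne rfl
  have hc0 : c ≠ 0 := by
    rintro rfl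
    exact hg0 (by filter_upwards [hc] with y hy; simpa using hy)
  have hm3 : Measurable (Function.uncurry fun x y => κ x y * p x * ∫⁻ z, κ z y * p z ∂μ) :=
    (hκ.mul (hp.comp measurable_fst)).mul (hq.comp measurable_snd)
  -- ‖S*p‖² = ⟨SS*p, p⟩ = A‖p‖² is infinite, so a nonzero multiple of q cannot be square integrable.
  have hqq : ∫⁻ y, (∫⁻ z, κ z y * p z ∂μ) ^ 2 ∂ν = ∞ := by
    calc ∫⁻ y, (∫⁻ z, κ z y * p z ∂μ) ^ 2 ∂ν
        = ∫⁻ y, ∫⁻ x, κ x y * p x * ∫⁻ z, κ z y * p z ∂μ ∂μ ∂ν := by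
          refine lintegral_congr fun y => ?_
          rw [lintegral_mul_const _ (measurable_right_mul hκ hp _), sq]
      _ = ∫⁻ x, ∫⁻ y, κ x y * p x * ∫⁻ z, κ z y * p z ∂μ ∂ν ∂μ :=
          (lintegral_lintegral_swap hm3.aemeasurable).symm
      _ = ∫⁻ x, A * p x ^ 2 ∂μ := by
          refine lintegral_congr_ae ?_
          filter_upwards [hA] with x hx
          have : ∀ y, κ x y * p x * ∫⁻ z, κ z y * p z ∂μ =
            p x * (κ x y * ∫⁻ z, κ z y * p z ∂μ) := fun y => by ring
          simp_rw [this]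
          rw [lintegral_const_mul _ (measurable_left_mul hκ hq _), hx]
          ring
      _ = ∞ := by rw [lintegral_const_mul _ (hp.pow_const 2), hpi, ENNReal.mul_top hA0]
  apply hgi
  rw [lintegral_congr_ae (g := fun y => c ^ 2 * (∫⁻ z, κ z y * p z ∂μ) ^ 2)
    (by filter_upwards [hc] with y hy; rw [hy, mul_pow]),
    lintegral_const_mul _ (hq.pow_const 2), hqq, ENNReal.mul_top (pow_ne_zero 2 hc0)]

theorem measurable_lintegral_adjoint (hκ : Measurable (Function.uncurry κ)) {h : X → ℝ≥0∞}
    (hh : Measurable h) : Measurable fun y => ∫⁻ z, κ z y * h z ∂μ :=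
  (hκ.mul (hh.comp measurable_fst)).lintegral_prod_left'

/-- This is ‖S*h‖² = ⟨SS*h, h⟩, by Tonelli. -/
theorem lintegral_sq_adjoint_eq (hκ : Measurable (Function.uncurry κ)) {h : X → ℝ≥0∞}
    (hh : Measurable h) : ∫⁻ y, (∫⁻ x, κ x y * h x ∂μ) ^ 2 ∂ν =
      ∫⁻ x, (∫⁻ y, κ x y * ∫⁻ z, κ z y * h z ∂μ ∂ν) * h x ∂μ := by
  have hg : Measurable fun y => ∫⁻ z, κ z y * h z ∂μ := measurable_lintegral_adjoint hκ hh
  have hm3 : Measurable (Function.uncurry fun x y => κ x y * h x * ∫⁻ z, κ z y * h z ∂μ) :=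
    (hκ.mul (hh.comp measurable_fst)).mul (hg.comp measurable_snd)
  calc ∫⁻ y, (∫⁻ z, κ z y * h z ∂μ) ^ 2 ∂ν
      = ∫⁻ y, ∫⁻ x, κ x y * h x * ∫⁻ z, κ z y * h z ∂μ ∂μ ∂ν := by
        refine lintegral_congr fun y => ?_
        rw [lintegral_mul_const _ (measurable_right_mul hκ hh _), sq]
    _ = ∫⁻ x, ∫⁻ y, κ x y * h x * ∫⁻ z, κ z y * h z ∂μ ∂ν ∂μ :=
        (lintegral_lintegral_swap hm3.aemeasurable).symm
    _ = _ := by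
        refine lintegral_congr fun x => ?_
        rw [← lintegral_mul_const _ (measurable_left_mul hκ hg _)]
        exact lintegral_congr fun y => by ring

/-- A lower bound for the norm of a positive integral operator, by testing with its adjoint. -/
theorem sq_lintegral_adjoint_le (hκ : Measurable (Function.uncurry κ)) {h : X → ℝ≥0∞}
    (hh : Measurable h) :
    (∫⁻ y, (∫⁻ x, κ x y * h x ∂μ) ^ 2 ∂ν) ^ 2 ≤
      (∫⁻ x, (∫⁻ y, κ x y * ∫⁻ z, κ z y * h z ∂μ ∂ν) ^ 2 ∂μ) * ∫⁻ x, h x ^ 2 ∂μ := by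
  have hS : Measurable fun x => ∫⁻ y, κ x y * ∫⁻ z, κ z y * h z ∂μ ∂ν :=
    (hκ.mul ((measurable_lintegral_adjoint hκ hh).comp measurable_snd)).lintegral_prod_right'
  rw [lintegral_sq_adjoint_eq hκ hh]
  have h2 := ENNReal.lintegral_mul_le_Lp_mul_Lq μ (p := 2) (q := 2)
    (Real.holderConjugate_iff.2 ⟨by norm_num, by norm_num⟩) hS.aemeasurable hh.aemeasurable
  simp only [Pi.mul_apply, ENNReal.rpow_ofNat] at h2
  refine (pow_le_pow_left' h2 2).trans_eq ?_
  rw [mul_pow, ← ENNReal.rpow_natCast, ← ENNReal.rpow_natCast, ← ENNReal.rpow_mul,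
    ← ENNReal.rpow_mul]
  norm_num

end Schur

/-! ### Rotation invariance and homogeneity of the kernel of SS*. -/

theorem finrank_space (m n : ℕ) : Module.finrank ℝ (Space m n) = m * n := by
  rw [(WithLp.linearEquiv 2 ℝ (Fin m → EuclideanSpace ℝ (Fin n))).finrank_eq,
    Module.finrank_pi_fintype]
  simp

theorem lintegral_comp_smul {V : Type*} [NormedAddCommGroup V] [NormedSpace ℝ V]
    [FiniteDimensional ℝ V] [MeasurableSpace V] [BorelSpace V] (μ : Measure V)
    [μ.IsAddHaarMeasure] {t : ℝ} (ht : 0 < t) (f : V → ℝ≥0∞) :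
    ∫⁻ v, f v ∂μ = ENNReal.ofReal t ^ (Module.finrank ℝ V : ℝ) * ∫⁻ v, f (t • v) ∂μ := by
  have h : ∫⁻ v, f v ∂(μ.map fun v => t • v) = ∫⁻ v, f (t • v) ∂μ :=
    lintegral_map_equiv f (MeasurableEquiv.smul₀ (G₀ := ℝ) (α := V) t ht.ne')
  rw [← h, Measure.map_addHaar_smul μ ht.ne', lintegral_smul_measure, smul_eq_mul, ← mul_assoc,
    ENNReal.ofReal_rpow_of_pos ht, ← ENNReal.ofReal_mul (by positivity), Real.rpow_natCast,
    abs_of_pos (by positivity), mul_inv_cancel₀ (by positivity), ENNReal.ofReal_one, one_mul]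

section Homogeneity

variable {m n : ℕ} (α β ρ : Fin m → ℝ)

/-- The kernel of the composition of the positive operator with its adjoint. -/
def compKern (x w : EuclideanSpace ℝ (Fin n)) : ℝ≥0∞ :=
  ∫⁻ y : Space m n, kern α β ρ x y * kern α β ρ w y

/-- The power weight `|x|^{-n/2}`. -/
def powWeight (x : EuclideanSpace ℝ (Fin n)) : ℝ≥0∞ := ‖x‖ₑ ^ (-((n : ℝ) / 2))

theorem measurable_powWeight : Measurable (powWeight : EuclideanSpace ℝ (Fin n) → ℝ≥0∞) :=
  measurable_enorm.pow_const _

theorem measurable_compKern :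
    Measurable (Function.uncurry (compKern (n := n) α β ρ)) := by
  have h3 : Measurable fun p : (EuclideanSpace ℝ (Fin n) × EuclideanSpace ℝ (Fin n)) × Space m n =>
      kern α β ρ p.1.1 p.2 * kern α β ρ p.1.2 p.2 :=
    (measurable_kern_comp α β ρ (measurable_fst.comp measurable_fst) measurable_snd).mul
      (measurable_kern_comp α β ρ (measurable_snd.comp measurable_fst) measurable_snd)
  have h4 := h3.lintegral_prod_right' (ν := volume)
  exact h4

theorem kern_isometry (O : EuclideanSpace ℝ (Fin n) ≃ₗᵢ[ℝ] EuclideanSpace ℝ (Fin n))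
    (x : EuclideanSpace ℝ (Fin n)) (y : Space m n) :
    kern α β ρ (O x) (LinearIsometryEquiv.piLpCongrRight 2 (fun _ => O) y) = kern α β ρ x y := by
  have h : ∀ z, ‖O z‖ₑ = ‖z‖ₑ := fun z => O.toLinearIsometry.enorm_map z
  simp only [kern, LinearIsometryEquiv.piLpCongrRight_apply, ← map_sub, h]

theorem compKern_isometry (O : EuclideanSpace ℝ (Fin n) ≃ₗᵢ[ℝ] EuclideanSpace ℝ (Fin n))
    (x w : EuclideanSpace ℝ (Fin n)) : compKern α β ρ (O x) (O w) = compKern α β ρ x w := by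
  set T : Space m n ≃ₗᵢ[ℝ] Space m n := LinearIsometryEquiv.piLpCongrRight 2 (fun _ => O)
  rw [compKern, ← T.measurePreserving.lintegral_comp_emb T.toHomeomorph.measurableEmbedding]
  simp only [T, kern_isometry]
  rfl

theorem enorm_smul_rpow {t : ℝ} (ht : 0 < t) (x : EuclideanSpace ℝ (Fin n)) (s : ℝ) :
    ‖t • x‖ₑ ^ s = ENNReal.ofReal t ^ s * ‖x‖ₑ ^ s := by
  rw [enorm_smul, ENNReal.mul_rpow_of_ne_top enorm_ne_top enorm_ne_top,
    Real.enorm_of_nonneg ht.le]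

theorem ofReal_rpow_add {t : ℝ} (ht : 0 < t) (a b : ℝ) :
    ENNReal.ofReal t ^ (a + b) = ENNReal.ofReal t ^ a * ENNReal.ofReal t ^ b :=
  ENNReal.rpow_add _ _ (by simpa using ht) ENNReal.ofReal_ne_top

theorem ofReal_rpow_sum {t : ℝ} (ht : 0 < t) (a : Fin m → ℝ) :
    ENNReal.ofReal t ^ (∑ k, a k) = ∏ k, ENNReal.ofReal t ^ (a k) := by
  rw [ENNReal.ofReal_rpow_of_pos ht, Real.rpow_sum_of_pos ht,
    ENNReal.ofReal_prod_of_nonneg fun _ _ => by positivity]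
  exact Finset.prod_congr rfl fun k _ => (ENNReal.ofReal_rpow_of_pos ht).symm

theorem kern_smul {t : ℝ} (ht : 0 < t) (x : EuclideanSpace ℝ (Fin n)) (y : Space m n) :
    kern α β ρ (t • x) (t • y) = ENNReal.ofReal t ^ (-((∑ k, β k) / 2) +
      ∑ k, (-((n : ℝ) - α k / 2) + -(ρ k / 2))) * kern α β ρ x y := by
  rw [ofReal_rpow_add ht, ofReal_rpow_sum ht]
  simp only [ofReal_rpow_add ht, kern, PiLp.smul_apply, ← smul_sub, enorm_smul_rpow ht]
  have : ∀ k, ENNReal.ofReal t ^ (-((n : ℝ) - α k / 2)) * ‖x - y k‖ₑ ^ (-((n : ℝ) - α k / 2)) *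
      (ENNReal.ofReal t ^ (-(ρ k / 2)) * ‖y k‖ₑ ^ (-(ρ k / 2))) =
      ENNReal.ofReal t ^ (-((n : ℝ) - α k / 2)) * ENNReal.ofReal t ^ (-(ρ k / 2)) *
      (‖x - y k‖ₑ ^ (-((n : ℝ) - α k / 2)) * ‖y k‖ₑ ^ (-(ρ k / 2))) := fun k => by ring
  simp_rw [this]
  rw [Finset.prod_mul_distrib]
  ring

variable {α β ρ}

/-- Twice the degree of the kernel plus the dimension mn is α - β - ρ - mn, which the balance
condition makes equal to -n. -/
theorem compKern_smul (hbal : (n : ℝ) - ∑ k, β k - ∑ k, ρ k = (m : ℝ) * n - ∑ k, α k)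
    {t : ℝ} (ht : 0 < t) (x w : EuclideanSpace ℝ (Fin n)) :
    compKern α β ρ (t • x) (t • w) = ENNReal.ofReal t ^ (-(n : ℝ)) * compKern α β ρ x w := by
  rw [compKern, lintegral_comp_smul volume ht, finrank_space]
  have h : ∀ y : Space m n, kern α β ρ (t • x) (t • y) * kern α β ρ (t • w) (t • y) =
      ENNReal.ofReal t ^ ((-((∑ k, β k) / 2) + ∑ k, (-((n : ℝ) - α k / 2) + -(ρ k / 2))) +
        (-((∑ k, β k) / 2) + ∑ k, (-((n : ℝ) - α k / 2) + -(ρ k / 2)))) *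
      (kern α β ρ x y * kern α β ρ w y) := fun y => by
    rw [ofReal_rpow_add ht, kern_smul α β ρ ht, kern_smul α β ρ ht]; ring
  simp_rw [h]
  rw [lintegral_const_mul]
  · rw [← mul_assoc, ← ofReal_rpow_add ht, compKern]
    congr 2
    have : ∑ k, (-((n : ℝ) - α k / 2) + -(ρ k / 2)) =
        -((m : ℝ) * n) + (∑ k, α k) / 2 - (∑ k, ρ k) / 2 := by
      rw [Finset.sum_div, Finset.sum_div, Finset.sum_add_distrib, Finset.sum_neg_distrib,
        Finset.sum_sub_distrib, Finset.sum_neg_distrib]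
      simp
      ring
    rw [this]
    push_cast
    linarith
  · exact (measurable_left (measurable_kern α β ρ) x).mul (measurable_left (measurable_kern α β ρ) w)

theorem exists_isometry_smul {e x : EuclideanSpace ℝ (Fin n)} (he : ‖e‖ = 1) (hx : x ≠ 0) :
    ∃ O : EuclideanSpace ℝ (Fin n) ≃ₗᵢ[ℝ] EuclideanSpace ℝ (Fin n), x = ‖x‖ • O e := by
  have hx' : ‖x‖ ≠ 0 := norm_ne_zero_iff.2 hx
  have h : ‖e‖ = ‖‖x‖⁻¹ • x‖ := by
    rw [he, norm_smul, norm_inv, norm_norm, inv_mul_cancel₀ hx']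
  refine ⟨(ℝ ∙ (e - ‖x‖⁻¹ • x))ᗮ.reflection, ?_⟩
  rw [Submodule.reflection_sub h, smul_inv_smul₀ hx']

/-- Moving x to the unit vector e by a rotation and a dilation shows that |x|^(-n/2) is an
eigenfunction. The radial factor φ covers three uses: φ = 1 for the eigenvalue, the unit ball for
finiteness, shells for sharpness. -/
theorem lintegral_compKern_eq (hbal : (n : ℝ) - ∑ k, β k - ∑ k, ρ k = (m : ℝ) * n - ∑ k, α k)
    (φ : ℝ → ℝ≥0∞) (hφ : Measurable φ) {e x : EuclideanSpace ℝ (Fin n)} (he : ‖e‖ = 1)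
    (hx : x ≠ 0) :
    ∫⁻ w, compKern α β ρ x w * (powWeight w * φ (‖w‖ / ‖x‖)) =
      (∫⁻ w, compKern α β ρ e w * (powWeight w * φ ‖w‖)) * powWeight x := by
  obtain ⟨O, hO⟩ := exists_isometry_smul he hx
  have hx0 : 0 < ‖x‖ := norm_pos_iff.2 hx
  rw [lintegral_comp_smul volume hx0, finrank_euclideanSpace_fin,
    ← O.measurePreserving.lintegral_comp_emb O.toHomeomorph.measurableEmbedding]
  have h : ∀ w, compKern α β ρ x (‖x‖ • O w) *
      (powWeight (‖x‖ • O w) * φ (‖‖x‖ • O w‖ / ‖x‖)) =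
      ENNReal.ofReal ‖x‖ ^ (-(n : ℝ) + -((n : ℝ) / 2)) *
        (compKern α β ρ e w * (powWeight w * φ ‖w‖)) := by
    intro w
    have h1 : compKern α β ρ x (‖x‖ • O w) =
        ENNReal.ofReal ‖x‖ ^ (-(n : ℝ)) * compKern α β ρ e w := by
      conv_lhs => rw [hO]
      rw [norm_smul, norm_norm, O.norm_map, he, mul_one, compKern_smul hbal hx0, compKern_isometry]
    have h2 : powWeight (‖x‖ • O w) = ENNReal.ofReal ‖x‖ ^ (-((n : ℝ) / 2)) * powWeight w := by
      rw [powWeight, enorm_smul_rpow hx0, O.toLinearIsometry.enorm_map w |> fun h =>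
        (h : ‖O w‖ₑ = ‖w‖ₑ), powWeight]
    rw [h1, h2, norm_smul, norm_norm, O.norm_map, mul_div_cancel_left₀ _ hx0.ne',
      ofReal_rpow_add hx0]
    ring
  simp_rw [h]
  rw [lintegral_const_mul, ← mul_assoc, ← ofReal_rpow_add hx0, mul_comm]
  · congr 1
    rw [powWeight, ← ofReal_norm x]
    congr 1
    ring
  · exact (measurable_left (measurable_compKern α β ρ) e).mul
      (measurable_powWeight.mul (hφ.comp measurable_norm))

end Homogeneity

/-! ### Logarithmic polar coordinates and the kernel H. -/

/-- Polar coordinates with a logarithmic radial variable. -/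
theorem lintegral_polar_log {n : ℕ} (hn : 0 < n) {F : EuclideanSpace ℝ (Fin n) → ℝ≥0∞}
    (hF : Measurable F) : ∫⁻ w, F w = ∫⁻ x : ℝ, ∫⁻ η, ENNReal.ofReal (Real.exp (n * x)) *
      F (Real.exp x • (η : EuclideanSpace ℝ (Fin n))) ∂(surface n) := by
  have : Nonempty (Fin n) := ⟨⟨0, hn⟩⟩
  have : SFinite (surface n) := by unfold surface; infer_instance
  have hmp := Measure.measurePreserving_homeomorphUnitSphereProd
    (volume : Measure (EuclideanSpace ℝ (Fin n)))
  have hG : Measurable fun p : Metric.sphere (0 : EuclideanSpace ℝ (Fin n)) 1 × Set.Ioi (0 : ℝ) =>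
      F ((p.2 : ℝ) • (p.1 : EuclideanSpace ℝ (Fin n))) := by fun_prop
  have h1 : ∫⁻ w, F w = ∫⁻ p, F ((p.2 : ℝ) • (p.1 : EuclideanSpace ℝ (Fin n)))
      ∂((surface n).prod (Measure.volumeIoiPow (n - 1))) := by
    have h := hmp.lintegral_comp_emb (Homeomorph.measurableEmbedding _)
      (fun p => F ((p.2 : ℝ) • (p.1 : EuclideanSpace ℝ (Fin n))))
    rw [finrank_euclideanSpace_fin] at h
    rw [surface, ← h]
    have h2 : ∀ x : ({0}ᶜ : Set (EuclideanSpace ℝ (Fin n))),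
        (((homeomorphUnitSphereProd (EuclideanSpace ℝ (Fin n))) x).2 : ℝ) •
        (((homeomorphUnitSphereProd (EuclideanSpace ℝ (Fin n))) x).1 : EuclideanSpace ℝ (Fin n)) =
        x := fun x => by
      have hx : ‖(x : EuclideanSpace ℝ (Fin n))‖ ≠ 0 := norm_ne_zero_iff.2 x.2
      simp [smul_smul, mul_inv_cancel₀ hx]
    simp_rw [h2]
    rw [lintegral_subtype_comap (measurableSet_singleton _).compl, restrict_compl_singleton]
  have hI : Measurable fun r : ℝ => ∫⁻ η, F (r • (η : EuclideanSpace ℝ (Fin n))) ∂(surface n) :=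
    Measurable.lintegral_prod_right' (f := fun p : ℝ × Metric.sphere (0 :
      EuclideanSpace ℝ (Fin n)) 1 => F (p.1 • (p.2 : EuclideanSpace ℝ (Fin n)))) (by fun_prop)
  rw [h1, lintegral_prod_symm _ hG.aemeasurable, Measure.volumeIoiPow,
    lintegral_withDensity_eq_lintegral_mul _ (by fun_prop) (by exact hI.comp measurable_subtype_coe)]
  have h3 := lintegral_subtype_comap (μ := (volume : Measure ℝ)) (s := Set.Ioi 0) measurableSet_Ioi
    (fun r : ℝ => ENNReal.ofReal (r ^ (n - 1)) *
      ∫⁻ η, F (r • (η : EuclideanSpace ℝ (Fin n))) ∂(surface n))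
  refine h3.trans ?_
  -- The substitution r = e^x turns r^(n-1) dr into e^(nx) dx.
  have himg : Real.exp '' Set.univ = Set.Ioi 0 := by rw [Set.image_univ, Real.range_exp]
  rw [← himg, lintegral_image_eq_lintegral_abs_deriv_mul MeasurableSet.univ
    (fun x _ => (Real.hasDerivAt_exp x).hasDerivWithinAt) Real.exp_injective.injOn,
    Measure.restrict_univ]
  refine lintegral_congr fun x => ?_
  rw [lintegral_const_mul, ← mul_assoc, ← ENNReal.ofReal_mul (abs_nonneg _),
    abs_of_pos (Real.exp_pos _), ← pow_succ', Nat.sub_add_cancel hn, ← Real.exp_nat_mul]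
  · exact hF.comp (by fun_prop)

instance (n : ℕ) : IsFiniteMeasure (surface n) := by unfold surface; infer_instance

theorem surface_univ_ne_zero {n : ℕ} (hn : 0 < n) : surface n Set.univ ≠ 0 := by
  rw [surface, Measure.toSphere_apply_univ, finrank_euclideanSpace_fin]
  exact mul_ne_zero (by exact_mod_cast hn.ne') (Metric.measure_ball_pos _ _ one_pos).ne'

theorem norm_exp_smul {n : ℕ} (x : ℝ) (η : Metric.sphere (0 : EuclideanSpace ℝ (Fin n)) 1) :
    ‖Real.exp x • (η : EuclideanSpace ℝ (Fin n))‖ = Real.exp x := by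
  rw [norm_smul, Real.norm_of_nonneg (Real.exp_pos x).le, norm_eq_of_mem_sphere η, mul_one]

theorem enorm_exp_smul_rpow {n : ℕ} (x s : ℝ)
    (η : Metric.sphere (0 : EuclideanSpace ℝ (Fin n)) 1) :
    ‖Real.exp x • (η : EuclideanSpace ℝ (Fin n))‖ₑ ^ s = ENNReal.ofReal (Real.exp (s * x)) := by
  rw [← ofReal_norm, norm_exp_smul, ENNReal.ofReal_rpow_of_pos (Real.exp_pos x), ← Real.exp_mul,
    mul_comm]

theorem ofReal_exp_mul (x y : ℝ) : ENNReal.ofReal (Real.exp x) * ENNReal.ofReal (Real.exp y) =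
    ENNReal.ofReal (Real.exp (x + y)) := by
  rw [← ENNReal.ofReal_mul (Real.exp_pos x).le, Real.exp_add]

/-- |w|^(-n) dw is the measure dx dσ in these coordinates; in particular |w|^(-n/2) misses L² only
by the infinite length of the line. -/
theorem lintegral_powWeight_sq_mul {n : ℕ} (hn : 0 < n) {φ : ℝ → ℝ≥0∞} (hφ : Measurable φ) :
    ∫⁻ w : EuclideanSpace ℝ (Fin n), powWeight w ^ 2 * φ ‖w‖ =
      (∫⁻ x : ℝ, φ (Real.exp x)) * surface n Set.univ := by
  have hF : Measurable fun w : EuclideanSpace ℝ (Fin n) => powWeight w ^ 2 * φ ‖w‖ :=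
    (measurable_powWeight.pow_const 2).mul (hφ.comp measurable_norm)
  rw [lintegral_polar_log hn hF, ← lintegral_mul_const _ (by fun_prop)]
  refine lintegral_congr fun x => ?_
  rw [← lintegral_const]
  refine lintegral_congr fun η => ?_
  rw [norm_exp_smul, powWeight, enorm_exp_smul_rpow, sq, ← mul_assoc, ofReal_exp_mul,
    ofReal_exp_mul]
  have : (n : ℝ) * x + (-((n : ℝ) / 2) * x + -((n : ℝ) / 2) * x) = 0 := by ring
  rw [this, Real.exp_zero, ENNReal.ofReal_one, one_mul]

theorem lintegral_powWeight_sq {n : ℕ} (hn : 0 < n) :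
    ∫⁻ w : EuclideanSpace ℝ (Fin n), powWeight w ^ 2 = ∞ := by
  have h := lintegral_powWeight_sq_mul hn (φ := fun _ => 1) measurable_const
  simp only [mul_one] at h
  rw [h]
  simp [ENNReal.top_mul (surface_univ_ne_zero hn)]

/-- The factor of `compKern` coming from one block. -/
def blockKern {n : ℕ} (a r : ℝ) (x w : EuclideanSpace ℝ (Fin n)) : ℝ≥0∞ :=
  ∫⁻ y, ‖x - y‖ₑ ^ (-a) * ‖y‖ₑ ^ (-(r / 2)) * (‖w - y‖ₑ ^ (-a) * ‖y‖ₑ ^ (-(r / 2)))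

theorem compKern_eq {m n : ℕ} (α β ρ : Fin m → ℝ) (x w : EuclideanSpace ℝ (Fin n)) :
    compKern α β ρ x w = ‖x‖ₑ ^ (-((∑ k, β k) / 2)) * ‖w‖ₑ ^ (-((∑ k, β k) / 2)) *
      ∏ k, blockKern ((n : ℝ) - α k / 2) (ρ k) x w := by
  simp only [blockKern]
  rw [← lintegral_space_prod _ fun k => by fun_prop, ← lintegral_const_mul]
  · simp only [compKern, kern, Finset.prod_mul_distrib]
    refine lintegral_congr fun y => ?_
    ring
  · refine Finset.measurable_fun_prod _ fun k _ => ?_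
    have := measurable_block (n := n) k
    fun_prop

theorem norm_exp_smul_sub_sq {n : ℕ} (x t : ℝ)
    (η ξ : Metric.sphere (0 : EuclideanSpace ℝ (Fin n)) 1) :
    ‖Real.exp x • (η : EuclideanSpace ℝ (Fin n)) - Real.exp t • (ξ : EuclideanSpace ℝ (Fin n))‖ ^ 2
      = 2 * Real.exp (x + t) * (Real.cosh (x - t) - inner ℝ (ξ : EuclideanSpace ℝ (Fin n)) η) := by
  rw [norm_sub_sq_real, norm_exp_smul, norm_exp_smul, inner_smul_left, inner_smul_right,
    real_inner_comm, Real.cosh_eq, Real.exp_add, Real.exp_neg, Real.exp_sub]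
  have h1 := Real.exp_pos x
  have h2 := Real.exp_pos t
  simp only [conj_trivial]
  field_simp
  ring

theorem enorm_rpow_neg_eq {n : ℕ} (z : EuclideanSpace ℝ (Fin n)) (a : ℝ) :
    ‖z‖ₑ ^ (-a) = ENNReal.ofReal (‖z‖ ^ 2) ^ (-(a / 2)) := by
  rw [ENNReal.ofReal_pow (norm_nonneg _), ofReal_norm, ← ENNReal.rpow_natCast, ← ENNReal.rpow_mul]
  congr 1
  push_cast
  ring

/-- With y = e^t ξ, each squared distance is 2 e^(±x/2+t) times a factor of the form cosh - inner
product. The powers of e^(x/2) cancel at these symmetric positions, and those of e^t combine to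
e^(-(r-a/2)t). -/
theorem blockKern_eq_kernelB {n : ℕ} (hn : 0 < n) (a r x : ℝ)
    (η₁ η₂ : Metric.sphere (0 : EuclideanSpace ℝ (Fin n)) 1) :
    blockKern ((n : ℝ) - a / 2) r (Real.exp (x / 2) • (η₁ : EuclideanSpace ℝ (Fin n)))
      (Real.exp (-(x / 2)) • (η₂ : EuclideanSpace ℝ (Fin n))) =
    ENNReal.ofReal (2 ^ (-((n : ℝ) - a / 2))) * kernelB n a r x η₁ η₂ := by
  rw [blockKern, lintegral_polar_log hn (by fun_prop), kernelB, ← lintegral_const_mul' _ _ (by simp)]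
  refine lintegral_congr fun t => ?_
  rw [← lintegral_const_mul' _ _ (by simp)]
  refine lintegral_congr fun ξ => ?_
  have hP1 : 0 ≤ Real.cosh (x / 2 - t) - inner ℝ (ξ : EuclideanSpace ℝ (Fin n)) η₁ := by
    have h := norm_exp_smul_sub_sq (x / 2) t η₁ ξ
    have h0 := sq_nonneg ‖Real.exp (x / 2) • (η₁ : EuclideanSpace ℝ (Fin n)) -
      Real.exp t • (ξ : EuclideanSpace ℝ (Fin n))‖
    rw [h] at h0
    exact nonneg_of_mul_nonneg_right h0 (by positivity)
  rw [enorm_rpow_neg_eq, enorm_rpow_neg_eq (_ - _), norm_exp_smul_sub_sq, norm_exp_smul_sub_sq,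
    enorm_exp_smul_rpow]
  set P1 := Real.cosh (x / 2 - t) - inner ℝ (ξ : EuclideanSpace ℝ (Fin n)) η₁
  have e2 : Real.cosh (-(x / 2) - t) = Real.cosh (x / 2 + t) := by rw [← Real.cosh_neg]; ring_nf
  rw [e2]
  set P2 := Real.cosh (x / 2 + t) - inner ℝ (ξ : EuclideanSpace ℝ (Fin n)) η₂
  set b := ((n : ℝ) - a / 2) / 2 with hb
  have h3 : ENNReal.ofReal (2 * Real.exp (x / 2 + t) * P1) ^ (-b) *
      ENNReal.ofReal (2 * Real.exp (-(x / 2) + t) * P2) ^ (-b) =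
      ENNReal.ofReal (2 ^ (-((n : ℝ) - a / 2))) *
        ENNReal.ofReal (Real.exp (-((n : ℝ) - a / 2) * t)) * ENNReal.ofReal (P1 * P2) ^ (-b) := by
    rw [← ENNReal.mul_rpow_of_ne_top ENNReal.ofReal_ne_top ENNReal.ofReal_ne_top,
      ← ENNReal.ofReal_mul (by positivity)]
    have : 2 * Real.exp (x / 2 + t) * P1 * (2 * Real.exp (-(x / 2) + t) * P2) =
        (2 * Real.exp t) ^ (2 : ℝ) * (P1 * P2) := by
      have : Real.exp (x / 2 + t) * Real.exp (-(x / 2) + t) = Real.exp t ^ 2 := by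
        rw [← Real.exp_add, ← Real.exp_nat_mul]; congr 1; push_cast; ring
      rw [Real.rpow_two]
      linear_combination 4 * P1 * P2 * this
    rw [this, ENNReal.ofReal_mul (by positivity),
      ENNReal.mul_rpow_of_ne_top ENNReal.ofReal_ne_top ENNReal.ofReal_ne_top,
      ENNReal.ofReal_rpow_of_pos (by positivity), ← Real.rpow_mul (by positivity),
      Real.mul_rpow (by norm_num) (Real.exp_pos t).le, ENNReal.ofReal_mul (by positivity),
      ← Real.exp_mul]
    congr 3
    · congr 1; rw [hb]; ring
    · congr 1; rw [hb]; ring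
  have hb' : (n : ℝ) / 2 - a / 4 = b := by rw [hb]; ring
  rw [hb']
  calc _ = ENNReal.ofReal (Real.exp (n * t)) * ENNReal.ofReal (Real.exp (-(r / 2) * t)) *
        ENNReal.ofReal (Real.exp (-(r / 2) * t)) *
        (ENNReal.ofReal (2 * Real.exp (x / 2 + t) * P1) ^ (-b) *
          ENNReal.ofReal (2 * Real.exp (-(x / 2) + t) * P2) ^ (-b)) := by ring
    _ = ENNReal.ofReal (2 ^ (-((n : ℝ) - a / 2))) * ((ENNReal.ofReal (Real.exp (n * t)) *
          ENNReal.ofReal (Real.exp (-(r / 2) * t)) * ENNReal.ofReal (Real.exp (-(r / 2) * t)) *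
          ENNReal.ofReal (Real.exp (-((n : ℝ) - a / 2) * t))) *
          ENNReal.ofReal (P1 * P2) ^ (-b)) := by rw [h3]; ring
    _ = _ := by
        rw [ofReal_exp_mul, ofReal_exp_mul, ofReal_exp_mul]
        congr 4
        ring

theorem measurable_kernelB (n : ℕ) (a r : ℝ) {Z : Type*} [MeasurableSpace Z] {f : Z → ℝ}
    {g h : Z → Metric.sphere (0 : EuclideanSpace ℝ (Fin n)) 1} (hf : Measurable f)
    (hg : Measurable g) (hh : Measurable h) :
    Measurable fun z => kernelB n a r (f z) (g z) (h z) := by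
  have hm : Measurable fun p : (Z × ℝ) × Metric.sphere (0 : EuclideanSpace ℝ (Fin n)) 1 =>
      ENNReal.ofReal (Real.exp (-(r - a / 2) * p.1.2)) *
      ENNReal.ofReal
        ((Real.cosh (f p.1.1 / 2 - p.1.2) - inner ℝ (p.2 : EuclideanSpace ℝ (Fin n)) (g p.1.1)) *
        (Real.cosh (f p.1.1 / 2 + p.1.2) - inner ℝ (p.2 : EuclideanSpace ℝ (Fin n)) (h p.1.1)))
      ^ (-((n : ℝ) / 2 - a / 4)) := by
    have h1 : Measurable fun p : (Z × ℝ) × Metric.sphere (0 : EuclideanSpace ℝ (Fin n)) 1 =>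
      f p.1.1 := hf.comp (measurable_fst.comp measurable_fst)
    have h2 : Measurable fun p : (Z × ℝ) × Metric.sphere (0 : EuclideanSpace ℝ (Fin n)) 1 =>
      (g p.1.1 : EuclideanSpace ℝ (Fin n)) :=
      measurable_subtype_coe.comp (hg.comp (measurable_fst.comp measurable_fst))
    have h3 : Measurable fun p : (Z × ℝ) × Metric.sphere (0 : EuclideanSpace ℝ (Fin n)) 1 =>
      (h p.1.1 : EuclideanSpace ℝ (Fin n)) :=
      measurable_subtype_coe.comp (hh.comp (measurable_fst.comp measurable_fst))
    have h4 : Measurable fun p : (Z × ℝ) × Metric.sphere (0 : EuclideanSpace ℝ (Fin n)) 1 =>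
      (p.2 : EuclideanSpace ℝ (Fin n)) := measurable_subtype_coe.comp measurable_snd
    fun_prop
  exact hm.lintegral_prod_right'.lintegral_prod_right'

/-- The integral does not depend on the unit vector e, so integrating over e = η₁ multiplies it by
σ(S^(n-1)) and produces the double spherical integral in H. -/
theorem surface_mul_lintegral_compKern {m n : ℕ} (hn : 0 < n) {α β ρ : Fin m → ℝ}
    (hbal : (n : ℝ) - ∑ k, β k - ∑ k, ρ k = (m : ℝ) * n - ∑ k, α k)
    {φ : ℝ → ℝ≥0∞} (hφ : Measurable φ) {e : EuclideanSpace ℝ (Fin n)} (he : ‖e‖ = 1) :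
    (∫⁻ w, compKern α β ρ e w * (powWeight w * φ ‖w‖)) * surface n Set.univ =
      ENNReal.ofReal (2 ^ (-((m : ℝ) * n) + (∑ k, α k) / 2)) *
        ∫⁻ x, φ (Real.exp (-x)) * kernelH n α ρ x := by
  have h1 : ∀ η : Metric.sphere (0 : EuclideanSpace ℝ (Fin n)) 1,
      ∫⁻ w, compKern α β ρ e w * (powWeight w * φ ‖w‖) =
        ∫⁻ x : ℝ, ∫⁻ η₂, φ (Real.exp (-x)) *
          (ENNReal.ofReal (2 ^ (-((m : ℝ) * n) + (∑ k, α k) / 2)) *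
            ∏ k, kernelB n (α k) (ρ k) x η η₂) ∂(surface n) := by
    intro η
    have hη : (η : EuclideanSpace ℝ (Fin n)) ≠ 0 := ne_zero_of_mem_unit_sphere η
    have h2 := lintegral_compKern_eq hbal φ hφ he hη
    have hη1 : ‖(η : EuclideanSpace ℝ (Fin n))‖ = 1 := norm_eq_of_mem_sphere η
    have hp1 : powWeight (η : EuclideanSpace ℝ (Fin n)) = 1 := by
      rw [powWeight, ← ofReal_norm, hη1, ENNReal.ofReal_one, ENNReal.one_rpow]
    rw [hp1, mul_one] at h2
    simp only [hη1, div_one] at h2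
    have hF : Measurable fun w => compKern α β ρ (η : EuclideanSpace ℝ (Fin n)) w *
        (powWeight w * φ ‖w‖) := (measurable_left (measurable_compKern α β ρ) _).mul
      (measurable_powWeight.mul (hφ.comp measurable_norm))
    rw [← h2, lintegral_polar_log hn hF, ← lintegral_neg_eq_self]
    refine lintegral_congr fun x => lintegral_congr fun η₂ => ?_
    -- Homogeneity with factor e^(x/2) moves the points η and e^(-x)η₂ to the symmetric positions
    -- e^(x/2)η and e^(-x/2)η₂.
    have h3 := compKern_smul hbal (Real.exp_pos (x / 2)) (η : EuclideanSpace ℝ (Fin n))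
      (Real.exp (-x) • (η₂ : EuclideanSpace ℝ (Fin n)))
    rw [smul_smul, ← Real.exp_add, show x / 2 + -x = -(x / 2) by ring, compKern_eq,
      enorm_exp_smul_rpow, enorm_exp_smul_rpow, ofReal_exp_mul,
      ENNReal.ofReal_rpow_of_pos (Real.exp_pos _), ← Real.exp_mul] at h3
    simp only [blockKern_eq_kernelB hn, Finset.prod_mul_distrib] at h3
    rw [← ENNReal.ofReal_prod_of_nonneg fun k _ => by positivity,
      ← Real.rpow_sum_of_pos two_pos, Finset.sum_neg_distrib, Finset.sum_sub_distrib,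
      ← Finset.sum_div, Finset.sum_const, Finset.card_univ, Fintype.card_fin, nsmul_eq_mul,
      show -((∑ k, β k) / 2) * (x / 2) + -((∑ k, β k) / 2) * -(x / 2) = 0 by ring, Real.exp_zero,
      ENNReal.ofReal_one, one_mul, show -((m : ℝ) * n - (∑ k, α k) / 2) =
        -((m : ℝ) * n) + (∑ k, α k) / 2 by ring] at h3
    rw [h3, norm_exp_smul, powWeight, enorm_exp_smul_rpow]
    calc _ = (ENNReal.ofReal (Real.exp (n * -x)) * ENNReal.ofReal (Real.exp (-((n : ℝ) / 2) * -x))) *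
          compKern α β ρ (η : EuclideanSpace ℝ (Fin n))
            (Real.exp (-x) • (η₂ : EuclideanSpace ℝ (Fin n))) * φ (Real.exp (-x)) := by ring
      _ = _ := by
          rw [ofReal_exp_mul, show (n : ℝ) * -x + -((n : ℝ) / 2) * -x = x / 2 * -n by ring]
          ring
  have hm : Measurable (Function.uncurry fun (η : Metric.sphere (0 : EuclideanSpace ℝ (Fin n)) 1)
      (x : ℝ) => ∫⁻ η₂, φ (Real.exp (-x)) *
          (ENNReal.ofReal (2 ^ (-((m : ℝ) * n) + (∑ k, α k) / 2)) *
            ∏ k, kernelB n (α k) (ρ k) x η η₂) ∂(surface n)) := by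
    refine Measurable.lintegral_prod_right' (f := fun p : (Metric.sphere (0 :
      EuclideanSpace ℝ (Fin n)) 1 × ℝ) × Metric.sphere (0 : EuclideanSpace ℝ (Fin n)) 1 =>
      φ (Real.exp (-p.1.2)) * (ENNReal.ofReal (2 ^ (-((m : ℝ) * n) + (∑ k, α k) / 2)) *
        ∏ k, kernelB n (α k) (ρ k) p.1.2 p.1.1 p.2)) ?_
    refine (hφ.comp (by fun_prop)).mul (measurable_const.mul
      (Finset.measurable_fun_prod _ fun k _ => measurable_kernelB n _ _ ?_ ?_ ?_))
    · exact measurable_snd.comp measurable_fst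
    · exact measurable_fst.comp measurable_fst
    · exact measurable_snd
  rw [← lintegral_const, lintegral_congr h1, lintegral_lintegral_swap hm.aemeasurable,
    ← lintegral_const_mul' _ _ ENNReal.ofReal_ne_top]
  refine lintegral_congr fun x => ?_
  have hB : ∀ η₁ : Metric.sphere (0 : EuclideanSpace ℝ (Fin n)) 1,
      Measurable fun η₂ => ∏ k, kernelB n (α k) (ρ k) x η₁ η₂ := fun η₁ =>
    Finset.measurable_fun_prod _ fun k _ =>
      measurable_kernelB n _ _ measurable_const measurable_const measurable_id
  have hB' : Measurable fun η₁ => ∫⁻ η₂, ∏ k, kernelB n (α k) (ρ k) x η₁ η₂ ∂(surface n) :=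
    Measurable.lintegral_prod_right' (f := fun p : Metric.sphere (0 :
      EuclideanSpace ℝ (Fin n)) 1 × Metric.sphere (0 : EuclideanSpace ℝ (Fin n)) 1 =>
      ∏ k, kernelB n (α k) (ρ k) x p.1 p.2) (Finset.measurable_fun_prod _ fun k _ =>
      measurable_kernelB n _ _ measurable_const measurable_fst measurable_snd)
  rw [kernelH, mul_left_comm, ← lintegral_const_mul _ hB', ← lintegral_const_mul]
  · refine lintegral_congr fun η₁ => ?_
    rw [lintegral_const_mul _ ((hB η₁).const_mul _), lintegral_const_mul _ (hB η₁)]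
  · exact hB'.const_mul _

/-! ### Finiteness of the integral of H. -/

section Finiteness

theorem rpow_neg_mul_rpow_neg_le {r q E D : ℝ} (hr : 0 < r) (hq : 0 < q) (hE : 0 ≤ E) (hD : 0 ≤ D)
    (h : 1 / 2 ≤ r + q) : r ^ (-E) * q ^ (-D) ≤
      5 ^ D * powTail E (E + D) r + 5 ^ E * powTail D (E + D) q := by
  have key : ∀ {r q E D : ℝ}, 0 < r → r ≤ q → 0 ≤ D → 1 / 2 ≤ r + q →
      r ^ (-E) * q ^ (-D) ≤ 5 ^ D * powTail E (E + D) r := by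
    intro r q E D hr hrq hD h
    -- If r ≤ q and r + q ≥ 1/2 then q ≥ 1/4, so 1 + r ≤ 4q + q.
    have h1 : (1 + r) / 5 ≤ q := by linarith
    have h2 : q ^ (-D) ≤ ((1 + r) / 5) ^ (-D) :=
      Real.rpow_le_rpow_of_nonpos (by positivity) h1 (by linarith)
    rw [Real.div_rpow (by positivity) (by norm_num), Real.rpow_neg (by norm_num : (0 : ℝ) ≤ 5),
      div_inv_eq_mul] at h2
    calc r ^ (-E) * q ^ (-D) ≤ r ^ (-E) * ((1 + r) ^ (-D) * 5 ^ D) := by gcongr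
      _ = _ := by rw [powTail]; ring_nf
  have n1 := powTail_nonneg E (E + D) hr.le
  have n2 := powTail_nonneg D (E + D) hq.le
  rcases le_total r q with hrq | hrq
  · exact (key hr hrq hD h).trans (le_add_of_nonneg_right (by positivity))
  · have := key (E := D) (D := E) hq hrq hE (by linarith)
    rw [mul_comm, add_comm E D]
    exact this.trans (le_add_of_nonneg_left (by rw [add_comm D E]; positivity))

/-- The larger of p and q is at least s/2, and μ of its powers are traded for s^(-μ); the remaining
powers are moved to the smaller one. -/
theorem rpow_neg_mul_rpow_neg_le_of_le_add {p q s A B μ : ℝ} (hp : 0 < p) (hq : 0 < q) (hs : 0 < s)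
    (hμ : 0 ≤ μ) (hA : μ ≤ A) (hB : μ ≤ B) (h : s ≤ p + q) :
    p ^ (-A) * q ^ (-B) ≤ 2 ^ μ * s ^ (-μ) * (p ^ (-(A + B - μ)) + q ^ (-(A + B - μ))) := by
  have key : ∀ {p q A B : ℝ}, 0 < p → p ≤ q → μ ≤ B → s ≤ p + q →
      p ^ (-A) * q ^ (-B) ≤ 2 ^ μ * s ^ (-μ) * p ^ (-(A + B - μ)) := by
    intro p q A B hp hpq hB h
    have hq : 0 < q := hp.trans_le hpq
    have h1 : q ^ (-μ) ≤ 2 ^ μ * s ^ (-μ) := by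
      have h3 : q ^ (-μ) ≤ (s / 2) ^ (-μ) :=
        Real.rpow_le_rpow_of_nonpos (by positivity) (by linarith) (by linarith)
      rwa [Real.div_rpow hs.le (by norm_num), Real.rpow_neg (by norm_num : (0 : ℝ) ≤ 2),
        div_inv_eq_mul, mul_comm] at h3
    have h2 : q ^ (-(B - μ)) ≤ p ^ (-(B - μ)) :=
      Real.rpow_le_rpow_of_nonpos hp hpq (by linarith)
    calc p ^ (-A) * q ^ (-B) = q ^ (-μ) * (p ^ (-A) * q ^ (-(B - μ))) := by
          rw [mul_left_comm, ← Real.rpow_add hq]; ring_nf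
      _ ≤ 2 ^ μ * s ^ (-μ) * (p ^ (-A) * p ^ (-(B - μ))) := by gcongr
      _ = _ := by rw [← Real.rpow_add hp]; ring_nf
  rcases le_total p q with hpq | hpq
  · refine (key hp hpq hB h).trans ?_
    gcongr
    exact le_add_of_nonneg_right (by positivity)
  · have h1 := key (A := B) hq hpq hA (by linarith)
    rw [mul_comm, add_comm A B]
    refine h1.trans ?_
    gcongr
    exact le_add_of_nonneg_left (by positivity)

variable {n : ℕ}

theorem ae_ne (hn : 0 < n) (z : EuclideanSpace ℝ (Fin n)) :
    ∀ᵐ y : EuclideanSpace ℝ (Fin n), y ≠ z := by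
  have : Nonempty (Fin n) := ⟨⟨0, hn⟩⟩
  exact Measure.ae_ne volume z

theorem lintegral_powTail_sub (κ τ : ℝ) (z : EuclideanSpace ℝ (Fin n)) :
    ∫⁻ y : EuclideanSpace ℝ (Fin n), ENNReal.ofReal (powTail κ τ ‖z - y‖) =
      ∫⁻ y : EuclideanSpace ℝ (Fin n), ENNReal.ofReal (powTail κ τ ‖y‖) :=
  lintegral_sub_left_eq_self (fun y => ENNReal.ofReal (powTail κ τ ‖y‖)) z

/-- When the centres are at least 1/2 apart the integrand is dominated by two translated majorants,
whose integrals do not depend on the centres. -/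
theorem exists_lintegral_two_centers_le (hn : 0 < n) {E D : ℝ} (hE : 0 ≤ E) (hD : 0 ≤ D)
    (hEn : E < n) (hDn : D < n) (hED : (n : ℝ) < E + D) : ∃ M : ℝ≥0∞, M ≠ ∞ ∧
    ∀ ζ z : EuclideanSpace ℝ (Fin n), 1 / 2 ≤ ‖ζ - z‖ →
      ∫⁻ y, ‖ζ - y‖ₑ ^ (-E) * ‖z - y‖ₑ ^ (-D) ≤ M := by
  have hfin : ∀ κ, κ < (n : ℝ) →
      ∫⁻ y : EuclideanSpace ℝ (Fin n), ENNReal.ofReal (powTail κ (E + D) ‖y‖) ≠ ∞ := fun κ hκ =>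
    (integrable_powTail hκ hED).lintegral_lt_top.ne
  have hmeas := fun κ => measurable_powTail κ (E + D)
  refine ⟨ENNReal.ofReal (5 ^ D) *
      (∫⁻ y : EuclideanSpace ℝ (Fin n), ENNReal.ofReal (powTail E (E + D) ‖y‖)) +
    ENNReal.ofReal (5 ^ E) *
      ∫⁻ y : EuclideanSpace ℝ (Fin n), ENNReal.ofReal (powTail D (E + D) ‖y‖),
    ENNReal.add_ne_top.2 ⟨ENNReal.mul_ne_top ENNReal.ofReal_ne_top (hfin E hEn),
      ENNReal.mul_ne_top ENNReal.ofReal_ne_top (hfin D hDn)⟩, fun ζ z hζ => ?_⟩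
  rw [← lintegral_powTail_sub _ _ ζ, ← lintegral_powTail_sub _ _ z,
    ← lintegral_const_mul _ (by have := hmeas E; fun_prop),
    ← lintegral_const_mul _ (by have := hmeas D; fun_prop),
    ← lintegral_add_left (by have := hmeas E; fun_prop)]
  refine lintegral_mono_ae ?_
  filter_upwards [ae_ne hn ζ, ae_ne hn z] with y hy1 hy2
  have hr := norm_pos_iff.2 (sub_ne_zero.2 hy1.symm)
  have hq := norm_pos_iff.2 (sub_ne_zero.2 hy2.symm)
  have n1 := powTail_nonneg E (E + D) hr.le
  have n2 := powTail_nonneg D (E + D) hq.le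
  rw [enorm_rpow_eq (sub_ne_zero.2 hy1.symm), enorm_rpow_eq (sub_ne_zero.2 hy2.symm),
    ← ENNReal.ofReal_mul (by positivity), ← ENNReal.ofReal_mul (by positivity),
    ← ENNReal.ofReal_mul (by positivity), ← ENNReal.ofReal_add (by positivity) (by positivity)]
  refine ENNReal.ofReal_le_ofReal (rpow_neg_mul_rpow_neg_le hr hq hE hD (hζ.trans ?_))
  have := norm_sub_le_norm_sub_add_norm_sub ζ y z
  rwa [norm_sub_rev y z] at this

/-- When two centres p and q may collide, the factor |p-q|^(-μ) is split off to lower the joint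
singularity to A + B - μ < n, reducing to two separated centres. -/
theorem exists_lintegral_three_centers_le (hn : 0 < n) {A B D μ : ℝ} (hμ : 0 ≤ μ) (hA : μ ≤ A)
    (hB : μ ≤ B) (hD : 0 ≤ D) (hEn : A + B - μ < n) (hDn : D < n) (hED : (n : ℝ) < A + B - μ + D) :
    ∃ M : ℝ≥0∞, M ≠ ∞ ∧ ∀ p q z : EuclideanSpace ℝ (Fin n), p ≠ q → 1 / 2 ≤ ‖p - z‖ →
      1 / 2 ≤ ‖q - z‖ →
      ∫⁻ y, ‖p - y‖ₑ ^ (-A) * ‖q - y‖ₑ ^ (-B) * ‖z - y‖ₑ ^ (-D) ≤ M * ‖p - q‖ₑ ^ (-μ) := by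
  obtain ⟨M, hM, h⟩ := exists_lintegral_two_centers_le hn (E := A + B - μ) (D := D)
    (by linarith) hD hEn hDn hED
  refine ⟨ENNReal.ofReal (2 ^ μ) * (M + M), ENNReal.mul_ne_top ENNReal.ofReal_ne_top
    (ENNReal.add_ne_top.2 ⟨hM, hM⟩), fun p q z hpq hp hq => ?_⟩
  have hpw : ∀ᵐ y : EuclideanSpace ℝ (Fin n),
      ‖p - y‖ₑ ^ (-A) * ‖q - y‖ₑ ^ (-B) * ‖z - y‖ₑ ^ (-D) ≤
      ENNReal.ofReal (2 ^ μ) * ‖p - q‖ₑ ^ (-μ) * (‖p - y‖ₑ ^ (-(A + B - μ)) * ‖z - y‖ₑ ^ (-D) +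
        ‖q - y‖ₑ ^ (-(A + B - μ)) * ‖z - y‖ₑ ^ (-D)) := by
    filter_upwards [ae_ne hn p, ae_ne hn q] with y hy1 hy2
    rw [← add_mul, ← mul_assoc]
    refine mul_le_mul_left ?_ _
    have hr := norm_pos_iff.2 (sub_ne_zero.2 hy1.symm)
    have hq := norm_pos_iff.2 (sub_ne_zero.2 hy2.symm)
    have hs := norm_pos_iff.2 (sub_ne_zero.2 hpq)
    rw [enorm_rpow_eq (sub_ne_zero.2 hy1.symm), enorm_rpow_eq (sub_ne_zero.2 hy2.symm),
      enorm_rpow_eq (sub_ne_zero.2 hpq), enorm_rpow_eq (sub_ne_zero.2 hy1.symm),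
      enorm_rpow_eq (sub_ne_zero.2 hy2.symm), ← ENNReal.ofReal_add (by positivity) (by positivity),
      ← ENNReal.ofReal_mul (by positivity), ← ENNReal.ofReal_mul (by positivity),
      ← ENNReal.ofReal_mul (by positivity)]
    refine ENNReal.ofReal_le_ofReal (rpow_neg_mul_rpow_neg_le_of_le_add hr hq hs hμ hA hB ?_)
    have := norm_sub_le_norm_sub_add_norm_sub p y q
    rwa [norm_sub_rev y q] at this
  refine (lintegral_mono_ae hpw).trans ?_
  rw [lintegral_const_mul _ (by fun_prop), lintegral_add_left (by fun_prop)]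
  calc _ ≤ ENNReal.ofReal (2 ^ μ) * ‖p - q‖ₑ ^ (-μ) * (M + M) := by
        gcongr
        · exact h p z hp
        · exact h q z hq
    _ = _ := by ring

theorem lintegral_rpow_ball_ne_top (hn : 0 < n) {κ : ℝ} (hκ : κ < n)
    (e : EuclideanSpace ℝ (Fin n)) :
    ∫⁻ w in {w | ‖e - w‖ < 2}, ‖e - w‖ₑ ^ (-κ) ≠ ∞ := by
  have hfin := (integrable_powTail (n := n) hκ (lt_add_one (n : ℝ))).lintegral_lt_top.ne
  rw [← lintegral_powTail_sub _ _ e] at hfin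
  refine ne_top_of_le_ne_top (ENNReal.mul_ne_top (ENNReal.ofReal_ne_top
    (r := 3 ^ ((n : ℝ) + 1 - κ))) hfin) ?_
  rw [← lintegral_const_mul' _ _ ENNReal.ofReal_ne_top]
  refine le_trans (setLIntegral_mono_ae' (measurableSet_lt (by fun_prop) (by fun_prop))
    (g := fun w => ENNReal.ofReal (3 ^ ((n : ℝ) + 1 - κ)) *
      ENNReal.ofReal (powTail κ (n + 1) ‖e - w‖)) ?_) (setLIntegral_le_lintegral _ _)
  filter_upwards [ae_ne hn e] with w hw hw2
  have hr := norm_pos_iff.2 (sub_ne_zero.2 hw.symm)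
  rw [enorm_rpow_eq (sub_ne_zero.2 hw.symm), ← ENNReal.ofReal_mul (by positivity)]
  refine ENNReal.ofReal_le_ofReal ?_
  rw [powTail, mul_left_comm]
  refine le_mul_of_one_le_right (by positivity) ?_
  rw [Real.rpow_neg (by positivity), ← div_eq_mul_inv, one_le_div (by positivity)]
  have hw3 : ‖e - w‖ < 2 := hw2
  exact Real.rpow_le_rpow (by positivity) (by linarith) (by linarith)

theorem blockKern_eq (hn : 0 < n) (a r : ℝ) (x w : EuclideanSpace ℝ (Fin n)) :
    blockKern a r x w =
      ∫⁻ y, ‖x - y‖ₑ ^ (-a) * ‖w - y‖ₑ ^ (-a) * ‖(0 : EuclideanSpace ℝ (Fin n)) - y‖ₑ ^ (-r) := by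
  refine lintegral_congr_ae ?_
  filter_upwards [ae_ne hn 0] with y hy
  have h : ‖y‖ₑ ^ (-r) = ‖y‖ₑ ^ (-(r / 2)) * ‖y‖ₑ ^ (-(r / 2)) := by
    rw [← ENNReal.rpow_add _ _ (by simpa using hy) enorm_ne_top]
    ring_nf
  rw [zero_sub, enorm_neg, h]
  ring

/-- For small w the singularities at w and 0 merge while e stays away. The choice μ > ρ - α/2 makes
the merged singularity integrable, and μ < (ρ+n-α)/2 is what the sum over the blocks can afford. -/
theorem exists_blockKern_le_small (hn : 0 < n) {α ρ : ℝ} (hα : 0 < α ∧ α < n) (hρ : 0 < ρ ∧ ρ < n) :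
    ∃ (μ : ℝ) (M : ℝ≥0∞), M ≠ ∞ ∧ μ < (ρ + n - α) / 2 ∧ ∀ e w : EuclideanSpace ℝ (Fin n),
      ‖e‖ = 1 → w ≠ 0 → ‖w‖ ≤ 1 / 2 → blockKern ((n : ℝ) - α / 2) ρ e w ≤ M * ‖w‖ₑ ^ (-μ) := by
  obtain ⟨μ, h1, h2⟩ := exists_between (a₁ := max 0 (ρ - α / 2))
    (a₂ := min (min (n - α / 2) ρ) ((ρ + n - α) / 2))
    (max_lt (lt_min (lt_min (by linarith) (by linarith)) (by linarith))
      (lt_min (lt_min (by linarith) (by linarith)) (by linarith)))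
  simp only [max_lt_iff, lt_min_iff] at h1 h2
  obtain ⟨M, hM, h⟩ := exists_lintegral_three_centers_le hn (A := n - α / 2) (B := ρ)
    (D := n - α / 2) (μ := μ) h1.1.le h2.1.1.le h2.1.2.le (by linarith) (by linarith) (by linarith)
    (by linarith)
  refine ⟨μ, M, hM, h2.2, fun e w he hw0 hw => ?_⟩
  have h3 := h w 0 e hw0 (by
    have := norm_sub_norm_le e w
    rw [norm_sub_rev]; linarith) (by rw [zero_sub, norm_neg, he]; norm_num)
  rw [sub_zero] at h3
  refine le_of_eq_of_le ?_ h3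
  rw [blockKern_eq hn]
  exact lintegral_congr fun y => by ring

/-- For w near e the singularities at e and w merge while 0 stays away; l > n - α gives local
integrability and l < n - α + ρ gives decay at infinity. -/
theorem exists_blockKern_le_near (hn : 0 < n) {α ρ : ℝ} (hα : 0 < α ∧ α < n) (hρ : 0 < ρ ∧ ρ < n) :
    ∃ (l : ℝ) (M : ℝ≥0∞), M ≠ ∞ ∧ l < n - α + ρ ∧ ∀ e w : EuclideanSpace ℝ (Fin n),
      ‖e‖ = 1 → e ≠ w → 1 / 2 ≤ ‖w‖ → blockKern ((n : ℝ) - α / 2) ρ e w ≤ M * ‖e - w‖ₑ ^ (-l) := by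
  obtain ⟨l, h1, h2⟩ := exists_between (a₁ := n - α) (a₂ := min (n - α / 2) (n - α + ρ))
    (by simp only [lt_min_iff]; constructor <;> linarith)
  simp only [lt_min_iff] at h2
  obtain ⟨M, hM, h⟩ := exists_lintegral_three_centers_le hn (A := n - α / 2) (B := n - α / 2)
    (D := ρ) (μ := l) (by linarith) h2.1.le h2.1.le hρ.1.le (by linarith) hρ.2 (by linarith)
  refine ⟨l, M, hM, h2.2, fun e w he hw0 hw => ?_⟩
  rw [blockKern_eq hn]
  exact h e w 0 hw0 (by rw [sub_zero, he]; norm_num) (by rwa [sub_zero])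

end Finiteness

section Finiteness

variable {m n : ℕ} {α β ρ : Fin m → ℝ}

theorem enorm_rpow_sum {z : EuclideanSpace ℝ (Fin n)} (hz : z ≠ 0) (a : Fin m → ℝ) :
    ∏ k, ‖z‖ₑ ^ (a k) = ‖z‖ₑ ^ (∑ k, a k) := by
  rw [← ofReal_norm, ofReal_rpow_sum (norm_pos_iff.2 hz)]

theorem enorm_rpow_add {z : EuclideanSpace ℝ (Fin n)} (hz : z ≠ 0) (a b : ℝ) :
    ‖z‖ₑ ^ (a + b) = ‖z‖ₑ ^ a * ‖z‖ₑ ^ b :=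
  ENNReal.rpow_add _ _ (by simpa using hz) enorm_ne_top

theorem enorm_rpow_le_of_le {w : EuclideanSpace ℝ (Fin n)} {r s : ℝ} (hr : 0 < r) (hw : r ≤ ‖w‖)
    (hs : s ≤ 0) : ‖w‖ₑ ^ s ≤ ENNReal.ofReal (r ^ s) := by
  rw [enorm_rpow_eq (norm_pos_iff.1 (hr.trans_le hw))]
  exact ENNReal.ofReal_le_ofReal (Real.rpow_le_rpow_of_nonpos hr hw hs)

theorem compKern_mul_powWeight_eq {e w : EuclideanSpace ℝ (Fin n)} (he : ‖e‖ = 1) (hw : w ≠ 0) :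
    compKern α β ρ e w * powWeight w = ‖w‖ₑ ^ (-((∑ k, β k) / 2) - (n : ℝ) / 2) *
      ∏ k, blockKern ((n : ℝ) - α k / 2) (ρ k) e w := by
  have he' : ‖e‖ₑ = 1 := by rw [← ofReal_norm, he, ENNReal.ofReal_one]
  rw [compKern_eq, he', ENNReal.one_rpow, one_mul, powWeight, sub_eq_add_neg, enorm_rpow_add hw]
  ring

/-- By the balance condition the strict bounds on the exponents add up to Σμ < (n-β)/2 and Σl < n-β.
The total singularity is therefore below n both at the origin, where the powers of |w| add (β+n)/2,
and at e. -/
theorem setLIntegral_compKern_ne_top (hn : 0 < n) (hm : 0 < m)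
    (hα : ∀ k, 0 < α k ∧ α k < n) (hβ : ∀ k, 0 < β k) (hρ : ∀ k, 0 < ρ k ∧ ρ k < n)
    (hbal : (n : ℝ) - ∑ k, β k - ∑ k, ρ k = (m : ℝ) * n - ∑ k, α k)
    {e : EuclideanSpace ℝ (Fin n)} (he : ‖e‖ = 1) :
    ∫⁻ w, compKern α β ρ e w * (powWeight w * (Set.Iio (1 : ℝ)).indicator 1 ‖w‖) ≠ ∞ := by
  have : Nonempty (Fin m) := ⟨⟨0, hm⟩⟩
  have hβ0 : 0 < ∑ k, β k := Finset.sum_pos (fun k _ => hβ k) Finset.univ_nonempty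
  choose μ M hM hμ hs using fun k => exists_blockKern_le_small hn (hα k) (hρ k)
  choose l N hN hl ht using fun k => exists_blockKern_le_near hn (hα k) (hρ k)
  have hμs : ∑ k, μ k < (n - ∑ k, β k) / 2 := by
    calc ∑ k, μ k < ∑ k, (ρ k + n - α k) / 2 :=
          Finset.sum_lt_sum_of_nonempty Finset.univ_nonempty fun k _ => hμ k
      _ = _ := by
          rw [← Finset.sum_div, Finset.sum_sub_distrib, Finset.sum_add_distrib]
          simp only [Finset.sum_const, Finset.card_univ, Fintype.card_fin, nsmul_eq_mul]
          linarith
  have hls : ∑ k, l k < n := by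
    calc ∑ k, l k < ∑ k, (n - α k + ρ k) :=
          Finset.sum_lt_sum_of_nonempty Finset.univ_nonempty fun k _ => hl k
      _ = n - ∑ k, β k := by
          rw [Finset.sum_add_distrib, Finset.sum_sub_distrib]
          simp only [Finset.sum_const, Finset.card_univ, Fintype.card_fin, nsmul_eq_mul]
          linarith
      _ < n := by linarith
  set κ : ℝ := (∑ k, β k) / 2 + (n : ℝ) / 2 + ∑ k, μ k with hκ
  set R : ℝ≥0∞ := ENNReal.ofReal ((1 / 2) ^ (-((∑ k, β k) / 2) - (n : ℝ) / 2))
  have hpw : ∀ᵐ w, compKern α β ρ e w * (powWeight w * (Set.Iio (1 : ℝ)).indicator 1 ‖w‖) ≤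
      (∏ k, M k) * {w | ‖0 - w‖ < 2}.indicator (fun w => ‖0 - w‖ₑ ^ (-κ)) w +
      R * (∏ k, N k) * {w | ‖e - w‖ < 2}.indicator (fun w => ‖e - w‖ₑ ^ (-(∑ k, l k))) w := by
    filter_upwards [ae_ne hn 0, ae_ne hn e] with w hw0 hwe
    by_cases hw : ‖w‖ < 1
    swap
    · rw [Set.indicator_of_notMem (by simpa using hw)]; simp
    rw [Set.indicator_of_mem (by simpa using hw), Pi.one_apply, mul_one,
      compKern_mul_powWeight_eq he hw0]
    rcases le_total ‖w‖ (1 / 2) with h | h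
    · refine le_add_of_le_of_nonneg ?_ zero_le
      rw [Set.indicator_of_mem (by simp only [Set.mem_ofPred_eq, zero_sub, norm_neg]; linarith),
        zero_sub, enorm_neg]
      calc _ ≤ ‖w‖ₑ ^ (-((∑ k, β k) / 2) - (n : ℝ) / 2) * ∏ k, M k * ‖w‖ₑ ^ (-μ k) := by
            gcongr with k
            exact hs k e w he hw0 h
        _ = (∏ k, M k) * (‖w‖ₑ ^ (-((∑ k, β k) / 2) - (n : ℝ) / 2) * ‖w‖ₑ ^ (∑ k, -μ k)) := by
            rw [Finset.prod_mul_distrib, enorm_rpow_sum hw0]; ring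
        _ = _ := by
            rw [← enorm_rpow_add hw0, Finset.sum_neg_distrib, hκ]
            ring_nf
    · refine le_add_of_nonneg_of_le zero_le ?_
      rw [Set.indicator_of_mem (by
        have := norm_sub_le e w
        simp only [Set.mem_ofPred_eq]; linarith), mul_assoc]
      refine mul_le_mul' (enorm_rpow_le_of_le (by norm_num) h ?_) ?_
      · have : (0 : ℝ) ≤ n := n.cast_nonneg
        linarith
      · rw [← Finset.sum_neg_distrib, ← enorm_rpow_sum (sub_ne_zero.2 hwe.symm),
          ← Finset.prod_mul_distrib]
        exact Finset.prod_le_prod' fun k _ => ht k e w he hwe.symm h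
  refine ne_top_of_le_ne_top ?_ (lintegral_mono_ae hpw)
  have hM' : ∏ k, M k ≠ ∞ := ENNReal.prod_ne_top fun k _ => hM k
  have hN' : R * ∏ k, N k ≠ ∞ :=
    ENNReal.mul_ne_top ENNReal.ofReal_ne_top (ENNReal.prod_ne_top fun k _ => hN k)
  have hS : ∀ z : EuclideanSpace ℝ (Fin n), MeasurableSet {w | ‖z - w‖ < 2} := fun z =>
    measurableSet_lt (by fun_prop) (by fun_prop)
  rw [lintegral_add_left (Measurable.const_mul (Measurable.indicator (by fun_prop) (hS 0)) _),
    lintegral_const_mul' _ _ hM', lintegral_const_mul' _ _ hN', lintegral_indicator (hS 0),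
    lintegral_indicator (hS e)]
  exact ENNReal.add_ne_top.2 ⟨ENNReal.mul_ne_top hM' (lintegral_rpow_ball_ne_top hn
    (by rw [hκ]; linarith) 0), ENNReal.mul_ne_top hN' (lintegral_rpow_ball_ne_top hn hls e)⟩

theorem kernelB_neg (n : ℕ) (a r x : ℝ) (η₁ η₂ : Metric.sphere (0 : EuclideanSpace ℝ (Fin n)) 1) :
    kernelB n a r (-x) η₁ η₂ = kernelB n a r x η₂ η₁ := by
  unfold kernelB
  refine lintegral_congr fun t => lintegral_congr fun ξ => ?_
  rw [show -x / 2 - t = -(x / 2 + t) by ring, show -x / 2 + t = -(x / 2 - t) by ring,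
    Real.cosh_neg, Real.cosh_neg, mul_comm (Real.cosh (x / 2 + t) - _)]

theorem measurable_prod_kernelB (n : ℕ) (α ρ : Fin m → ℝ) {Z : Type*} [MeasurableSpace Z]
    {f : Z → ℝ} {g h : Z → Metric.sphere (0 : EuclideanSpace ℝ (Fin n)) 1} (hf : Measurable f)
    (hg : Measurable g) (hh : Measurable h) :
    Measurable fun z => ∏ k, kernelB n (α k) (ρ k) (f z) (g z) (h z) :=
  Finset.measurable_fun_prod _ fun _ _ => measurable_kernelB n _ _ hf hg hh

theorem measurable_kernelH (n : ℕ) (α ρ : Fin m → ℝ) : Measurable (kernelH n α ρ) := by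
  have h1 := measurable_prod_kernelB n α ρ
    (Z := (ℝ × Metric.sphere (0 : EuclideanSpace ℝ (Fin n)) 1) ×
      Metric.sphere (0 : EuclideanSpace ℝ (Fin n)) 1)
    (measurable_fst.comp measurable_fst) (measurable_snd.comp measurable_fst) measurable_snd
  have h2 := h1.lintegral_prod_right' (ν := surface n)
  exact h2.lintegral_prod_right' (ν := surface n)

theorem kernelH_neg (n : ℕ) (α ρ : Fin m → ℝ) (x : ℝ) : kernelH n α ρ (-x) = kernelH n α ρ x := by
  simp only [kernelH, kernelB_neg]
  exact lintegral_lintegral_swap (measurable_prod_kernelB n α ρ measurable_const measurable_snd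
    measurable_fst).aemeasurable

/-- H is even because x ↦ -x exchanges η₁ and η₂; so the half line x > 0, that is |w| < 1, carries
half of the integral. -/
theorem lintegral_kernelH_eq (n : ℕ) (α ρ : Fin m → ℝ) : ∫⁻ x, kernelH n α ρ x =
    2 * ∫⁻ x, (Set.Iio (1 : ℝ)).indicator 1 (Real.exp (-x)) * kernelH n α ρ x := by
  have hH := measurable_kernelH n α ρ
  have hφ : Measurable ((Set.Iio (1 : ℝ)).indicator (1 : ℝ → ℝ≥0∞)) :=
    measurable_one.indicator measurableSet_Iio
  have h1 : ∫⁻ x, (Set.Iio (1 : ℝ)).indicator 1 (Real.exp (-x)) * kernelH n α ρ x =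
      ∫⁻ x, (Set.Iio (1 : ℝ)).indicator 1 (Real.exp x) * kernelH n α ρ x := by
    rw [← lintegral_neg_eq_self]
    simp only [neg_neg, kernelH_neg]
  have h2 : ∫⁻ x, kernelH n α ρ x = ∫⁻ x, ((Set.Iio (1 : ℝ)).indicator 1 (Real.exp (-x)) *
      kernelH n α ρ x + (Set.Iio (1 : ℝ)).indicator 1 (Real.exp x) * kernelH n α ρ x) := by
    refine lintegral_congr_ae ?_
    filter_upwards [Measure.ae_ne volume (0 : ℝ)] with x hx
    rcases hx.lt_or_gt with h | h
    · rw [Set.indicator_of_notMem (by simpa using h.le), Set.indicator_of_mem (by simpa using h)]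
      simp
    · rw [Set.indicator_of_mem (by simpa using h), Set.indicator_of_notMem (by simpa using h.le)]
      simp
  rw [h2, lintegral_add_left (by fun_prop), ← h1, two_mul]

theorem exists_norm_eq_one (hn : 0 < n) : ∃ e : EuclideanSpace ℝ (Fin n), ‖e‖ = 1 :=
  ⟨EuclideanSpace.single ⟨0, hn⟩ 1, by simp⟩

theorem lintegral_kernelH_ne_top (hn : 0 < n) (hm : 0 < m)
    (hα : ∀ k, 0 < α k ∧ α k < n) (hβ : ∀ k, 0 < β k) (hρ : ∀ k, 0 < ρ k ∧ ρ k < n)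
    (hbal : (n : ℝ) - ∑ k, β k - ∑ k, ρ k = (m : ℝ) * n - ∑ k, α k) :
    ∫⁻ x, kernelH n α ρ x ≠ ∞ := by
  obtain ⟨e, he⟩ := exists_norm_eq_one hn
  have h := surface_mul_lintegral_compKern hn hbal (φ := (Set.Iio (1 : ℝ)).indicator 1)
    (measurable_one.indicator measurableSet_Iio) he
  have h1 := ENNReal.mul_ne_top (setLIntegral_compKern_ne_top hn hm hα hβ hρ hbal he)
    (measure_ne_top (surface n) Set.univ)
  rw [h] at h1
  rw [lintegral_kernelH_eq]
  refine ENNReal.mul_ne_top (by simp) fun h2 => h1 ?_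
  rw [h2]
  exact ENNReal.mul_top (ENNReal.ofReal_pos.2 (by positivity)).ne'

/-! ### The value of the sharp constant. -/

/-- The norm of the composition `S S*` of the integral operator `S` with kernel `kern` and its
adjoint. -/
def normConst {m : ℕ} (n : ℕ) (α ρ : Fin m → ℝ) : ℝ≥0∞ :=
  ENNReal.ofReal (2 ^ (-((m : ℝ) * n) + (∑ k, α k) / 2)) * (∫⁻ x, kernelH n α ρ x) /
    surface n Set.univ

theorem lintegral_compKern_mul_powWeight (hn : 0 < n)
    (hbal : (n : ℝ) - ∑ k, β k - ∑ k, ρ k = (m : ℝ) * n - ∑ k, α k)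
    {e : EuclideanSpace ℝ (Fin n)} (he : ‖e‖ = 1) :
    ∫⁻ w, compKern α β ρ e w * powWeight w = normConst n α ρ := by
  have h := surface_mul_lintegral_compKern hn hbal (φ := fun _ => 1) measurable_const he
  simp only [mul_one, one_mul] at h
  rw [normConst, ENNReal.eq_div_iff (surface_univ_ne_zero hn) (measure_ne_top _ _), ← h, mul_comm]

/-- The eigenvalue equation SS*p = N p for p = |x|^(-n/2). -/
theorem lintegral_compKern_mul_powWeight_eq (hn : 0 < n)
    (hbal : (n : ℝ) - ∑ k, β k - ∑ k, ρ k = (m : ℝ) * n - ∑ k, α k)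
    {x : EuclideanSpace ℝ (Fin n)} (hx : x ≠ 0) :
    ∫⁻ w, compKern α β ρ x w * powWeight w = normConst n α ρ * powWeight x := by
  obtain ⟨e, he⟩ := exists_norm_eq_one hn
  have h := lintegral_compKern_eq hbal (fun _ => 1) measurable_const he hx
  simp only [mul_one] at h
  rw [h, lintegral_compKern_mul_powWeight hn hbal he]

/-- Squaring the Riesz constants produces the powers of π and the squared Gamma quotients; the
remaining factor is the eigenvalue. -/
theorem sharpConst_eq (n : ℕ) (α ρ : Fin m → ℝ) :
    sharpConst n α ρ = rieszConst n α ^ 2 * (normConst n α ρ).toReal := by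
  have h1 : rieszConst n α ^ 2 = Real.pi ^ (-((m : ℝ) * n) + ∑ k, α k) *
      ∏ k, (Real.Gamma ((2 * n - α k) / 4) / Real.Gamma (α k / 4)) ^ 2 := by
    rw [rieszConst, ← Finset.prod_pow]
    simp only [mul_pow]
    rw [Finset.prod_mul_distrib]
    congr 1
    simp only [← Real.rpow_natCast, ← Real.rpow_mul Real.pi_pos.le]
    rw [← Real.rpow_sum_of_pos Real.pi_pos]
    congr 1
    push_cast
    simp only [sub_mul, Finset.sum_sub_distrib, div_mul_cancel₀ _ (two_ne_zero' ℝ)]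
    simp
    ring
  rw [sharpConst, normConst, h1, ENNReal.toReal_div, ENNReal.toReal_mul,
    ENNReal.toReal_ofReal (by positivity), Measure.real]
  ring

end Finiteness

/-! ### The norm of the integral operator: upper bound, strictness, sharpness. -/

section KernelOperator

variable {m n : ℕ} {α β ρ : Fin m → ℝ}

theorem lintegral_kern_adjoint {h : EuclideanSpace ℝ (Fin n) → ℝ≥0∞} (hh : Measurable h)
    (x : EuclideanSpace ℝ (Fin n)) :
    ∫⁻ y, kern α β ρ x y * ∫⁻ z, kern α β ρ z y * h z = ∫⁻ z, compKern α β ρ x z * h z := by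
  have hκ := measurable_kern (n := n) α β ρ
  have hm : Measurable (Function.uncurry fun (y : Space m n) (z : EuclideanSpace ℝ (Fin n)) =>
      kern α β ρ x y * (kern α β ρ z y * h z)) :=
    (measurable_kern_comp α β ρ measurable_const measurable_fst).mul
      ((measurable_kern_comp α β ρ measurable_snd measurable_fst).mul (hh.comp measurable_snd))
  calc _ = ∫⁻ y, ∫⁻ z, kern α β ρ x y * (kern α β ρ z y * h z) := by
        refine lintegral_congr fun y => ?_
        rw [lintegral_const_mul _ (measurable_right_mul hκ hh y)]
    _ = ∫⁻ z, ∫⁻ y, kern α β ρ x y * (kern α β ρ z y * h z) :=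
        lintegral_lintegral_swap hm.aemeasurable
    _ = _ := by
        refine lintegral_congr fun z => ?_
        have hm2 : Measurable fun y => kern α β ρ x y * kern α β ρ z y :=
          (measurable_left hκ x).mul (measurable_left hκ z)
        rw [compKern, ← lintegral_mul_const _ hm2]
        exact lintegral_congr fun y => by ring

theorem powWeight_ne_zero (x : EuclideanSpace ℝ (Fin n)) : powWeight x ≠ 0 :=
  enorm_rpow_ne_zero _ (by have : (0 : ℝ) ≤ n := n.cast_nonneg; linarith)

theorem powWeight_ne_top {x : EuclideanSpace ℝ (Fin n)} (hx : x ≠ 0) : powWeight x ≠ ∞ := by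
  rw [powWeight, enorm_rpow_eq hx]
  exact ENNReal.ofReal_ne_top

theorem lintegral_ne_zero_of_ne_zero {X : Type*} [MeasurableSpace X] {μ : Measure X} (hμ : μ ≠ 0)
    {f : X → ℝ≥0∞} (hf : Measurable f) (h0 : ∀ x, f x ≠ 0) : ∫⁻ x, f x ∂μ ≠ 0 := by
  have : NeBot (ae μ) := ae_neBot.2 hμ
  rw [Ne, lintegral_eq_zero_iff hf]
  intro h
  obtain ⟨x, hx⟩ := h.exists
  exact h0 x hx

theorem lintegral_kern_powWeight (hn : 0 < n)
    (hbal : (n : ℝ) - ∑ k, β k - ∑ k, ρ k = (m : ℝ) * n - ∑ k, α k)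
    {x : EuclideanSpace ℝ (Fin n)} (hx : x ≠ 0) :
    ∫⁻ y, kern α β ρ x y * ∫⁻ z, kern α β ρ z y * powWeight z =
      normConst n α ρ * powWeight x := by
  rw [lintegral_kern_adjoint measurable_powWeight, lintegral_compKern_mul_powWeight_eq hn hbal hx]

theorem normConst_ne_top (hn : 0 < n) (hm : 0 < m)
    (hα : ∀ k, 0 < α k ∧ α k < n) (hβ : ∀ k, 0 < β k) (hρ : ∀ k, 0 < ρ k ∧ ρ k < n)
    (hbal : (n : ℝ) - ∑ k, β k - ∑ k, ρ k = (m : ℝ) * n - ∑ k, α k) : normConst n α ρ ≠ ∞ :=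
  ENNReal.div_ne_top (ENNReal.mul_ne_top ENNReal.ofReal_ne_top
    (lintegral_kernelH_ne_top hn hm hα hβ hρ hbal)) (surface_univ_ne_zero hn)

/-- Finiteness of SS*p at a single unit vector e forces S*p to be finite almost everywhere, since
the kernel at e never vanishes. -/
theorem kern_adjoint_powWeight_ne (hn : 0 < n) (hm : 0 < m)
    (hα : ∀ k, 0 < α k ∧ α k < n) (hβ : ∀ k, 0 < β k) (hρ : ∀ k, 0 < ρ k ∧ ρ k < n)
    (hbal : (n : ℝ) - ∑ k, β k - ∑ k, ρ k = (m : ℝ) * n - ∑ k, α k) :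
    ∀ᵐ y : Space m n, ∫⁻ z, kern α β ρ z y * powWeight z ≠ 0 ∧
      ∫⁻ z, kern α β ρ z y * powWeight z ≠ ∞ := by
  have hκ := measurable_kern (n := n) α β ρ
  have hα' : ∀ k, α k ≤ 2 * n := fun k => by have := hα k; linarith
  have hk0 := kern_ne_zero (n := n) hα' (fun k => (hβ k).le) (fun k => (hρ k).1.le)
  obtain ⟨e, he⟩ := exists_norm_eq_one hn
  have he0 : e ≠ 0 := norm_ne_zero_iff.1 (by rw [he]; exact one_ne_zero)
  have hfin : ∫⁻ y, kern α β ρ e y * ∫⁻ z, kern α β ρ z y * powWeight z ≠ ∞ := by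
    rw [lintegral_kern_powWeight hn hbal he0]
    exact ENNReal.mul_ne_top (normConst_ne_top hn hm hα hβ hρ hbal) (powWeight_ne_top he0)
  filter_upwards [ae_lt_top (measurable_left_mul hκ
    (measurable_lintegral_adjoint hκ measurable_powWeight) e) hfin] with y hy
  refine ⟨lintegral_ne_zero_of_ne_zero (NeZero.ne _) (measurable_right_mul hκ measurable_powWeight y)
    fun x => mul_ne_zero (hk0 x y) (powWeight_ne_zero x), fun h => ?_⟩
  rw [h, ENNReal.mul_top (hk0 e y)] at hy
  exact lt_irrefl _ hy

theorem lintegral_kern_sq_le (hn : 0 < n) (hm : 0 < m)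
    (hα : ∀ k, 0 < α k ∧ α k < n) (hβ : ∀ k, 0 < β k) (hρ : ∀ k, 0 < ρ k ∧ ρ k < n)
    (hbal : (n : ℝ) - ∑ k, β k - ∑ k, ρ k = (m : ℝ) * n - ∑ k, α k)
    {g : Space m n → ℝ≥0∞} (hg : Measurable g) :
    ∫⁻ x, (∫⁻ y, kern α β ρ x y * g y) ^ 2 ≤ normConst n α ρ * ∫⁻ y, g y ^ 2 := by
  refine schur_le (measurable_kern α β ρ) measurable_powWeight
    (kern_adjoint_powWeight_ne hn hm hα hβ hρ hbal) ?_ hg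
  filter_upwards [ae_ne hn 0] with x hx using lintegral_kern_powWeight hn hbal hx

theorem lintegral_kern_sq_lt (hn : 0 < n) (hm : 0 < m)
    (hα : ∀ k, 0 < α k ∧ α k < n) (hβ : ∀ k, 0 < β k) (hρ : ∀ k, 0 < ρ k ∧ ρ k < n)
    (hbal : (n : ℝ) - ∑ k, β k - ∑ k, ρ k = (m : ℝ) * n - ∑ k, α k)
    {g : Space m n → ℝ≥0∞} (hg : Measurable g) (hgi : ∫⁻ y, g y ^ 2 ≠ ∞)
    (hg0 : ¬ g =ᵐ[volume] 0) :
    ∫⁻ x, (∫⁻ y, kern α β ρ x y * g y) ^ 2 < normConst n α ρ * ∫⁻ y, g y ^ 2 := by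
  have hα' : ∀ k, α k ≤ 2 * n := fun k => by have := hα k; linarith
  refine schur_lt (measurable_kern α β ρ)
    (kern_ne_zero hα' (fun k => (hβ k).le) (fun k => (hρ k).1.le)) measurable_powWeight
    (by filter_upwards [ae_ne hn 0] with x hx using powWeight_ne_top hx)
    (lintegral_powWeight_sq hn) (kern_adjoint_powWeight_ne hn hm hα hβ hρ hbal) ?_
    (normConst_ne_top hn hm hα hβ hρ hbal) hg hgi hg0
  filter_upwards [ae_ne hn 0] with x hx using lintegral_kern_powWeight hn hbal hx

/-- The indicator function of the interval `(e^{-R}, e^R)`. -/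
def shell (R : ℝ) : ℝ → ℝ≥0∞ := (Set.Ioo (Real.exp (-R)) (Real.exp R)).indicator 1

theorem measurable_shell (R : ℝ) : Measurable (shell R) :=
  measurable_one.indicator measurableSet_Ioo

theorem shell_of_mem {R r : ℝ} (h : r ∈ Set.Ioo (Real.exp (-R)) (Real.exp R)) : shell R r = 1 :=
  Set.indicator_of_mem h 1

theorem shell_of_notMem {R r : ℝ} (h : r ∉ Set.Ioo (Real.exp (-R)) (Real.exp R)) :
    shell R r = 0 :=
  Set.indicator_of_notMem h 1

theorem shell_le_one (R r : ℝ) : shell R r ≤ 1 := Set.indicator_le_self' (by simp) r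

theorem shell_sq (R r : ℝ) : shell R r ^ 2 = shell R r := by
  by_cases h : r ∈ Set.Ioo (Real.exp (-R)) (Real.exp R) <;> simp [shell, h]

theorem lintegral_shell_exp (R : ℝ) : ∫⁻ x, shell R (Real.exp x) = ENNReal.ofReal (2 * R) := by
  have h : ∀ x, shell R (Real.exp x) = (Set.Ioo (-R) R).indicator 1 x := fun x => by
    simp [shell, Set.indicator_apply]
  simp_rw [h]
  rw [lintegral_indicator_one measurableSet_Ioo, Real.volume_Ioo]
  ring_nf

/-- Logarithmic widths add: a shell of half-width L around a point of the inner shell stays inside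
the outer one. -/
theorem shell_mul_le {L R r s : ℝ} (hr : 0 < r) :
    shell (R - L) r * shell L (s / r) ≤ shell R s := by
  by_cases h1 : r ∈ Set.Ioo (Real.exp (-(R - L))) (Real.exp (R - L))
  swap
  · simp [shell_of_notMem h1]
  by_cases h2 : s / r ∈ Set.Ioo (Real.exp (-L)) (Real.exp L)
  swap
  · simp [shell_of_notMem h2]
  have h3 : s ∈ Set.Ioo (Real.exp (-R)) (Real.exp R) := by
    have e1 : Real.exp (-R) = Real.exp (-L) * Real.exp (-(R - L)) := by
      rw [← Real.exp_add]; ring_nf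
    have e2 : Real.exp R = Real.exp L * Real.exp (R - L) := by rw [← Real.exp_add]; ring_nf
    rw [e1, e2, ← div_mul_cancel₀ s hr.ne']
    have := Real.exp_pos (-L)
    have := Real.exp_pos (-(R - L))
    exact ⟨mul_lt_mul'' h2.1 h1.1 (by positivity) (by positivity),
      mul_lt_mul'' h2.2 h1.2 (by linarith [h2.1]) hr.le⟩
  simp [shell_of_mem h1, shell_of_mem h2, shell_of_mem h3]

theorem tendsto_lintegral_compKern_shell (hn : 0 < n)
    (hbal : (n : ℝ) - ∑ k, β k - ∑ k, ρ k = (m : ℝ) * n - ∑ k, α k)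
    {e : EuclideanSpace ℝ (Fin n)} (he : ‖e‖ = 1) :
    Tendsto (fun L : ℕ => ∫⁻ w, compKern α β ρ e w * (powWeight w * shell L ‖w‖)) atTop
      (𝓝 (normConst n α ρ)) := by
  rw [← lintegral_compKern_mul_powWeight hn hbal he]
  refine lintegral_tendsto_of_tendsto_of_monotone (fun L => ?_) ?_ ?_
  · exact ((measurable_left (measurable_compKern α β ρ) e).mul (measurable_powWeight.mul
      ((measurable_shell L).comp measurable_norm))).aemeasurable
  · refine ae_of_all _ fun w L L' hL => ?_
    have hL' : (L : ℝ) ≤ L' := by exact_mod_cast hL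
    dsimp only
    gcongr
    exact Set.indicator_le_indicator_of_subset (Set.Ioo_subset_Ioo
      (Real.exp_le_exp.2 (by linarith)) (Real.exp_le_exp.2 hL')) (by simp) _
  · filter_upwards [ae_ne hn 0] with w hw
    refine tendsto_const_nhds.congr' ?_
    have hw0 := norm_pos_iff.2 hw
    filter_upwards [tendsto_natCast_atTop_atTop.eventually (eventually_gt_atTop |Real.log ‖w‖|)]
      with L hL
    rw [abs_lt] at hL
    rw [shell_of_mem ⟨(Real.lt_log_iff_exp_lt hw0).1 hL.1, (Real.log_lt_iff_lt_exp hw0).1 hL.2⟩,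
      mul_one]

/-- The norm of the operator with kernel `kern` is not smaller than given by `normConst`. -/
theorem exists_lintegral_kern_sq_gt (hn : 0 < n) (hN : normConst n α ρ ≠ ∞)
    (hbal : (n : ℝ) - ∑ k, β k - ∑ k, ρ k = (m : ℝ) * n - ∑ k, α k) {A : ℝ≥0∞}
    (hA : A < normConst n α ρ) : ∃ g : Space m n → ℝ≥0∞, Measurable g ∧ ∫⁻ y, g y ^ 2 ≠ ∞ ∧
      A * ∫⁻ y, g y ^ 2 < ∫⁻ x, (∫⁻ y, kern α β ρ x y * g y) ^ 2 := by
  have hκ := measurable_kern (n := n) α β ρ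
  obtain ⟨e, he⟩ := exists_norm_eq_one hn
  obtain ⟨L, hL⟩ := ((tendsto_lintegral_compKern_shell hn hbal he).eventually_const_lt hA).exists
  set B := ∫⁻ w, compKern α β ρ e w * (powWeight w * shell L ‖w‖) with hB
  have hBN : B ≤ normConst n α ρ := by
    rw [← lintegral_compKern_mul_powWeight hn hbal he]
    refine lintegral_mono fun w => ?_
    gcongr
    exact mul_le_of_le_one_right' (shell_le_one _ _)
  have hBt : B ≠ ∞ := ne_top_of_le_ne_top hN hBN
  have hAt : A ≠ ∞ := hL.ne_top
  have hab : A.toReal < B.toReal := (ENNReal.toReal_lt_toReal hAt hBt).2 hL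
  have ha0 : 0 ≤ A.toReal := ENNReal.toReal_nonneg
  -- The outer shell has to be so long that the loss L at each end is negligible: A R < B (R - L)
  -- holds once R exceeds B L / (B - A).
  obtain ⟨R, hR0, hR⟩ : ∃ R : ℝ, L < R ∧ A.toReal * (2 * R) < B.toReal * (2 * (R - L)) := by
    refine ⟨(B.toReal * L + 1) / (B.toReal - A.toReal) + L, ?_, ?_⟩
    · have : 0 < (B.toReal * L + 1) / (B.toReal - A.toReal) :=
        div_pos (by have := ha0.trans hab.le; positivity) (by linarith)
      linarith
    · have : (B.toReal * L + 1) / (B.toReal - A.toReal) * (B.toReal - A.toReal) =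
        B.toReal * L + 1 := div_mul_cancel₀ _ (by linarith)
      have h2 : A.toReal * L ≤ B.toReal * L := by gcongr
      nlinarith
  set σ := surface n Set.univ
  have hσ0 : σ ≠ 0 := surface_univ_ne_zero hn
  have hσt : σ ≠ ∞ := measure_ne_top _ _
  set h : EuclideanSpace ℝ (Fin n) → ℝ≥0∞ := fun w => powWeight w * shell R ‖w‖ with hh_def
  have hh : Measurable h := measurable_powWeight.mul ((measurable_shell R).comp measurable_norm)
  have hshell : ∀ r : ℝ, ∫⁻ w : EuclideanSpace ℝ (Fin n), powWeight w ^ 2 * shell r ‖w‖ =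
      ENNReal.ofReal (2 * r) * σ := fun r => by
    rw [lintegral_powWeight_sq_mul hn (measurable_shell r), lintegral_shell_exp]
  have hh2 : ∫⁻ w, h w ^ 2 = ENNReal.ofReal (2 * R) * σ := by
    simp only [hh_def, mul_pow, shell_sq, hshell]
  have hg := measurable_lintegral_adjoint (μ := volume) hκ hh
  have hgeq := lintegral_sq_adjoint_eq (μ := volume) (ν := volume) hκ hh
  simp only [lintegral_kern_adjoint hh] at hgeq
  -- On the inner shell, SS*h ≥ B p because each point there sees a full shell of half-width L
  -- inside the support of h.
  have hlow : B * (ENNReal.ofReal (2 * (R - L)) * σ) ≤ ∫⁻ y, (∫⁻ x, kern α β ρ x y * h x) ^ 2 := by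
    rw [hgeq, ← hshell, ← lintegral_const_mul' _ _ hBt]
    refine lintegral_mono_ae ?_
    filter_upwards [ae_ne hn 0] with x hx
    have hx0 := norm_pos_iff.2 hx
    have hle : B * powWeight x * shell (R - L) ‖x‖ ≤ ∫⁻ z, compKern α β ρ x z * h z := by
      rw [hB, ← lintegral_compKern_eq hbal (shell L) (measurable_shell L) he hx, mul_comm,
        ← lintegral_const_mul' _ _ (ne_top_of_le_ne_top ENNReal.one_ne_top (shell_le_one _ _))]
      refine lintegral_mono fun w => ?_
      calc _ = compKern α β ρ x w *
            (powWeight w * (shell (R - L) ‖x‖ * shell L (‖w‖ / ‖x‖))) := by ring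
        _ ≤ _ := by
            simp only [hh_def]
            gcongr
            exact shell_mul_le hx0
    by_cases hs : ‖x‖ ∈ Set.Ioo (Real.exp (-(R - L))) (Real.exp (R - L))
    swap
    · simp [shell_of_notMem hs]
    have e1 : shell (R - L) ‖x‖ = 1 := shell_of_mem hs
    have hs' : ‖x‖ ∈ Set.Ioo (Real.exp (-R)) (Real.exp R) :=
      Set.Ioo_subset_Ioo (Real.exp_le_exp.2 (by have := (Nat.cast_nonneg L : (0 : ℝ) ≤ L); linarith))
        (Real.exp_le_exp.2 (by have := (Nat.cast_nonneg L : (0 : ℝ) ≤ L); linarith)) hs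
    have e2 : h x = powWeight x := by simp [hh_def, shell_of_mem hs']
    rw [e1, mul_one] at hle
    rw [e1, e2, mul_one, sq, ← mul_assoc]
    gcongr
  have hup : ∫⁻ y, (∫⁻ x, kern α β ρ x y * h x) ^ 2 ≠ ∞ := by
    refine ne_top_of_le_ne_top (b := normConst n α ρ * (ENNReal.ofReal (2 * R) * σ))
      (ENNReal.mul_ne_top hN (ENNReal.mul_ne_top ENNReal.ofReal_ne_top hσt)) ?_
    rw [hgeq, ← hshell, ← lintegral_const_mul' _ _ hN]
    refine lintegral_mono_ae ?_
    filter_upwards [ae_ne hn 0] with x hx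
    have : ∫⁻ z, compKern α β ρ x z * h z ≤ normConst n α ρ * powWeight x := by
      rw [← lintegral_compKern_mul_powWeight_eq hn hbal hx]
      refine lintegral_mono fun z => ?_
      gcongr
      exact mul_le_of_le_one_right' (shell_le_one _ _)
    refine (mul_le_mul_left this _).trans_eq ?_
    simp only [hh_def]
    ring
  have hgt : A * ∫⁻ w, h w ^ 2 < ∫⁻ y, (∫⁻ x, kern α β ρ x y * h x) ^ 2 := by
    refine lt_of_lt_of_le ?_ hlow
    rw [hh2, ← mul_assoc, ← mul_assoc]
    refine ENNReal.mul_lt_mul_left hσ0 hσt ?_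
    rw [← ENNReal.ofReal_toReal hAt, ← ENNReal.ofReal_toReal hBt,
      ← ENNReal.ofReal_mul ha0, ← ENNReal.ofReal_mul (ha0.trans hab.le)]
    refine (ENNReal.ofReal_lt_ofReal_iff_of_nonneg ?_).2 hR
    have : (0 : ℝ) ≤ L := L.cast_nonneg
    have : 0 ≤ R := by linarith
    positivity
  refine ⟨_, hg, hup, ?_⟩
  -- With g = S*h, the bound ‖Sg‖² ≤ A‖g‖² and ‖g‖⁴ ≤ ‖Sg‖²‖h‖² would give ‖g‖² ≤ A‖h‖².
  by_contra! hcon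
  have h1 := (sq_lintegral_adjoint_le (μ := volume) (ν := volume) hκ hh).trans
    (mul_le_mul_left hcon _)
  rw [sq, mul_comm A, mul_assoc] at h1
  have h0 : ∫⁻ y, (∫⁻ x, kern α β ρ x y * h x) ^ 2 ≠ 0 := (zero_le.trans_lt hgt).ne'
  rw [ENNReal.mul_le_mul_iff_right h0 hup] at h1
  exact absurd hgt (not_lt.2 h1)

end KernelOperator

/-! ### The inequality, its sharpness and the absence of extremals. -/

section Inequality

/-- The conditions on the exponents of the inequality. -/
structure Admissible {m : ℕ} (n : ℕ) (α β ρ : Fin m → ℝ) : Prop where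
  hn : 0 < n
  hm : 0 < m
  hα : ∀ k, 0 < α k ∧ α k < n
  hβ : ∀ k, 0 < β k
  hρ : ∀ k, 0 < ρ k ∧ ρ k < n
  hbal : (n : ℝ) - ∑ k, β k - ∑ k, ρ k = (m : ℝ) * n - ∑ k, α k

theorem eLpNorm_two_sq {X ε : Type*} [MeasurableSpace X] [ENorm ε] (μ : Measure X)
    (f : X → ε) : eLpNorm f 2 μ ^ 2 = ∫⁻ x, ‖f x‖ₑ ^ 2 ∂μ := by
  have h := eLpNorm_nnreal_pow_eq_lintegral (μ := μ) (f := f) (p := 2) two_ne_zero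
  simpa using h

theorem integral_norm_sq_eq {X : Type*} [MeasurableSpace X] {μ : Measure X} {f : X → ℂ}
    (hf : AEStronglyMeasurable f μ) : ∫ x, ‖f x‖ ^ 2 ∂μ = (eLpNorm f 2 μ ^ 2).toReal := by
  have h2 : AEStronglyMeasurable (fun x => ‖f x‖ ^ 2) μ := hf.norm.pow 2
  rw [eLpNorm_two_sq, integral_eq_lintegral_of_nonneg_ae (ae_of_all _ fun x => by positivity) h2]
  simp only [ENNReal.ofReal_pow (norm_nonneg _), ofReal_norm]

theorem le_of_forall_le_add_mul {a b K : ℝ≥0∞} (hK : K ≠ ∞)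
    (h : ∀ ε : ℝ≥0∞, 0 < ε → a ≤ b + K * ε) : a ≤ b := by
  have h1 : Tendsto (fun ε : ℝ≥0∞ => b + K * ε) (𝓝[>] 0) (𝓝 (b + K * 0)) :=
    (Tendsto.const_add b (ENNReal.Tendsto.const_mul tendsto_id (Or.inr hK))).mono_left
      nhdsWithin_le_nhds
  rw [mul_zero, add_zero] at h1
  exact ge_of_tendsto h1 (eventually_nhdsWithin_of_forall fun ε hε => h ε hε)

variable {m n : ℕ} {α β ρ : Fin m → ℝ}

theorem measurable_iterated (α β ρ : Fin m → ℝ) (f : 𝓢(Space m n, ℂ)) :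
    Measurable (iterated α β ρ f) :=
  (Complex.measurable_ofReal.comp (measurable_weight ρ)).mul (Lp.stronglyMeasurable _).measurable

/-- The positive integral operator that bounds the restriction to the diagonal. -/
def kernOp (α β ρ : Fin m → ℝ) (g : Space m n → ℝ≥0∞) (x : EuclideanSpace ℝ (Fin n)) : ℝ≥0∞ :=
  ENNReal.ofReal (rieszConst n α) * ∫⁻ y, kern α β ρ x y * g y

theorem kernOp_congr {g h : Space m n → ℝ≥0∞} (hgh : g =ᵐ[volume] h) :
    kernOp α β ρ g = kernOp α β ρ h := by
  ext x
  rw [kernOp, kernOp]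
  congr 1
  refine lintegral_congr_ae ?_
  filter_upwards [hgh] with y hy
  rw [hy]

theorem measurable_kernOp {g : Space m n → ℝ≥0∞} (hg : AEMeasurable g) :
    Measurable (kernOp α β ρ g) := by
  rw [kernOp_congr hg.ae_eq_mk]
  exact (((measurable_kern α β ρ).mul
    (hg.measurable_mk.comp measurable_snd)).lintegral_prod_right').const_mul _

theorem kernOp_le_add {g h k : Space m n → ℝ≥0∞} (hh : AEMeasurable h) (hg : ∀ y, g y ≤ h y + k y)
    (x : EuclideanSpace ℝ (Fin n)) :
    kernOp α β ρ g x ≤ kernOp α β ρ h x + kernOp α β ρ k x := by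
  have hm : AEMeasurable fun y => kern α β ρ x y * h y :=
    (measurable_left (measurable_kern α β ρ) x).aemeasurable.mul hh
  rw [kernOp, kernOp, kernOp, ← mul_add, ← lintegral_add_left' hm]
  gcongr with y
  rw [← mul_add]
  gcongr
  exact hg y

theorem ofReal_sharpConst (h : Admissible n α β ρ) :
    ENNReal.ofReal (sharpConst n α ρ) = ENNReal.ofReal (rieszConst n α) ^ 2 * normConst n α ρ := by
  have hc := rieszConst_pos h.hα
  rw [sharpConst_eq, ENNReal.ofReal_mul (by positivity), ENNReal.ofReal_pow hc.le,
    ENNReal.ofReal_toReal (normConst_ne_top h.hn h.hm h.hα h.hβ h.hρ h.hbal)]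

theorem lintegral_kernOp_sq (g : Space m n → ℝ≥0∞) : ∫⁻ x, kernOp α β ρ g x ^ 2 =
    ENNReal.ofReal (rieszConst n α) ^ 2 * ∫⁻ x, (∫⁻ y, kern α β ρ x y * g y) ^ 2 := by
  rw [← lintegral_const_mul' _ _ (by finiteness)]
  simp only [kernOp, mul_pow]

theorem lintegral_kernOp_sq_le (h : Admissible n α β ρ) {g : Space m n → ℝ≥0∞}
    (hg : AEMeasurable g) :
    ∫⁻ x, kernOp α β ρ g x ^ 2 ≤ ENNReal.ofReal (sharpConst n α ρ) * ∫⁻ y, g y ^ 2 := by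
  have e : ∫⁻ y, g y ^ 2 = ∫⁻ y, hg.mk g y ^ 2 := lintegral_congr_ae (hg.ae_eq_mk.pow_const 2)
  rw [kernOp_congr hg.ae_eq_mk, e, lintegral_kernOp_sq, ofReal_sharpConst h, mul_assoc]
  gcongr
  exact lintegral_kern_sq_le h.hn h.hm h.hα h.hβ h.hρ h.hbal hg.measurable_mk

theorem lintegral_kernOp_sq_lt (h : Admissible n α β ρ) {g : Space m n → ℝ≥0∞}
    (hg : AEMeasurable g) (hgi : ∫⁻ y, g y ^ 2 ≠ ∞) (hg0 : ¬ g =ᵐ[volume] 0) :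
    ∫⁻ x, kernOp α β ρ g x ^ 2 < ENNReal.ofReal (sharpConst n α ρ) * ∫⁻ y, g y ^ 2 := by
  have e : ∫⁻ y, g y ^ 2 = ∫⁻ y, hg.mk g y ^ 2 := lintegral_congr_ae (hg.ae_eq_mk.pow_const 2)
  rw [e] at hgi ⊢
  have hc := rieszConst_pos h.hα
  rw [kernOp_congr hg.ae_eq_mk, lintegral_kernOp_sq, ofReal_sharpConst h, mul_assoc]
  exact ENNReal.mul_lt_mul_right (by simpa using hc) (by finiteness)
    (lintegral_kern_sq_lt h.hn h.hm h.hα h.hβ h.hρ h.hbal hg.measurable_mk hgi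
      fun h0 => hg0 (hg.ae_eq_mk.trans h0))

theorem eLpNorm_kernOp_le (h : Admissible n α β ρ) {g : Space m n → ℝ≥0∞}
    (hg : AEMeasurable g) : eLpNorm (kernOp α β ρ g) 2 volume ≤
      ENNReal.ofReal (sharpConst n α ρ) ^ (1 / 2 : ℝ) * eLpNorm g 2 volume := by
  rw [← ENNReal.pow_le_pow_left_iff two_ne_zero, mul_pow, eLpNorm_two_sq, eLpNorm_two_sq,
    ← ENNReal.rpow_natCast, ← ENNReal.rpow_mul]
  simpa using lintegral_kernOp_sq_le h hg

/-- Only an inequality: where the kernel is infinite, its real value is 0 by convention. -/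
theorem enorm_kern_mul_le (x : EuclideanSpace ℝ (Fin n)) (y : Space m n) (z : ℂ) :
    ‖((kern α β ρ x y).toReal : ℂ) * z‖ₑ ≤ kern α β ρ x y * ‖z‖ₑ := by
  rw [enorm_mul, ← ofReal_norm ((kern α β ρ x y).toReal : ℂ), Complex.norm_real,
    Real.norm_of_nonneg ENNReal.toReal_nonneg]
  gcongr
  exact ENNReal.ofReal_toReal_le

theorem enorm_rieszConst_mul (h : Admissible n α β ρ) (z : ℂ) :
    ‖(rieszConst n α : ℂ) * z‖ₑ = ENNReal.ofReal (rieszConst n α) * ‖z‖ₑ := by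
  rw [enorm_mul, ← ofReal_norm (rieszConst n α : ℂ), Complex.norm_real,
    Real.norm_of_nonneg (rieszConst_pos h.hα).le]

theorem enorm_diag_le (h : Admissible n α β ρ) (f : 𝓢(Space m n, ℂ))
    {x : EuclideanSpace ℝ (Fin n)} (hx : x ≠ 0) :
    ‖f (diag m x)‖ₑ ≤ kernOp α β ρ (fun y => ‖iterated α β ρ f y‖ₑ) x := by
  rw [(diag_representation h.hn ρ h.hα h.hβ f hx).2, enorm_rieszConst_mul h, kernOp]
  gcongr
  exact (enorm_integral_le_lintegral_enorm _).trans
    (lintegral_mono fun y => enorm_kern_mul_le x y _)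

/-- A reverse of `enorm_diag_le`: for nonnegative g close to Tf no cancellation is lost, since the
integral of the kernel against g equals its own absolute value. -/
theorem kernOp_le_enorm_diag_add (h : Admissible n α β ρ) (f : 𝓢(Space m n, ℂ))
    {g : Space m n → ℝ≥0∞} (hg : Measurable g) (hgt : ∀ᵐ y, g y ≠ ∞)
    {x : EuclideanSpace ℝ (Fin n)} (hx : x ≠ 0) :
    kernOp α β ρ g x ≤ ‖f (diag m x)‖ₑ +
      kernOp α β ρ (fun y => ‖iterated α β ρ f y - ((g y).toReal : ℂ)‖ₑ) x := by
  have hκ := measurable_left (measurable_kern (n := n) α β ρ) x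
  have hκt : ∀ᵐ y, kern α β ρ x y ≠ ∞ := by
    filter_upwards [ae_kern_eq h.hn α β ρ hx] with y hy
    rw [hy]
    exact ENNReal.ofReal_ne_top
  obtain ⟨hi, hf⟩ := diag_representation h.hn ρ h.hα h.hβ f hx
  rw [hf, enorm_rieszConst_mul h, kernOp, kernOp, ← mul_add]
  gcongr
  set E := ∫⁻ y, kern α β ρ x y * ‖iterated α β ρ f y - ((g y).toReal : ℂ)‖ₑ
  by_cases hE : E = ∞
  · rw [hE, add_top]
    exact le_top
  have hd : Integrable fun y =>
      ((kern α β ρ x y).toReal : ℂ) * (iterated α β ρ f y - ((g y).toReal : ℂ)) :=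
    ⟨(((Complex.measurable_ofReal.comp hκ.ennreal_toReal).mul ((measurable_iterated α β ρ f).sub
      (Complex.measurable_ofReal.comp hg.ennreal_toReal))).aestronglyMeasurable),
      (lintegral_mono fun y => enorm_kern_mul_le x y _).trans_lt (lt_top_iff_ne_top.2 hE)⟩
  -- Integrability of the kernel against g is not assumed; it follows from that against Tf and
  -- against the difference, the case of an infinite error being trivial.
  have hgi := hi.sub hd
  have hge : ∫⁻ y, kern α β ρ x y * g y =
      ‖∫ y, ((kern α β ρ x y).toReal : ℂ) * ((g y).toReal : ℂ)‖ₑ := by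
    have hri : Integrable fun y => (kern α β ρ x y).toReal * (g y).toReal := by
      have hc : Integrable fun y => (((kern α β ρ x y).toReal * (g y).toReal : ℝ) : ℂ) := by
        refine hgi.congr (ae_of_all _ fun y => ?_)
        simp only [Pi.sub_apply]
        push_cast
        ring
      exact hc.re
    simp only [← Complex.ofReal_mul]
    rw [integral_complex_ofReal, ← ofReal_norm, Complex.norm_real, Real.norm_of_nonneg
      (integral_nonneg fun y => mul_nonneg ENNReal.toReal_nonneg ENNReal.toReal_nonneg),
      ofReal_integral_eq_lintegral_ofReal hri
      (ae_of_all _ fun y => mul_nonneg ENNReal.toReal_nonneg ENNReal.toReal_nonneg)]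
    refine lintegral_congr_ae ?_
    filter_upwards [hκt, hgt] with y h1 h2
    rw [ENNReal.ofReal_mul ENNReal.toReal_nonneg, ENNReal.ofReal_toReal h1, ENNReal.ofReal_toReal h2]
  have hsub : ∫ y, ((kern α β ρ x y).toReal : ℂ) * ((g y).toReal : ℂ) =
      (∫ y, ((kern α β ρ x y).toReal : ℂ) * iterated α β ρ f y) -
      ∫ y, ((kern α β ρ x y).toReal : ℂ) * (iterated α β ρ f y - ((g y).toReal : ℂ)) := by
    rw [← integral_sub hi hd]
    exact integral_congr_ae (ae_of_all _ fun y => by ring)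
  rw [hge, hsub]
  refine enorm_sub_le.trans ?_
  gcongr
  exact (enorm_integral_le_lintegral_enorm _).trans
    (lintegral_mono fun y => enorm_kern_mul_le x y _)

theorem continuous_diag (m n : ℕ) : Continuous (diag m : EuclideanSpace ℝ (Fin n) → Space m n) :=
  (PiLp.continuous_toLp 2 _).comp (continuous_pi fun _ => continuous_id)

theorem aestronglyMeasurable_comp_diag (f : 𝓢(Space m n, ℂ)) :
    AEStronglyMeasurable fun x : EuclideanSpace ℝ (Fin n) => f (diag m x) :=
  (f.continuous.comp (continuous_diag m n)).aestronglyMeasurable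

theorem eLpNorm_diag_le_kernOp (h : Admissible n α β ρ) (f : 𝓢(Space m n, ℂ)) :
    eLpNorm (fun x : EuclideanSpace ℝ (Fin n) => f (diag m x)) 2 volume ≤
      eLpNorm (kernOp α β ρ fun y => ‖iterated α β ρ f y‖ₑ) 2 volume := by
  refine eLpNorm_mono_enorm_ae ?_
  filter_upwards [ae_ne h.hn 0] with x hx using enorm_diag_le h f hx

theorem memLp_iterated (h : Admissible n α β ρ) (f : 𝓢(Space m n, ℂ)) :
    MemLp (iterated α β ρ f) 2 :=
  (memLp_iterated_and_tendsto h.hn h.hα (fun k => (h.hβ k).le)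
    (fun k => ⟨(h.hρ k).1.le, (h.hρ k).2⟩) f).1

theorem aemeasurable_enorm_iterated (f : 𝓢(Space m n, ℂ)) :
    AEMeasurable fun y => ‖iterated α β ρ f y‖ₑ :=
  (measurable_iterated α β ρ f).enorm.aemeasurable

theorem eLpNorm_diag_sq_le (h : Admissible n α β ρ) (f : 𝓢(Space m n, ℂ)) :
    eLpNorm (fun x : EuclideanSpace ℝ (Fin n) => f (diag m x)) 2 volume ^ 2 ≤
      ENNReal.ofReal (sharpConst n α ρ) * eLpNorm (iterated α β ρ f) 2 volume ^ 2 := by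
  refine (pow_le_pow_left' (eLpNorm_diag_le_kernOp h f) 2).trans ?_
  rw [eLpNorm_two_sq, eLpNorm_two_sq]
  exact lintegral_kernOp_sq_le h (aemeasurable_enorm_iterated f)

theorem memLp_comp_diag (h : Admissible n α β ρ) (f : 𝓢(Space m n, ℂ)) :
    MemLp (fun x : EuclideanSpace ℝ (Fin n) => f (diag m x)) 2 := by
  refine ⟨aestronglyMeasurable_comp_diag f, lt_top_iff_ne_top.2 fun ht => ?_⟩
  have h1 := eLpNorm_diag_sq_le h f
  rw [ht, ENNReal.top_pow two_ne_zero, top_le_iff] at h1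
  exact ENNReal.mul_ne_top ENNReal.ofReal_ne_top (ENNReal.pow_ne_top (memLp_iterated h f).2.ne) h1

theorem sharpConst_pos (h : Admissible n α β ρ) : 0 < sharpConst n α ρ := by
  have hα' : ∀ k, α k ≤ 2 * n := fun k => by have := h.hα k; linarith
  have hk0 := kern_ne_zero (n := n) hα' (fun k => (h.hβ k).le) (fun k => (h.hρ k).1.le)
  have hκ := measurable_kern (n := n) α β ρ
  obtain ⟨e, he⟩ := exists_norm_eq_one h.hn
  have hN : normConst n α ρ ≠ 0 := by
    have : Nonempty (Fin n) := ⟨⟨0, h.hn⟩⟩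
    rw [← lintegral_compKern_mul_powWeight h.hn h.hbal he]
    refine lintegral_ne_zero_of_ne_zero (NeZero.ne _)
      ((measurable_left (measurable_compKern α β ρ) e).mul measurable_powWeight)
      fun w => mul_ne_zero ?_ (powWeight_ne_zero w)
    exact lintegral_ne_zero_of_ne_zero (NeZero.ne _)
      ((measurable_left hκ e).mul (measurable_left hκ w)) fun y => mul_ne_zero (hk0 e y) (hk0 w y)
  have := rieszConst_pos h.hα
  have := ENNReal.toReal_pos hN (normConst_ne_top h.hn h.hm h.hα h.hβ h.hρ h.hbal)
  rw [sharpConst_eq]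
  positivity

theorem integral_diag_le (h : Admissible n α β ρ) (f : 𝓢(Space m n, ℂ)) :
    ∫ x : EuclideanSpace ℝ (Fin n), ‖f (diag m x)‖ ^ 2 ≤
      sharpConst n α ρ * ∫ x, ‖iterated α β ρ f x‖ ^ 2 := by
  rw [integral_norm_sq_eq (aestronglyMeasurable_comp_diag f),
    integral_norm_sq_eq (memLp_iterated h f).1, ← ENNReal.toReal_ofReal (sharpConst_pos h).le,
    ← ENNReal.toReal_mul]
  exact ENNReal.toReal_mono (ENNReal.mul_ne_top ENNReal.ofReal_ne_top
    (ENNReal.pow_ne_top (memLp_iterated h f).2.ne)) (eLpNorm_diag_sq_le h f)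

theorem weight_ne_zero (s : Fin m → ℝ) {x : Space m n} (hx : ∀ k, x k ≠ 0) : weight s x ≠ 0 :=
  Finset.prod_ne_zero_iff.2 fun k _ => (Real.rpow_pos_of_pos (norm_pos_iff.2 (hx k)) _).ne'

theorem ae_eq_zero_of_weighted (hn : 0 < n) {s : Fin m → ℝ} {u : Space m n → ℂ}
    (h : ∀ᵐ x, weighted s u x = 0) : u =ᵐ[volume] 0 := by
  filter_upwards [h, ae_block_ne_zero m hn] with x hx h0
  exact (mul_eq_zero.1 hx).resolve_left (Complex.ofReal_ne_zero.2 (weight_ne_zero s h0))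

/-- T is injective: the weights and the multiplier vanish only on null sets, and the Fourier
transform is inverted between them. -/
theorem eq_zero_of_iterated (h : Admissible n α β ρ) {f : 𝓢(Space m n, ℂ)}
    (h0 : iterated α β ρ f =ᵐ[volume] 0) : f = 0 := by
  have h1 : (fracLap α (weighted β f) : Space m n → ℂ) =ᵐ[volume] 0 :=
    ae_eq_zero_of_weighted h.hn h0
  have h2 : 𝓕 (fracLap α (weighted β f) : Space m n → ℂ) = 0 := by
    ext ξ
    rw [Real.fourier_eq]
    refine integral_eq_zero_of_ae ?_
    filter_upwards [h1] with x hx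
    simp [hx]
  have h3 := fourier_fracLap_ae h.hn h.hα (fun k => (h.hβ k).le) f
  rw [h2] at h3
  have h4 : 𝓕 (weighted β f) =ᵐ[volume] 0 := ae_eq_zero_of_weighted h.hn h3.symm
  have h5 : ∀ X, weighted β f X = 0 := fun X => by
    rw [weighted_eq_integral_fourier h.hn h.hβ f X]
    refine integral_eq_zero_of_ae ?_
    filter_upwards [h4] with x hx
    simp [hx]
  have h6 : (f : Space m n → ℂ) =ᵐ[volume] 0 := ae_eq_zero_of_weighted h.hn (ae_of_all _ h5)
  have h7 := (f.continuous.ae_eq_iff_eq volume continuous_zero).1 h6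
  exact DFunLike.coe_injective h7

theorem integral_diag_lt (h : Admissible n α β ρ) {f : 𝓢(Space m n, ℂ)} (hf : f ≠ 0) :
    ∫ x : EuclideanSpace ℝ (Fin n), ‖f (diag m x)‖ ^ 2 <
      sharpConst n α ρ * ∫ x, ‖iterated α β ρ f x‖ ^ 2 := by
  have ht : eLpNorm (iterated α β ρ f) 2 volume ^ 2 ≠ ∞ :=
    ENNReal.pow_ne_top (memLp_iterated h f).2.ne
  rw [integral_norm_sq_eq (aestronglyMeasurable_comp_diag f),
    integral_norm_sq_eq (memLp_iterated h f).1, ← ENNReal.toReal_ofReal (sharpConst_pos h).le,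
    ← ENNReal.toReal_mul]
  refine ENNReal.toReal_strict_mono (ENNReal.mul_ne_top ENNReal.ofReal_ne_top ht)
    ((pow_le_pow_left' (eLpNorm_diag_le_kernOp h f) 2).trans_lt ?_)
  rw [eLpNorm_two_sq] at ht ⊢
  rw [eLpNorm_two_sq]
  refine lintegral_kernOp_sq_lt h (aemeasurable_enorm_iterated f) ht fun h0 =>
    hf (eq_zero_of_iterated h ?_)
  filter_upwards [h0] with y hy
  exact enorm_eq_zero.1 hy

theorem sharpConst_le (h : Admissible n α β ρ) {A : ℝ} (hA : ∀ f : 𝓢(Space m n, ℂ),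
    ∫ x : EuclideanSpace ℝ (Fin n), ‖f (diag m x)‖ ^ 2 ≤ A * ∫ x, ‖iterated α β ρ f x‖ ^ 2) :
    sharpConst n α ρ ≤ A := by
  by_contra! hlt
  -- A negative A becomes 0, which is harmless because the sharp constant is positive.
  set a : ℝ≥0∞ := ENNReal.ofReal A with ha
  have hA' : ∀ f : 𝓢(Space m n, ℂ),
      eLpNorm (fun x : EuclideanSpace ℝ (Fin n) => f (diag m x)) 2 volume ≤
        a ^ (1 / 2 : ℝ) * eLpNorm (iterated α β ρ f) 2 volume := fun f => by
    rw [← ENNReal.pow_le_pow_left_iff two_ne_zero, mul_pow, ← ENNReal.rpow_natCast (a ^ _),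
      ← ENNReal.rpow_mul]
    have h1 := hA f
    have ht : eLpNorm (iterated α β ρ f) 2 volume ^ 2 ≠ ∞ :=
      ENNReal.pow_ne_top (memLp_iterated h f).2.ne
    have ht' : eLpNorm (fun x : EuclideanSpace ℝ (Fin n) => f (diag m x)) 2 volume ^ 2 ≠ ∞ :=
      ENNReal.pow_ne_top (memLp_comp_diag h f).2.ne
    rw [integral_norm_sq_eq (aestronglyMeasurable_comp_diag f),
      integral_norm_sq_eq (memLp_iterated h f).1] at h1
    have h2 := ENNReal.ofReal_le_ofReal h1
    rw [ENNReal.ofReal_toReal ht', ENNReal.ofReal_mul' ENNReal.toReal_nonneg,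
      ENNReal.ofReal_toReal ht] at h2
    simpa using h2
  have hlt' : a < ENNReal.ofReal (sharpConst n α ρ) :=
    (ENNReal.ofReal_lt_ofReal_iff (sharpConst_pos h)).2 hlt
  set c : ℝ≥0∞ := ENNReal.ofReal (rieszConst n α) ^ 2 with hc
  have hc0 : c ≠ 0 := by simpa [hc] using rieszConst_pos h.hα
  have hct : c ≠ ∞ := by finiteness
  have hN := normConst_ne_top h.hn h.hm h.hα h.hβ h.hρ h.hbal
  rw [ofReal_sharpConst h, mul_comm] at hlt'
  obtain ⟨g, hg, hgi, hgt⟩ := exists_lintegral_kern_sq_gt h.hn hN h.hbal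
    (ENNReal.div_lt_of_lt_mul hlt')
  have hfin : ∀ᵐ y, g y ≠ ∞ := by
    filter_upwards [ae_lt_top (hg.pow_const 2) hgi] with y hy hy2
    simp [hy2] at hy
  have hgc : ∀ᵐ y, ‖((g y).toReal : ℂ)‖ₑ = ‖g y‖ₑ := by
    filter_upwards [hfin] with y hy
    rw [← ofReal_norm, Complex.norm_real, Real.norm_of_nonneg ENNReal.toReal_nonneg,
      ENNReal.ofReal_toReal hy, enorm_eq_self]
  have hnorm : eLpNorm (fun y => ((g y).toReal : ℂ)) 2 volume = eLpNorm g 2 volume :=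
    le_antisymm (eLpNorm_mono_enorm_ae (hgc.mono fun _ h => h.le))
      (eLpNorm_mono_enorm_ae (hgc.mono fun _ h => h.ge))
  have hgm : Measurable fun y => ((g y).toReal : ℂ) :=
    Complex.measurable_ofReal.comp hg.ennreal_toReal
  have hmem : MemLp (fun y => ((g y).toReal : ℂ)) 2 := by
    refine ⟨hgm.aestronglyMeasurable, ?_⟩
    rw [hnorm, lt_top_iff_ne_top]
    intro htop
    have h1 := eLpNorm_two_sq volume g
    rw [htop, ENNReal.top_pow two_ne_zero] at h1
    exact hgi h1.symm
  set s := ENNReal.ofReal (sharpConst n α ρ) ^ (1 / 2 : ℝ) with hs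
  have key : eLpNorm (kernOp α β ρ g) 2 volume ≤ a ^ (1 / 2 : ℝ) * eLpNorm g 2 volume := by
    -- The near-optimal g is nonnegative but need not be some Tf. It is approximated within ε by
    -- some Tf, at the cost of √a ε in the norm of Tf and s ε in the operator bound.
    refine le_of_forall_le_add_mul (K := a ^ (1 / 2 : ℝ) + s) (by finiteness) fun ε hε => ?_
    obtain ⟨f, hf⟩ := approx_of_memLp (β := β) h.hn h.hα (fun k => ⟨(h.hρ k).1.le, (h.hρ k).2⟩)
      hmem ε hε
    have hd := (measurable_iterated α β ρ f).sub hgm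
    have e1 : eLpNorm (kernOp α β ρ g) 2 volume ≤
        eLpNorm (fun x : EuclideanSpace ℝ (Fin n) => f (diag m x)) 2 volume + s * ε := by
      calc eLpNorm (kernOp α β ρ g) 2 volume
          ≤ eLpNorm ((fun x : EuclideanSpace ℝ (Fin n) => ‖f (diag m x)‖ₑ) +
            kernOp α β ρ fun y => ‖iterated α β ρ f y - ((g y).toReal : ℂ)‖ₑ) 2 volume := by
            refine eLpNorm_mono_enorm_ae ?_
            filter_upwards [ae_ne h.hn 0] with x hx using kernOp_le_enorm_diag_add h f hg hfin hx
        _ ≤ _ := eLpNorm_add_le (aestronglyMeasurable_comp_diag f).enorm.aestronglyMeasurable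
            (measurable_kernOp hd.enorm.aemeasurable).aestronglyMeasurable (by norm_num)
        _ ≤ _ := by
            gcongr
            · exact eLpNorm_mono_enorm fun x => le_rfl
            · refine (eLpNorm_kernOp_le h hd.enorm.aemeasurable).trans ?_
              gcongr
              exact (eLpNorm_mono_enorm fun x => le_rfl).trans hf.le
    have e2 : eLpNorm (iterated α β ρ f) 2 volume ≤ eLpNorm g 2 volume + ε := by
      rw [← hnorm]
      calc eLpNorm (iterated α β ρ f) 2 volume
          = eLpNorm ((fun y => ((g y).toReal : ℂ)) +
            (iterated α β ρ f - fun y => ((g y).toReal : ℂ))) 2 volume := by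
            rw [add_sub_cancel]
        _ ≤ _ := eLpNorm_add_le hgm.aestronglyMeasurable hd.aestronglyMeasurable (by norm_num)
        _ ≤ _ := by gcongr
    calc _ ≤ _ := e1
      _ ≤ a ^ (1 / 2 : ℝ) * (eLpNorm g 2 volume + ε) + s * ε := by
          gcongr
          exact (hA' f).trans (by gcongr)
      _ = _ := by ring
  rw [← ENNReal.pow_le_pow_left_iff two_ne_zero, mul_pow, eLpNorm_two_sq, eLpNorm_two_sq,
    ← ENNReal.rpow_natCast (a ^ _), ← ENNReal.rpow_mul] at key
  simp only [enorm_eq_self, lintegral_kernOp_sq] at key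
  norm_num at key
  refine absurd hgt (not_lt.2 ?_)
  rw [← ENNReal.mul_le_mul_iff_right hc0 hct]
  refine key.trans_eq ?_
  rw [← mul_assoc, ENNReal.mul_div_cancel hc0 hct]

/-- In the limit, the positive operator applied to |g| would attain the sharp constant,
contradicting strictness, which holds for all nonzero square integrable functions. -/
theorem ae_eq_zero_of_tendsto (h : Admissible n α β ρ) (F : ℕ → 𝓢(Space m n, ℂ))
    {g : Space m n → ℂ} (hg : MemLp g 2)
    (hF : Tendsto (fun j => eLpNorm (iterated α β ρ (F j) - g) 2 volume) atTop (𝓝 0))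
    (hl : Tendsto (fun j => ∫ x : EuclideanSpace ℝ (Fin n), ‖F j (diag m x)‖ ^ 2) atTop
      (𝓝 (sharpConst n α ρ * ∫ x, ‖g x‖ ^ 2))) : g =ᵐ[volume] 0 := by
  have hgt : eLpNorm g 2 volume ^ 2 ≠ ∞ := ENNReal.pow_ne_top hg.2.ne
  have hl2 : Tendsto (fun j =>
      eLpNorm (fun x : EuclideanSpace ℝ (Fin n) => F j (diag m x)) 2 volume ^ 2) atTop
      (𝓝 (ENNReal.ofReal (sharpConst n α ρ) * eLpNorm g 2 volume ^ 2)) := by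
    have h1 := ENNReal.tendsto_ofReal hl
    rw [integral_norm_sq_eq hg.1, ENNReal.ofReal_mul (sharpConst_pos h).le,
      ENNReal.ofReal_toReal hgt] at h1
    refine h1.congr fun j => ?_
    rw [integral_norm_sq_eq (aestronglyMeasurable_comp_diag _),
      ENNReal.ofReal_toReal (ENNReal.pow_ne_top (memLp_comp_diag h _).2.ne)]
  set s := ENNReal.ofReal (sharpConst n α ρ) ^ (1 / 2 : ℝ) with hs
  have hb : ∀ j, eLpNorm (fun x : EuclideanSpace ℝ (Fin n) => F j (diag m x)) 2 volume ≤
      eLpNorm (kernOp α β ρ fun y => ‖g y‖ₑ) 2 volume +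
        s * eLpNorm (iterated α β ρ (F j) - g) 2 volume := fun j => by
    have hd : AEMeasurable fun y => ‖iterated α β ρ (F j) y - g y‖ₑ :=
      ((measurable_iterated α β ρ (F j)).aestronglyMeasurable.sub hg.1).enorm
    calc _ ≤ _ := eLpNorm_diag_le_kernOp h (F j)
      _ ≤ eLpNorm ((kernOp α β ρ fun y => ‖g y‖ₑ) +
          kernOp α β ρ fun y => ‖iterated α β ρ (F j) y - g y‖ₑ) 2 volume := by
          refine eLpNorm_mono_enorm fun x => ?_
          refine kernOp_le_add hg.1.enorm (fun y => ?_) x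
          calc ‖iterated α β ρ (F j) y‖ₑ = ‖g y + (iterated α β ρ (F j) y - g y)‖ₑ := by
                rw [add_sub_cancel]
            _ ≤ _ := enorm_add_le _ _
      _ ≤ _ := eLpNorm_add_le (measurable_kernOp hg.1.enorm).aestronglyMeasurable
          (measurable_kernOp hd).aestronglyMeasurable (by norm_num)
      _ ≤ _ := by
          gcongr
          exact (eLpNorm_kernOp_le h hd).trans
            (mul_le_mul_right (eLpNorm_mono_enorm fun x => le_rfl) _)
  have hr : Tendsto (fun j => (eLpNorm (kernOp α β ρ fun y => ‖g y‖ₑ) 2 volume +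
      s * eLpNorm (iterated α β ρ (F j) - g) 2 volume) ^ 2) atTop
      (𝓝 (eLpNorm (kernOp α β ρ fun y => ‖g y‖ₑ) 2 volume ^ 2)) := by
    have h1 := (ENNReal.Tendsto.const_mul (a := s) hF (Or.inr (by finiteness))).const_add
      (eLpNorm (kernOp α β ρ fun y => ‖g y‖ₑ) 2 volume)
    rw [mul_zero, add_zero] at h1
    exact ENNReal.Tendsto.pow h1
  have hle := le_of_tendsto_of_tendsto' hl2 hr fun j => pow_le_pow_left' (hb j) 2
  by_contra hg0
  rw [eLpNorm_two_sq] at hgt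
  rw [eLpNorm_two_sq, eLpNorm_two_sq] at hle
  refine absurd (lintegral_kernOp_sq_lt h hg.1.enorm hgt fun h0 => hg0 ?_) (not_lt.2 hle)
  filter_upwards [h0] with y hy
  exact enorm_eq_zero.1 hy

end Inequality

end IteratedSteinWeiss

end

theorem mainTheorem6 (m n : ℕ) (α β ρ : Fin m → ℝ)
    (hα : ∀ k, 0 < α k ∧ α k < n) (hβ : ∀ k, 0 < β k ∧ β k < n) (hρ : ∀ k, 0 < ρ k ∧ ρ k < n)
    (hbal : (n : ℝ) - ∑ k, β k - ∑ k, ρ k = (m : ℝ) * n - ∑ k, α k)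
    (hpos : 0 < ∑ k, β k + ∑ k, ρ k) (hlt : ∑ k, β k + ∑ k, ρ k < n) :
    -- both sides of the inequality are well defined and finite for Schwartz functions
    (∀ f : 𝓢(IteratedSteinWeiss.Space m n, ℂ),
      MemLp (IteratedSteinWeiss.fracLapFourier α (IteratedSteinWeiss.weighted β f)) 2 volume ∧
      MemLp (IteratedSteinWeiss.iterated α β ρ f) 2 volume ∧
      MemLp (fun x : EuclideanSpace ℝ (Fin n) => f (IteratedSteinWeiss.diag m x)) 2 volume) ∧
    -- the integral of `H` is finite
    (∫⁻ x : ℝ, IteratedSteinWeiss.kernelH n α ρ x) ≠ ∞ ∧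
    -- the inequality holds with the constant `C`, and `C` is the smallest such constant
    IsLeast {A : ℝ | ∀ f : 𝓢(IteratedSteinWeiss.Space m n, ℂ),
        ∫ x : EuclideanSpace ℝ (Fin n), ‖f (IteratedSteinWeiss.diag m x)‖ ^ 2 ≤
          A * ∫ x, ‖IteratedSteinWeiss.iterated α β ρ f x‖ ^ 2}
      (IteratedSteinWeiss.sharpConst n α ρ) ∧
    -- no extremals among Schwartz functions
    (∀ f : 𝓢(IteratedSteinWeiss.Space m n, ℂ), f ≠ 0 →
      ∫ x : EuclideanSpace ℝ (Fin n), ‖f (IteratedSteinWeiss.diag m x)‖ ^ 2 <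
        IteratedSteinWeiss.sharpConst n α ρ *
          ∫ x, ‖IteratedSteinWeiss.iterated α β ρ f x‖ ^ 2) ∧
    -- no extremals in the completion with respect to the norm on the right-hand side
    (∀ (F : ℕ → 𝓢(IteratedSteinWeiss.Space m n, ℂ)) (g : IteratedSteinWeiss.Space m n → ℂ),
      MemLp g 2 volume →
      Tendsto (fun j => eLpNorm (IteratedSteinWeiss.iterated α β ρ (F j) - g) 2 volume)
        atTop (𝓝 0) →
      Tendsto (fun j => ∫ x : EuclideanSpace ℝ (Fin n),
          ‖F j (IteratedSteinWeiss.diag m x)‖ ^ 2)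
        atTop (𝓝 (IteratedSteinWeiss.sharpConst n α ρ * ∫ x, ‖g x‖ ^ 2)) →
      g =ᵐ[volume] 0) := by
  -- For m = 0 all sums vanish, against 0 < β + ρ; then n > 0 follows from 0 < α_0 < n.
  have hm : 0 < m := by
    rcases Nat.eq_zero_or_pos m with rfl | h
    · simp at hpos
    · exact h
  have hn : 0 < n := by
    have := (hα ⟨0, hm⟩).1.trans (hα ⟨0, hm⟩).2
    exact_mod_cast this
  have h : IteratedSteinWeiss.Admissible n α β ρ := ⟨hn, hm, hα, fun k => (hβ k).1, hρ, hbal⟩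
  exact ⟨fun f => ⟨IteratedSteinWeiss.memLp_fracLapFourier hn
        (fun k => ⟨(hα k).1.le, (hα k).2⟩) (fun k => (hβ k).1.le) f,
      IteratedSteinWeiss.memLp_iterated h f, IteratedSteinWeiss.memLp_comp_diag h f⟩,
    IteratedSteinWeiss.lintegral_kernelH_ne_top hn hm hα h.hβ hρ hbal,
    ⟨IteratedSteinWeiss.integral_diag_le h, fun _ hA => IteratedSteinWeiss.sharpConst_le h hA⟩,
    fun _ => IteratedSteinWeiss.integral_diag_lt h,
    fun F _ => IteratedSteinWeiss.ae_eq_zero_of_tendsto h F⟩
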